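/- All $\mathbb C[[\hbar]]$-modules $V,W$ below are topologically free (torsion-free, separated and complete for the $\hbar$-adic topology); $\mathrm{End}$ denotes $\mathbb C[[\hbar]]$-linear endomorphisms; $M_\hbar((x))$ is the set of $\sum_{n\in\mathbb Z}\psi(n)x^n\in M[[x,x^{-1}]]$ with $\psi(-n)\to 0$ $\hbar$-adically as $n\to\infty$. An $\hbar$-adic nonlocal vertex algebra is a topologically free $V$ with a $\mathbb C[[\hbar]]$-linear map $Y(\cdot,x):V\to(\mathrm{End}\,V)[[x,x^{-1}]]$, $Y(v,x)=\sum_n v_nx^{-n-1}$, and a vector $\mathbf 1\in V$ such that $Y(u,x)v\in V_\hbar((x))$, $Y(\mathbf 1,x)=1$, $Y(v,x)\mathbf 1\in V[[x]]$ has constant term $v$, and for all $u,v,w\in V$ and $n\ge 1$ there is $l\in\mathbb N$ with $$(x_0+x_2)^lY(u,x_0+x_2)Y(v,x_2)w\equiv(x_2+x_0)^lY(Y(u,x_0)v,x_2)w \pmod{\hbar^n}.$$ A $V$-module is a topologically free $W$ with a $\mathbb C[[\hbar]]$-linear map $Y_W(\cdot,x):V\to(\mathrm{End}\,W)[[x,x^{-1}]]$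 such that $Y_W(v,x)w\in W_\hbar((x))$, $Y_W(\mathbf 1,x)=1_W$, and the same weak associativity holds with $Y_W(u,\cdot)$, $Y_W(v,\cdot)$, $Y_W(Y(u,x_0)v,x_2)$ acting on $w\in W$. For a series $F(x)$ let $F^+(x)$ and $F^-(x)$ be its parts with non-negative and with negative powers of $x$. **Proposition.** Let $V$ be an $\hbar$-adic nonlocal vertex algebra and $(W,Y_W)$ a $V$-module. Let $a\in V$ and $\gamma(x)\in x^{-1}\mathbb C[x^{-1}][[\hbar]]$ be such that $$[Y^{\pm}(a,x_1),Y^{\pm}(a,x_2)]=0,\qquad [Y^-(a,x_1),Y^+(a,x_2)]=\gamma(x_1-x_2),$$ where $\gamma(x_1-x_2)$ is expanded in non-negative powers of $x_2$. Let $z\in\hbar\,\mathbb C[[\hbar]]$. On $V$ and $W$ put, for a formal variable $x$, $$E^{\pm}(a,x)=\exp\Big(\sum_{n\in\pm\mathbb Z_{+}}\tfrac1n a_nx^{-n}\Big),$$ let $E^-(a,z)$ be given by the same formula with $z$ in place of $x$, let $E^{\pm}(a,x+z)=e^{z\partial_x}E^{\pm}(a,x)$, let $L(t)=\frac{e^t-1}{t}$,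 and let $(1+\frac zx)^{a_0}=\exp\big(a_0\log(1+\frac zx)\big)$. Then all series below converge $\hbar$-adically (pointwise and coefficient by coefficient), and on $W$ $$Y_W(E^-(-a,z)\mathbf 1,x)=\exp\big(zL(z\partial_x)Y_W^+(a,x)\big)\exp\big(zL(z\partial_x)Y_W^-(a,x)\big)$$ $$=E^-(-a,x+z)\,E^-(a,x)\,\Big(1+\frac zx\Big)^{a_0}E^+(-a,x+z)\,E^+(a,x).$$ If moreover the coefficient of $x^{-1}$ in $\gamma(x)$ is zero, then this also equals $$\Big(1+\frac zx\Big)^{a_0}E^-(-a,x+z)\,E^-(a,x)\,E^+(-a,x+z)\,E^+(a,x).$$ -/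

import Mathlib

open scoped PowerSeries

noncomputable section

namespace HAdic

/-- The submodule `ħ^r M` of a `ℂ[[ħ]]`-module `M`; the variable `ħ` is `PowerSeries.X`. -/
def hFil (M : Type*) [AddCommGroup M] [Module ℂ⟦X⟧ M] (r : ℕ) : Submodule ℂ⟦X⟧ M :=
  LinearMap.range (LinearMap.lsmul ℂ⟦X⟧ M ((PowerSeries.X : ℂ⟦X⟧) ^ r))

/-- Topologically free `ℂ[[ħ]]`-modules: separated, `ħ`-adically complete and `ħ`-torsion-free
(equivalently, of the form `M₀[[ħ]]` for a complex vector space `M₀`). -/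
structure TopFree (M : Type*) [AddCommGroup M] [Module ℂ⟦X⟧ M] : Prop where
  complete : IsAdicComplete (Ideal.span {(PowerSeries.X : ℂ⟦X⟧)}) M
  torsionFree : ∀ m : M, (PowerSeries.X : ℂ⟦X⟧) • m = 0 → m = 0

section Sums

variable {ι M : Type*} [AddCommGroup M] [Module ℂ⟦X⟧ M]

/-- Convergence of the family `f` to the sum `s` in the `ħ`-adic topology. -/
def HasHSum (f : ι → M) (s : M) : Prop :=
  ∀ r : ℕ, ∃ F₀ : Finset ι, ∀ F : Finset ι, F₀ ⊆ F → (∑ i ∈ F, f i) - s ∈ hFil M r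

/-- Pointwise `ħ`-adic convergence of a family of operators. -/
def HasOpSum (f : ι → Module.End ℂ⟦X⟧ M) (T : Module.End ℂ⟦X⟧ M) : Prop :=
  ∀ m : M, HasHSum (fun i => f i m) (T m)

def OpSummable (f : ι → Module.End ℂ⟦X⟧ M) : Prop := ∃ T, HasOpSum f T

open Classical in
/-- The sum of a convergent family of operators (and `0` if the family does not converge). -/
def opSum (f : ι → Module.End ℂ⟦X⟧ M) : Module.End ℂ⟦X⟧ M :=
  if h : OpSummable f then h.choose else 0

/-- `exp T = ∑ T^k / k!`. -/
def opExp (T : Module.End ℂ⟦X⟧ M) : Module.End ℂ⟦X⟧ M :=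
  opSum fun k : ℕ => (PowerSeries.C (1 / (k.factorial : ℂ)) : ℂ⟦X⟧) • T ^ k

def OpExpConv (T : Module.End ℂ⟦X⟧ M) : Prop :=
  OpSummable fun k : ℕ => (PowerSeries.C (1 / (k.factorial : ℂ)) : ℂ⟦X⟧) • T ^ k

end Sums

/-- `(End M)[[x, x⁻¹]]`: the value at `n` is the coefficient of `x ^ n`. -/
abbrev FSeries (M : Type*) [AddCommGroup M] [Module ℂ⟦X⟧ M] := ℤ → Module.End ℂ⟦X⟧ M

/-- `M_ħ((x))`: the coefficient of `x^(-n)` tends to `0` in the `ħ`-adic topology as `n → ∞`. -/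
def IsHLaurent {M : Type*} [AddCommGroup M] [Module ℂ⟦X⟧ M] (ψ : ℤ → M) : Prop :=
  ∀ r : ℕ, ∃ k : ℕ, ∀ n : ℕ, k ≤ n → ψ (-(n : ℤ)) ∈ hFil M r

section Series

variable {M : Type*} [AddCommGroup M] [Module ℂ⟦X⟧ M]

/-- The constant series `1`. -/
def fone : FSeries M := fun n => if n = 0 then 1 else 0

/-- The mode `a_n` of `a(x) = ∑ a_n x^(-n-1)`. -/
def mode (F : FSeries M) (n : ℤ) : Module.End ℂ⟦X⟧ M := F (-n - 1)

/-- The regular part (non-negative powers of `x`). -/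
def regPart (F : FSeries M) : FSeries M := fun n => if 0 ≤ n then F n else 0

/-- The singular part (negative powers of `x`). -/
def singPart (F : FSeries M) : FSeries M := fun n => if n < 0 then F n else 0

/-- The product `A(x) B(x)`; the coefficients are pointwise `ħ`-adically convergent sums. -/
def fmul (A B : FSeries M) : FSeries M := fun n => opSum fun i : ℤ => A i * B (n - i)

infixl:70 " ⊛ " => fmul

def MulConv (A B : FSeries M) : Prop := ∀ n : ℤ, OpSummable fun i : ℤ => A i * B (n - i)

def fpow (A : FSeries M) : ℕ → FSeries M
  | 0 => fone
  | k + 1 => A ⊛ fpow A k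

/-- `exp A(x) = ∑ A(x)^k / k!`. -/
def fexp (A : FSeries M) : FSeries M := fun n =>
  opSum fun k : ℕ => (PowerSeries.C (1 / (k.factorial : ℂ)) : ℂ⟦X⟧) • fpow A k n

def ExpConv (A : FSeries M) : Prop :=
  (∀ k : ℕ, MulConv A (fpow A k)) ∧
    ∀ n : ℤ, OpSummable fun k : ℕ =>
      (PowerSeries.C (1 / (k.factorial : ℂ)) : ℂ⟦X⟧) • fpow A k n

/-- The formal derivative with respect to `x`. -/
def dx (A : FSeries M) : FSeries M := fun n => (n + 1) • A (n + 1)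

/-- `z L(z ∂ₓ) A(x) = ∑_{k ≥ 0} z^(k+1) / (k+1)! ∂ₓ^k A(x)`, where `L(t) = (e^t - 1) / t`. -/
def zL (z : ℂ⟦X⟧) (A : FSeries M) : FSeries M := fun n =>
  opSum fun k : ℕ =>
    (PowerSeries.C (1 / ((k + 1).factorial : ℂ)) * z ^ (k + 1) : ℂ⟦X⟧) • (dx^[k] A) n

def ZLConv (z : ℂ⟦X⟧) (A : FSeries M) : Prop :=
  ∀ n : ℤ, OpSummable fun k : ℕ =>
    (PowerSeries.C (1 / ((k + 1).factorial : ℂ)) * z ^ (k + 1) : ℂ⟦X⟧) • (dx^[k] A) n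

/-- `A(x + z) = e^(z ∂ₓ) A(x)`: expansion in non-negative powers of `z`. -/
def shift (z : ℂ⟦X⟧) (A : FSeries M) : FSeries M := fun n =>
  opSum fun k : ℕ => (PowerSeries.C (1 / (k.factorial : ℂ)) * z ^ k : ℂ⟦X⟧) • (dx^[k] A) n

def ShiftConv (z : ℂ⟦X⟧) (A : FSeries M) : Prop :=
  ∀ n : ℤ, OpSummable fun k : ℕ =>
    (PowerSeries.C (1 / (k.factorial : ℂ)) * z ^ k : ℂ⟦X⟧) • (dx^[k] A) n

/-- `∑_{n < 0} (1/n) a_n x^(-n)`; the coefficient of `x^m` is the term with `n = -m`. -/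
def minusLog (F : FSeries M) : FSeries M := fun m =>
  if 0 < m then (PowerSeries.C (1 / ((-m : ℤ) : ℂ)) : ℂ⟦X⟧) • mode F (-m) else 0

/-- `∑_{n > 0} (1/n) a_n x^(-n)`; the coefficient of `x^m` is the term with `n = -m`. -/
def plusLog (F : FSeries M) : FSeries M := fun m =>
  if m < 0 then (PowerSeries.C (1 / ((-m : ℤ) : ℂ)) : ℂ⟦X⟧) • mode F (-m) else 0

/-- `E⁻(a, x)` for `a(x) = F`. -/
def EMinus (F : FSeries M) : FSeries M := fexp (minusLog F)

/-- `E⁺(a, x)` for `a(x) = F`. -/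
def EPlus (F : FSeries M) : FSeries M := fexp (plusLog F)

/-- The terms `(1/n) a_n z^(-n)`, `n = -(k+1) < 0`, for a scalar `z`. -/
def minusTerm (F : FSeries M) (z : ℂ⟦X⟧) (k : ℕ) : Module.End ℂ⟦X⟧ M :=
  (PowerSeries.C (1 / (-((k : ℂ) + 1))) * z ^ (k + 1) : ℂ⟦X⟧) • mode F (-((k : ℤ) + 1))

/-- `E⁻(a, z) = exp (∑_{n < 0} (1/n) a_n z^(-n))` for a scalar `z ∈ ħ ℂ[[ħ]]`. -/
def EMinusAt (F : FSeries M) (z : ℂ⟦X⟧) : Module.End ℂ⟦X⟧ M := opExp (opSum (minusTerm F z))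

/-- `T log(1 + z/x) = ∑_{k ≥ 1} ((-1)^(k-1) / k) z^k T x^(-k)`. -/
def logTerm (z : ℂ⟦X⟧) (T : Module.End ℂ⟦X⟧ M) : FSeries M := fun m =>
  if m < 0 then
    (PowerSeries.C ((-1 : ℂ) ^ (m.natAbs + 1) / (m.natAbs : ℂ)) * z ^ m.natAbs : ℂ⟦X⟧) • T
  else 0

/-- `(1 + z/x)^T = exp (T log(1 + z/x))`. -/
def onePlusPow (z : ℂ⟦X⟧) (T : Module.End ℂ⟦X⟧ M) : FSeries M := fexp (logTerm z T)

end Series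

/-- Weak associativity modulo `ħ^n` with exponent `l`: the coefficient of `x₀^p x₂^q` in
`(x₀+x₂)^l Y(u, x₀+x₂) Y(v, x₂) w` (powers of `x₀+x₂` expanded in non-negative powers of `x₂`)
is the convergent sum `s`, and the one in `(x₂+x₀)^l Y(Y(u, x₀)v, x₂) w` is the finite sum. -/
def WeakAssocMod {V W : Type*} [AddCommGroup V] [Module ℂ⟦X⟧ V] [AddCommGroup W]
    [Module ℂ⟦X⟧ W] (Y : V → FSeries V) (YW : V → FSeries W) (u v : V) (w : W) (n l : ℕ) : Prop :=
  ∀ p q : ℤ, ∃ s : W,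
    HasHSum (fun i : ℕ => Ring.choose (p + i) i • YW u (p + i - l) (YW v (q - i) w)) s ∧
    s - ∑ j ∈ Finset.range (l + 1), l.choose j • YW (Y u (p - j) v) (q - l + j) w ∈ hFil W n

/-- `ħ`-adic nonlocal vertex algebra structures on `V`. -/
structure NonlocalVA (V : Type*) [AddCommGroup V] [Module ℂ⟦X⟧ V] where
  topFree : TopFree V
  Y : V →ₗ[ℂ⟦X⟧] FSeries V
  vac : V
  laurent : ∀ u v : V, IsHLaurent fun n => Y u n v
  vac_left : Y vac = fone
  creation_regular : ∀ (v : V) (n : ℤ), n < 0 → Y v n vac = 0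
  creation_zero : ∀ v : V, Y v 0 vac = v
  weakAssoc : ∀ (u v w : V) (n : ℕ), 0 < n → ∃ l : ℕ, WeakAssocMod Y Y u v w n l

/-- Modules for an `ħ`-adic nonlocal vertex algebra. -/
structure VAModule {V : Type*} [AddCommGroup V] [Module ℂ⟦X⟧ V] (A : NonlocalVA V)
    (W : Type*) [AddCommGroup W] [Module ℂ⟦X⟧ W] where
  topFree : TopFree W
  Y : V →ₗ[ℂ⟦X⟧] FSeries W
  laurent : ∀ (v : V) (w : W), IsHLaurent fun n => Y v n w
  vac_left : Y A.vac = fone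
  weakAssoc : ∀ (u v : V) (w : W) (n : ℕ), 0 < n → ∃ l : ℕ, WeakAssocMod A.Y Y u v w n l

/-- `γ(x) = ∑ γ_n x^n` belongs to `x⁻¹ ℂ[x⁻¹][[ħ]]`: only negative powers of `x` occur, and for
each `r` the coefficient of `ħ^r` is a polynomial in `x⁻¹`. -/
def IsSingularPoly (γ : ℤ → ℂ⟦X⟧) : Prop :=
  (∀ n : ℤ, 0 ≤ n → γ n = 0) ∧ ∀ r : ℕ, {n : ℤ | PowerSeries.coeff r (γ n) ≠ 0}.Finite

/-- The coefficient of `x₁^m x₂^n` in `γ(x₁ - x₂)`, expanded in non-negative powers of `x₂`. -/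
def diffCoeff (γ : ℤ → ℂ⟦X⟧) (m n : ℤ) : ℂ⟦X⟧ :=
  if 0 ≤ n then ((-1 : ℤ) ^ n.toNat * Ring.choose (m + n) n.toNat) • γ (m + n) else 0

end HAdic

end

open HAdic

/-! Modulo `ħ^r`, weak associativity says that in a fixed total degree `Y_W(u, x₁)Y_W(v, x₂)w` and
`Y_W(Y(u, x₀)v, x₂)w` are the expansions at `x = ∞` and at `x = 1` of one rational function of `x =
x₁/x₂`, whose only other possible pole is `x = 0`. Removing the polar part at `x = 1` leaves a
Laurent polynomial, an abstract normally ordered product (`VAModule.normalCoeff_spec`), whose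
binomial moments are the coefficients of `Y_W(u_{-p-1}v, x₂)w` (`VAModule.hasHSum_normalCoeff`).

Two consequences carry the first formula. The Heisenberg relations pass from `V` to `W`
(`HeisenbergRel.module`), because a Laurent polynomial is determined by its binomial moments. The
commutator formula for `Y_W⁻(a, x₁)` holds for all vectors obtained from `1` by creation modes of
`a` and `ħ`-adic limits (`VAModule.mode_mem_commCore`), so for them the abstract normal product is
the usual one. With `T = ∫₀^z Y⁺(a, t) dt`, `P = zL(z∂)Y_W⁺(a, x)` and `Q = zL(z∂)Y_W⁻(a, x)`, this
gives `Y_W(Tv) = P Y_W(v) + Y_W(v) Q` (`VAModule.Y_primitive_eq`). Left multiplication by `P`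
commutes with right multiplication by `Q`, so the binomial theorem computes `Y_W(T^N 1)`; dividing
by `N!` and summing gives `exp P · exp Q`, while `E⁻(-a, z) = exp T`.

For the second formula, `e^{z∂}F = F + zL(z∂)F'` and `e^{z∂}` is multiplicative, so `e^{F(x+z)}
e^{-F(x)} = exp(zL(z∂)F')` when the coefficients of `F` commute
(`IsClosedModel.shift_exp_mul_exp_neg`). This is applied to antiderivatives of `Y_W⁺` and of `Y_W⁻`
without its residue term; the residue `a_0 x⁻¹` contributes `a_0 log(1 + z/x)`. If `γ` has no `x⁻¹`
term, `a_0` commutes with the creation modes and its factor can be moved to the left. -/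

namespace HAdic

/-! ### The `ħ`-adic filtration. -/

section Filtration

variable {M N : Type*} [AddCommGroup M] [Module ℂ⟦X⟧ M] [AddCommGroup N] [Module ℂ⟦X⟧ N]

theorem mem_hFil {r : ℕ} {m : M} :
    m ∈ hFil M r ↔ ∃ y : M, (PowerSeries.X : ℂ⟦X⟧) ^ r • y = m := by
  simp [hFil]

theorem mem_hFil_zero (m : M) : m ∈ hFil M 0 := mem_hFil.2 ⟨m, by simp⟩

theorem hFil_antitone {r s : ℕ} (h : r ≤ s) : hFil M s ≤ hFil M r := by
  intro m hm
  obtain ⟨y, rfl⟩ := mem_hFil.1 hm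
  refine mem_hFil.2 ⟨(PowerSeries.X : ℂ⟦X⟧) ^ (s - r) • y, ?_⟩
  rw [smul_smul, ← pow_add, Nat.add_sub_cancel' h]

theorem hFil_eq_smul_top (r : ℕ) :
    hFil M r = ((Ideal.span {(PowerSeries.X : ℂ⟦X⟧)}) ^ r • ⊤ : Submodule ℂ⟦X⟧ M) := by
  ext m
  rw [Ideal.span_singleton_pow, Submodule.ideal_span_singleton_smul,
    Submodule.mem_smul_pointwise_iff_exists, mem_hFil]
  simp

theorem map_mem_hFil (L : M →ₗ[ℂ⟦X⟧] N) {r : ℕ} {m : M} (hm : m ∈ hFil M r) :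
    L m ∈ hFil N r := by
  obtain ⟨y, rfl⟩ := mem_hFil.1 hm
  exact mem_hFil.2 ⟨L y, by rw [map_smul]⟩

theorem smul_mem_hFil_add {r s : ℕ} {c : ℂ⟦X⟧} (hc : (PowerSeries.X : ℂ⟦X⟧) ^ r ∣ c) {m : M}
    (hm : m ∈ hFil M s) : c • m ∈ hFil M (r + s) := by
  obtain ⟨y, rfl⟩ := mem_hFil.1 hm
  obtain ⟨d, rfl⟩ := hc
  refine mem_hFil.2 ⟨d • y, ?_⟩
  rw [smul_smul, smul_smul, pow_add]
  congr 1
  ring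

theorem smul_mem_hFil {r : ℕ} {c : ℂ⟦X⟧} (hc : (PowerSeries.X : ℂ⟦X⟧) ^ r ∣ c) (m : M) :
    c • m ∈ hFil M r := smul_mem_hFil_add hc (mem_hFil_zero m)

theorem TopFree.eq_zero (hM : TopFree M) {m : M} (h : ∀ r, m ∈ hFil M r) : m = 0 := by
  have := hM.complete
  refine IsHausdorff.haus' (I := Ideal.span {(PowerSeries.X : ℂ⟦X⟧)}) m fun n => ?_
  rw [SModEq.zero, ← hFil_eq_smul_top]
  exact h n

theorem TopFree.eq_of_sub_mem (hM : TopFree M) {m n : M} (h : ∀ r, m - n ∈ hFil M r) : m = n :=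
  sub_eq_zero.1 (hM.eq_zero h)

end Filtration

/-- A family tends to `0` in the `ħ`-adic topology along the cofinite filter. -/
def HNull {ι M : Type*} [AddCommGroup M] [Module ℂ⟦X⟧ M] (f : ι → M) : Prop :=
  ∀ r : ℕ, ∃ F : Finset ι, ∀ i ∉ F, f i ∈ hFil M r

/-! ### Unordered `ħ`-adic sums and interchange of summations. -/

section Sums

variable {ι κ M N : Type*} [AddCommGroup M] [Module ℂ⟦X⟧ M] [AddCommGroup N] [Module ℂ⟦X⟧ N]

theorem sum_sub_sum_mem_hFil {f : ι → M} {r : ℕ} {F G : Finset ι}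
    (hFG : F ⊆ G) (h : ∀ i ∉ F, f i ∈ hFil M r) :
    ∑ i ∈ G, f i - ∑ i ∈ F, f i ∈ hFil M r := by
  classical
  rw [← Finset.sum_sdiff hFG, add_sub_cancel_right]
  exact Submodule.sum_mem _ fun i hi => h i (Finset.mem_sdiff.1 hi).2

theorem HasHSum.null {f : ι → M} {s : M} (h : HasHSum f s) : HNull f := by
  classical
  intro r
  obtain ⟨F, hF⟩ := h r
  refine ⟨F, fun i hi => ?_⟩
  have h1 := hF F le_rfl
  have h2 := hF (insert i F) (Finset.subset_insert _ _)
  rw [Finset.sum_insert hi] at h2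
  simpa using Submodule.sub_mem _ h2 h1

theorem hasHSum_of_forall_exists {f : ι → M} {s : M}
    (h : ∀ r, ∃ F : Finset ι, (∀ i ∉ F, f i ∈ hFil M r) ∧ ∑ i ∈ F, f i - s ∈ hFil M r) :
    HasHSum f s := by
  intro r
  obtain ⟨F, hF, hs⟩ := h r
  refine ⟨F, fun G hG => ?_⟩
  simpa using Submodule.add_mem _ (sum_sub_sum_mem_hFil hG hF) hs

theorem HasHSum.sum_sub_mem {f : ι → M} {s : M} (h : HasHSum f s) {r : ℕ} {F : Finset ι}
    (hF : ∀ i ∉ F, f i ∈ hFil M r) : ∑ i ∈ F, f i - s ∈ hFil M r := by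
  classical
  obtain ⟨G, hG⟩ := h r
  have h1 := hG (F ∪ G) Finset.subset_union_right
  have h2 := sum_sub_sum_mem_hFil (Finset.subset_union_left (s₂ := G)) hF
  have := Submodule.sub_mem _ h1 h2
  simpa using this

theorem HasHSum.unique (hM : TopFree M) {f : ι → M} {s t : M} (hs : HasHSum f s)
    (ht : HasHSum f t) : s = t := by
  refine hM.eq_of_sub_mem fun r => ?_
  obtain ⟨F, hF⟩ := hs.null r
  have := Submodule.sub_mem _ (ht.sum_sub_mem hF) (hs.sum_sub_mem hF)
  simpa using this

theorem HNull.exists_hasHSum (hM : TopFree M) {f : ι → M} (h : HNull f) : ∃ s, HasHSum f s := by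
  classical
  choose F hF using h
  have := hM.complete
  -- Unions make the index sets increase with `n`, so that the partial sums over them form a Cauchy
  -- sequence.
  let G : ℕ → Finset ι := fun n => (Finset.range (n + 1)).biUnion F
  have hG : ∀ n, ∀ i ∉ G n, f i ∈ hFil M n := fun n i hi =>
    hF n i fun hi' => hi (Finset.mem_biUnion.2 ⟨n, Finset.self_mem_range_succ n, hi'⟩)
  have hmono : ∀ {m n}, m ≤ n → G m ⊆ G n := fun hmn =>
    Finset.biUnion_subset_biUnion_of_subset_left _ (Finset.range_mono (by omega))
  obtain ⟨L, hL⟩ := IsPrecomplete.prec' (I := Ideal.span {(PowerSeries.X : ℂ⟦X⟧)})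
    (fun n => ∑ i ∈ G n, f i) (by
      intro m n hmn
      rw [SModEq.sub_mem, ← hFil_eq_smul_top, ← neg_sub]
      exact Submodule.neg_mem _ (sum_sub_sum_mem_hFil (hmono hmn) (hG m)))
  refine ⟨L, hasHSum_of_forall_exists fun r => ⟨G r, hG r, ?_⟩⟩
  have := hL r
  rwa [SModEq.sub_mem, ← hFil_eq_smul_top] at this

theorem HasHSum.map {f : ι → M} {s : M} (h : HasHSum f s) (L : M →ₗ[ℂ⟦X⟧] N) :
    HasHSum (fun i => L (f i)) (L s) := by
  intro r
  obtain ⟨F, hF⟩ := h r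
  refine ⟨F, fun G hG => ?_⟩
  rw [← map_sum, ← map_sub]
  exact map_mem_hFil L (hF G hG)

theorem HasHSum.add {f g : ι → M} {s t : M} (hf : HasHSum f s) (hg : HasHSum g t) :
    HasHSum (fun i => f i + g i) (s + t) := by
  classical
  intro r
  obtain ⟨F, hF⟩ := hf r
  obtain ⟨G, hG⟩ := hg r
  refine ⟨F ∪ G, fun H hH => ?_⟩
  rw [Finset.sum_add_distrib, add_sub_add_comm]
  exact Submodule.add_mem _ (hF H (Finset.union_subset_left hH))
    (hG H (Finset.union_subset_right hH))

theorem HasHSum.smul {f : ι → M} {s : M} (hf : HasHSum f s) (c : ℂ⟦X⟧) :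
    HasHSum (fun i => c • f i) (c • s) := hf.map (LinearMap.lsmul ℂ⟦X⟧ M c)

theorem HasHSum.neg {f : ι → M} {s : M} (hf : HasHSum f s) :
    HasHSum (fun i => -f i) (-s) := hf.map (-LinearMap.id)

theorem HasHSum.sub {f g : ι → M} {s t : M} (hf : HasHSum f s) (hg : HasHSum g t) :
    HasHSum (fun i => f i - g i) (s - t) := by
  simpa only [sub_eq_add_neg] using hf.add hg.neg

theorem hasHSum_sum {f : ι → M} {F : Finset ι} (h : ∀ i ∉ F, f i = 0) :
    HasHSum f (∑ i ∈ F, f i) :=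
  hasHSum_of_forall_exists fun _ => ⟨F, fun i hi => by rw [h i hi]; exact zero_mem _, by simp⟩

theorem hasHSum_single {f : ι → M} (i : ι) (h : ∀ j, j ≠ i → f j = 0) : HasHSum f (f i) := by
  simpa using hasHSum_sum (f := f) (F := {i}) fun j hj => h j (by simpa using hj)

theorem hasHSum_zero : HasHSum (fun _ : ι => (0 : M)) 0 := by
  simpa using hasHSum_sum (f := fun _ : ι => (0 : M)) (F := ∅) (by simp)

theorem HasHSum.comp_equiv {f : ι → M} {s : M} (h : HasHSum f s) (e : κ ≃ ι) :
    HasHSum (fun k => f (e k)) s := by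
  intro r
  obtain ⟨F, hF⟩ := h r
  refine ⟨F.map e.symm.toEmbedding, fun G hG => ?_⟩
  have := hF (G.map e.toEmbedding) (by
    intro i hi
    exact Finset.mem_map.2 ⟨e.symm i, hG (Finset.mem_map.2 ⟨i, hi, rfl⟩), by simp⟩)
  simpa using this

/-- Extension by zero along an injection does not change the sum. -/
theorem HasHSum.of_injective {f : ι → M} {s : M} {e : κ → ι} (he : Function.Injective e)
    (h : HasHSum (fun k => f (e k)) s) (h0 : ∀ i, i ∉ Set.range e → f i = 0) : HasHSum f s := by
  refine hasHSum_of_forall_exists fun r => ?_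
  obtain ⟨F, hF⟩ := h.null r
  refine ⟨F.map ⟨e, he⟩, fun i hi => ?_, ?_⟩
  · by_cases hi' : i ∈ Set.range e
    · obtain ⟨k, rfl⟩ := hi'
      exact hF k fun hk => hi (Finset.mem_map.2 ⟨k, hk, rfl⟩)
    · rw [h0 i hi']
      exact zero_mem _
  · simpa using h.sum_sub_mem hF

theorem HNull.comp_injective {f : ι → M} (hf : HNull f) {e : κ → ι} (he : Function.Injective e) :
    HNull fun k => f (e k) := by
  classical
  intro r
  obtain ⟨F, hF⟩ := hf r
  exact ⟨F.preimage e he.injOn, fun i hi => hF _ fun h => hi (Finset.mem_preimage.2 h)⟩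

/-- Summing a summable double family by rows. -/
theorem HasHSum.fiberwise {g : ι × κ → M} {s : M} {t : ι → M} (h : HasHSum g s)
    (ht : ∀ i, HasHSum (fun k => g (i, k)) (t i)) : HasHSum t s := by
  classical
  refine hasHSum_of_forall_exists fun r => ?_
  obtain ⟨F, hF⟩ := h.null r
  have hsub : F ⊆ F.image Prod.fst ×ˢ F.image Prod.snd := Finset.subset_product
  have key : ∀ i, ∑ k ∈ F.image Prod.snd, g (i, k) - t i ∈ hFil M r := fun i =>
    (ht i).sum_sub_mem fun k hk => hF _ fun hik =>
      hk (Finset.mem_image.2 ⟨(i, k), hik, rfl⟩)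
  refine ⟨F.image Prod.fst, fun i hi => ?_, ?_⟩
  · have h0 : ∑ k ∈ F.image Prod.snd, g (i, k) ∈ hFil M r := Submodule.sum_mem _ fun k _ =>
      hF _ fun hik => hi (Finset.mem_image.2 ⟨(i, k), hik, rfl⟩)
    simpa using Submodule.sub_mem _ h0 (key i)
  · have h1 := h.sum_sub_mem (r := r) (F := F.image Prod.fst ×ˢ F.image Prod.snd)
      fun i hi => hF i fun hi' => hi (hsub hi')
    rw [Finset.sum_product] at h1
    have h2 := Submodule.sum_mem (hFil M r) (t := F.image Prod.fst) fun i _ => key i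
    rw [Finset.sum_sub_distrib] at h2
    simpa using Submodule.sub_mem _ h1 h2

theorem HasHSum.fiberwise_right {g : ι × κ → M} {s : M} {t : κ → M} (h : HasHSum g s)
    (ht : ∀ k, HasHSum (fun i => g (i, k)) (t k)) : HasHSum t s :=
  (h.comp_equiv (Equiv.prodComm κ ι)).fiberwise ht

/-- Interchange of two summations. -/
theorem HasHSum.comm (hM : TopFree M) {g : ι × κ → M} (h : HNull g) {t : ι → M} {u : κ → M} {s : M}
    (ht : ∀ i, HasHSum (fun k => g (i, k)) (t i)) (hu : ∀ k, HasHSum (fun i => g (i, k)) (u k))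
    (hs : HasHSum t s) : HasHSum u s := by
  obtain ⟨s', hs'⟩ := h.exists_hasHSum hM
  rw [hs.unique hM (hs'.fiberwise ht)]
  exact hs'.fiberwise_right hu

/-- A double family is null if its rows are null and uniformly small outside finitely many rows. -/
theorem HNull.prod {g : ι × κ → M} (h : ∀ i, HNull fun k => g (i, k))
    (h' : ∀ r, ∃ F : Finset ι, ∀ i ∉ F, ∀ k, g (i, k) ∈ hFil M r) : HNull g := by
  classical
  intro r
  obtain ⟨F, hF⟩ := h' r
  choose G hG using fun i => h i r
  refine ⟨F.biUnion fun i => (G i).map ⟨fun k => (i, k), Prod.mk_right_injective i⟩, ?_⟩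
  rintro ⟨i, k⟩ hik
  by_cases hi : i ∈ F
  · exact hG i k fun hk => hik (Finset.mem_biUnion.2 ⟨i, hi, Finset.mem_map.2 ⟨k, hk, rfl⟩⟩)
  · exact hF i hi k

theorem HNull.prod_right {g : ι × κ → M} (h : ∀ k, HNull fun i => g (i, k))
    (h' : ∀ r, ∃ F : Finset κ, ∀ k ∉ F, ∀ i, g (i, k) ∈ hFil M r) : HNull g :=
  (HNull.prod (g := fun p : κ × ι => g (p.2, p.1)) h h').comp_injective
    (e := Equiv.prodComm ι κ) (Equiv.injective _)

theorem HNull.map {f : ι → M} (h : HNull f) (L : M →ₗ[ℂ⟦X⟧] N) : HNull fun i => L (f i) := by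
  intro r
  obtain ⟨F, hF⟩ := h r
  exact ⟨F, fun i hi => map_mem_hFil L (hF i hi)⟩

theorem HNull.add {f g : ι → M} (hf : HNull f) (hg : HNull g) : HNull fun i => f i + g i := by
  classical
  intro r
  obtain ⟨F, hF⟩ := hf r
  obtain ⟨G, hG⟩ := hg r
  exact ⟨F ∪ G, fun i hi => Submodule.add_mem _ (hF i fun h => hi (Finset.mem_union_left _ h))
    (hG i fun h => hi (Finset.mem_union_right _ h))⟩

theorem HNull.sub {f g : ι → M} (hf : HNull f) (hg : HNull g) : HNull fun i => f i - g i := by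
  simpa only [sub_eq_add_neg] using! hf.add (hg.map (-LinearMap.id))

theorem hNull_of_dvd {c : ℕ → ℂ⟦X⟧} (hc : ∀ k, (PowerSeries.X : ℂ⟦X⟧) ^ k ∣ c k) (f : ℕ → M) :
    HNull fun k => c k • f k := fun r =>
  ⟨Finset.range r, fun k hk => hFil_antitone (by simpa using hk) (smul_mem_hFil (hc k) (f k))⟩

end Sums

/-! ### Pointwise sums of operators. -/

section OpSums

variable {ι M : Type*} [AddCommGroup M] [Module ℂ⟦X⟧ M]

theorem HasOpSum.opSummable {f : ι → Module.End ℂ⟦X⟧ M} {T : Module.End ℂ⟦X⟧ M}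
    (h : HasOpSum f T) : OpSummable f := ⟨T, h⟩

theorem OpSummable.hasOpSum {f : ι → Module.End ℂ⟦X⟧ M} (h : OpSummable f) :
    HasOpSum f (opSum f) := by
  rw [opSum, dif_pos h]
  exact h.choose_spec

theorem HasOpSum.opSum_eq (hM : TopFree M) {f : ι → Module.End ℂ⟦X⟧ M} {T : Module.End ℂ⟦X⟧ M}
    (h : HasOpSum f T) : opSum f = T :=
  LinearMap.ext fun m => (h.opSummable.hasOpSum m).unique hM (h m)

/-- Uniqueness of sums makes the pointwise limit linear, so smallness at each vector is all that
convergence requires. -/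
theorem opSummable_of_hNull (hM : TopFree M) {f : ι → Module.End ℂ⟦X⟧ M}
    (h : ∀ m, HNull fun i => f i m) : OpSummable f := by
  choose T hT using fun m => (h m).exists_hasHSum hM
  refine ⟨{ toFun := T, map_add' := fun m n => ?_, map_smul' := fun c m => ?_ }, hT⟩
  · exact (hT (m + n)).unique hM (by simpa using (hT m).add (hT n))
  · exact (hT (c • m)).unique hM (by simpa using (hT m).smul c)

theorem HasOpSum.mem_hFil {f : ι → Module.End ℂ⟦X⟧ M} {T : Module.End ℂ⟦X⟧ M} (h : HasOpSum f T)
    {m : M} {r : ℕ} (hf : ∀ i, f i m ∈ hFil M r) : T m ∈ hFil M r := by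
  simpa using (h m).sum_sub_mem (r := r) (F := ∅) fun i _ => hf i

end OpSums

end HAdic

noncomputable section

namespace HAdic

/-! ### Expansions of rational functions of `x = 1 + y` at `y = ∞` and `y = 0`. -/

section Expansions

variable {Q : Type*} [AddCommGroup Q]

/-- Multiplication of a formal series in `y` by `1 + y`. -/
def mulOneAdd (C : ℤ → Q) : ℤ → Q := fun p => C p + C (p - 1)

theorem mulOneAdd_iterate (l : ℕ) (C : ℤ → Q) (p : ℤ) :
    mulOneAdd^[l] C p = ∑ j ∈ Finset.range (l + 1), l.choose j • C (p - j) := by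
  induction l generalizing p with
  | zero => simp
  | succ l ih =>
    rw [Function.iterate_succ_apply', mulOneAdd, ih, ih,
      Finset.sum_choose_succ_nsmul (fun i _ => C (p - i)) l]
    congr 1
    refine Finset.sum_congr rfl fun i _ => ?_
    congr 2
    push_cast
    ring

theorem mulOneAdd_iterate_sub (l : ℕ) (C D : ℤ → Q) :
    mulOneAdd^[l] (C - D) = mulOneAdd^[l] C - mulOneAdd^[l] D := by
  ext p
  simp [mulOneAdd_iterate, Finset.sum_sub_distrib, smul_sub]

theorem mulOneAdd_iterate_eq_zero_of_neg (l : ℕ) {C : ℤ → Q} (hC : ∀ p < 0, C p = 0) :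
    ∀ p < 0, mulOneAdd^[l] C p = 0 := by
  intro p hp
  rw [mulOneAdd_iterate]
  exact Finset.sum_eq_zero fun j _ => by rw [hC _ (by omega), smul_zero]

/-- Coefficients are eliminated upwards from the lowest one. The lower bound is essential: `1 + y`
kills the two-sided series `∑ (-1)^n y^n`. -/
theorem eq_zero_of_mulOneAdd_iterate (l : ℕ) {C : ℤ → Q} (hC : ∀ p < 0, C p = 0)
    (h : mulOneAdd^[l] C = 0) : C = 0 := by
  induction l with
  | zero => exact h
  | succ l ih =>
    apply ih
    rw [Function.iterate_succ_apply'] at h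
    have h0 := mulOneAdd_iterate_eq_zero_of_neg l hC
    generalize mulOneAdd^[l] C = D at h h0
    have key : ∀ n : ℕ, D n = 0 := by
      intro n
      induction n with
      | zero => simpa [mulOneAdd, h0 (-1) (by omega)] using congrFun h 0
      | succ n ihn =>
        have := congrFun h ((n : ℤ) + 1)
        simpa [mulOneAdd, ihn] using this
    ext p
    rcases lt_or_ge p 0 with hp | hp
    · exact h0 p hp
    · lift p to ℕ using hp
      exact key p

/-- The transform of `g` by an integral kernel. -/
def kernelSum (K : ℤ → ℤ → ℤ) (g : ℤ → Q) : ℤ → Q := fun p => ∑ᶠ m : ℤ, K p m • g m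

/-- The condition on `K` is Pascal's rule, that is `x · x^m = (1 + y) x^m`, and both expansions of
`(1 + y)^m` satisfy it. -/
theorem kernelSum_shift {K : ℤ → ℤ → ℤ} (hK : ∀ p m, K p (m + 1) = K p m + K (p - 1) m)
    {g : ℤ → Q} (hg : ∀ p, (Function.support fun m => K p m • g m).Finite) :
    kernelSum K (fun m => g (m - 1)) = mulOneAdd (kernelSum K g) := by
  ext p
  rw [mulOneAdd, kernelSum, kernelSum, kernelSum, ← finsum_add_distrib (hg p) (hg (p - 1)),
    ← finsum_comp_equiv (Equiv.addRight (1 : ℤ))]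
  simp [hK, add_smul]

/-- The coefficient of `y ^ p` in `(1 + y) ^ m`, expanded in powers of `y⁻¹`. -/
def kernelInf (p m : ℤ) : ℤ := if p ≤ m then Ring.choose m (m - p).toNat else 0

/-- The coefficient of `y ^ p` in `(1 + y) ^ m`, expanded in powers of `y`. -/
def kernelZero (p m : ℤ) : ℤ := if 0 ≤ p then Ring.choose m p.toNat else 0

theorem kernelInf_succ (p m : ℤ) : kernelInf p (m + 1) = kernelInf p m + kernelInf (p - 1) m := by
  unfold kernelInf
  rcases lt_trichotomy p (m + 1) with h | h | h
  · obtain ⟨i, rfl⟩ : ∃ i : ℕ, m = p + i := ⟨(m - p).toNat, by omega⟩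
    rw [if_pos (by omega), if_pos (by omega), if_pos (by omega),
      show (p + (i : ℤ) + 1 - p).toNat = i + 1 by omega, show (p + (i : ℤ) - p).toNat = i by omega,
      show (p + (i : ℤ) - (p - 1)).toNat = i + 1 by omega, Ring.choose_succ_succ]
  · subst h
    simp
  · rw [if_neg (by omega), if_neg (by omega), if_neg (by omega), add_zero]

theorem kernelZero_succ (p m : ℤ) :
    kernelZero p (m + 1) = kernelZero p m + kernelZero (p - 1) m := by
  unfold kernelZero
  rcases lt_trichotomy p 0 with h | h | h
  · rw [if_neg (by omega), if_neg (by omega), if_neg (by omega), add_zero]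
  · subst h
    simp
  · obtain ⟨i, rfl⟩ : ∃ i : ℕ, p = i + 1 := ⟨(p - 1).toNat, by omega⟩
    rw [if_pos (by omega), if_pos (by omega), if_pos (by omega),
      show ((i : ℤ) + 1).toNat = i + 1 by omega, show ((i : ℤ) + 1 - 1).toNat = i by omega,
      Ring.choose_succ_succ, add_comm]

theorem kernelInf_self (p : ℤ) : kernelInf p p = 1 := by simp [kernelInf]

theorem kernelInf_eq_zero_of_neg {p m : ℤ} (hp : p < 0) (hm : 0 ≤ m) : kernelInf p m = 0 := by
  lift m to ℕ using hm
  rw [kernelInf, if_pos (by omega), Ring.choose_natCast, Nat.choose_eq_zero_of_lt (by omega),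
    Nat.cast_zero]

theorem kernelInf_eq_kernelZero {p m : ℤ} (hm : 0 ≤ m) : kernelInf p m = kernelZero p m := by
  rcases lt_or_ge p 0 with hp | hp
  · rw [kernelInf_eq_zero_of_neg hp hm, kernelZero, if_neg (by omega)]
  lift m to ℕ using hm
  lift p to ℕ using hp
  rw [kernelInf, kernelZero, if_pos (show (0 : ℤ) ≤ p by omega), Int.toNat_natCast,
    Ring.choose_natCast]
  split_ifs with h
  · rw [Ring.choose_natCast, show ((m : ℤ) - p).toNat = m - p by omega,
      Nat.choose_symm (by omega)]
  · rw [Ring.choose_natCast, Nat.choose_eq_zero_of_lt (by omega), Nat.cast_zero]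

theorem support_kernelInf_finite {g : ℤ → Q} {N : ℤ} (hg : ∀ m > N, g m = 0) (p : ℤ) :
    (Function.support fun m => kernelInf p m • g m).Finite := by
  refine (Set.finite_Icc p N).subset fun m hm => ?_
  by_contra h
  rw [Set.mem_Icc, not_and_or, not_le, not_le] at h
  refine hm ?_
  rcases h with h | h
  · simp [kernelInf, not_le.2 h]
  · simp [hg m h]

theorem kernelSum_shift_iterate {K : ℤ → ℤ → ℤ} (hK : ∀ p m, K p (m + 1) = K p m + K (p - 1) m)
    {g : ℤ → Q} (hg : ∀ (l : ℕ) p, (Function.support fun m => K p m • g (m - l)).Finite) (l : ℕ) :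
    kernelSum K (fun m => g (m - l)) = mulOneAdd^[l] (kernelSum K g) := by
  induction l with
  | zero => simp
  | succ l ih =>
    rw [Function.iterate_succ_apply', ← ih, ← kernelSum_shift hK (hg l)]
    congr 1
    ext m
    congr 1
    push_cast
    ring

theorem kernelSum_sub {K : ℤ → ℤ → ℤ} {g h : ℤ → Q}
    (hg : ∀ p, (Function.support fun m => K p m • g m).Finite)
    (hh : ∀ p, (Function.support fun m => K p m • h m).Finite) :
    kernelSum K (g - h) = kernelSum K g - kernelSum K h := by
  ext p
  simp only [kernelSum, Pi.sub_apply, smul_sub]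
  exact finsum_sub_distrib (hg p) (hh p)

/-- The coefficient of `x ^ m` in `(x - 1) ^ (-i - 1)`, expanded in powers of `x⁻¹`. -/
def poleCoeff (i : ℕ) (m : ℤ) : ℤ := if m < 0 then ((-m - 1).toNat.choose i : ℤ) else 0

theorem poleCoeff_of_pos {i : ℕ} {m : ℤ} (hm : m > -1) : poleCoeff i m = 0 := by
  rw [poleCoeff, if_neg (by omega)]

theorem poleCoeff_succ (i : ℕ) (m : ℤ) :
    poleCoeff (i + 1) (m - 1) - poleCoeff (i + 1) m = poleCoeff i m := by
  unfold poleCoeff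
  rcases lt_trichotomy m 0 with h | h | h
  · obtain ⟨j, rfl⟩ : ∃ j : ℕ, m = -j - 1 := ⟨(-m - 1).toNat, by omega⟩
    rw [if_pos (by omega), if_pos (by omega), if_pos (by omega),
      show (-(-(j : ℤ) - 1 - 1) - 1).toNat = j + 1 by omega,
      show (-(-(j : ℤ) - 1) - 1).toNat = j by omega, Nat.choose_succ_succ]
    push_cast
    ring
  · subst h
    simp
  · rw [if_neg (by omega), if_neg (by omega), if_neg (by omega), sub_zero]

theorem poleCoeff_zero (m : ℤ) :
    poleCoeff 0 (m - 1) - poleCoeff 0 m = if m = 0 then 1 else 0 := by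
  unfold poleCoeff
  split_ifs <;> first | omega | simp

/-- Expanding at infinity turns `(x - 1)^(-i-1)` into the single monomial `y^(-i-1)`. Multiplication
by `x - 1 = y` shifts the index `p`, lowers the pole order, and turns the simple pole into the
constant `1`. -/
theorem kernelSum_poleCoeff (i : ℕ) (p : ℤ) :
    kernelSum kernelInf (poleCoeff i) p = if p = -i - 1 then 1 else 0 := by
  have key : ∀ j p, kernelSum kernelInf (poleCoeff j) (p - 1) =
      kernelSum kernelInf (fun m => poleCoeff j (m - 1) - poleCoeff j m) p := by
    intro j p
    have h1 : ∀ p, (Function.support fun m => kernelInf p m • poleCoeff j m).Finite :=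
      support_kernelInf_finite (N := -1) fun m hm => poleCoeff_of_pos hm
    have h2 : ∀ p, (Function.support fun m => kernelInf p m • poleCoeff j (m - 1)).Finite :=
      support_kernelInf_finite (N := 0) fun m hm => poleCoeff_of_pos (by omega)
    have h3 := congrFun (kernelSum_sub h2 h1) p
    have h4 := congrFun (kernelSum_shift kernelInf_succ h1) p
    rw [Pi.sub_apply, h4, mulOneAdd] at h3
    rw [show (fun m => poleCoeff j (m - 1) - poleCoeff j m) =
      (fun m => poleCoeff j (m - 1)) - poleCoeff j from rfl, h3]
    ring
  have key0 : ∀ j p, kernelSum kernelInf (poleCoeff j) p =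
      kernelSum kernelInf (fun m => poleCoeff j (m - 1) - poleCoeff j m) (p + 1) := by
    intro j p
    rw [← key, add_sub_cancel_right]
  induction i generalizing p with
  | zero =>
    rw [key0]
    simp only [poleCoeff_zero, kernelSum]
    rw [finsum_eq_single _ 0 fun m hm => by simp [hm]]
    simp only [kernelInf]
    rcases lt_trichotomy (p + 1) 0 with h | h | h
    · rw [if_pos (by omega), if_neg (show ¬ p = -((0 : ℕ) : ℤ) - 1 by omega)]
      obtain ⟨j, hj⟩ : ∃ j : ℕ, (0 - (p + 1)).toNat = j + 1 := ⟨(-p - 2).toNat, by omega⟩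
      rw [hj, Ring.choose_zero_succ]
      simp
    · rw [if_pos (by omega), if_pos (show p = -((0 : ℕ) : ℤ) - 1 by omega), h]
      simp
    · rw [if_neg (by omega), if_neg (show ¬ p = -((0 : ℕ) : ℤ) - 1 by omega)]
      simp
  | succ i ih =>
    rw [key0]
    simp only [poleCoeff_succ]
    rw [show (fun m => poleCoeff i m) = poleCoeff i from rfl, ih]
    congr 1
    push_cast
    simp only [eq_iff_iff]
    omega

/-- The expansion in powers of `x⁻¹` of the singular part `∑_{p < 0} C_p (x - 1) ^ p`. -/
def polarPart (C : ℤ → Q) : ℤ → Q := fun m =>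
  if m < 0 then ∑ i ∈ Finset.range (-m).toNat, ((-m - 1).toNat.choose i) • C (-i - 1) else 0

theorem polarPart_eq_sum {C : ℤ → Q} {k : ℕ} (hC : ∀ p < -(k : ℤ), C p = 0) (m : ℤ) :
    polarPart C m = ∑ i ∈ Finset.range k, poleCoeff i m • C (-i - 1) := by
  unfold polarPart poleCoeff
  split_ifs with h
  · simp only [natCast_zsmul]
    have h1 := Finset.sum_subset (s₁ := Finset.range k) (s₂ := Finset.range (k + (-m).toNat))
      (f := fun i : ℕ => ((-m - 1).toNat.choose i) • C (-i - 1)) (by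
        intro i; simp only [Finset.mem_range]; omega) (by
        intro i _ hi
        rw [hC _ (by simp only [Finset.mem_range] at hi; omega), smul_zero])
    have h2 := Finset.sum_subset (s₁ := Finset.range (-m).toNat)
      (s₂ := Finset.range (k + (-m).toNat))
      (f := fun i : ℕ => ((-m - 1).toNat.choose i) • C (-i - 1)) (by
        intro i; simp only [Finset.mem_range]; omega) (by
        intro i _ hi
        rw [Nat.choose_eq_zero_of_lt (by simp only [Finset.mem_range] at hi; omega), zero_smul])
    rw [h1, h2]
  · simp

theorem kernelSum_polarPart {C : ℤ → Q} {k : ℕ} (hC : ∀ p < -(k : ℤ), C p = 0) (p : ℤ) :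
    kernelSum kernelInf (polarPart C) p = if p < 0 then C p else 0 := by
  have h1 : kernelSum kernelInf (polarPart C) p =
      ∑ i ∈ Finset.range k, kernelSum kernelInf (poleCoeff i) p • C (-i - 1) := by
    simp only [kernelSum, polarPart_eq_sum hC, Finset.smul_sum]
    rw [finsum_sum_comm]
    · refine Finset.sum_congr rfl fun i _ => ?_
      have := AddMonoidHom.map_finsum ((zmultiplesHom Q).toFun (C (-i - 1)))
        (support_kernelInf_finite (g := poleCoeff i) (N := -1)
          (fun m hm => poleCoeff_of_pos hm) p)
      simp only [smul_eq_mul, zmultiplesHom, Equiv.toFun_as_coe, Equiv.coe_fn_mk] at this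
      simp only [smul_eq_mul]
      simpa [mul_smul] using this.symm
    · intro i _
      exact support_kernelInf_finite (g := fun m => poleCoeff i m • C (-i - 1)) (N := -1)
        (fun m hm => by rw [poleCoeff_of_pos hm, zero_smul]) p
  rw [h1]
  simp only [kernelSum_poleCoeff, ite_smul, one_smul, zero_smul]
  split_ifs with hp
  · obtain ⟨j, rfl⟩ : ∃ j : ℕ, p = -j - 1 := ⟨(-p - 1).toNat, by omega⟩
    by_cases hj : j < k
    · rw [Finset.sum_eq_single_of_mem j (Finset.mem_range.2 hj), if_pos rfl]
      intro i _ hi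
      rw [if_neg (by omega)]
    · rw [hC _ (by omega)]
      refine Finset.sum_eq_zero fun i hi => ?_
      rw [if_neg (by simp only [Finset.mem_range] at hi; omega)]
  · exact Finset.sum_eq_zero fun i _ => by rw [if_neg (by omega)]

/-- If `x ^ l f(x)`, expanded at `x = ∞` in `y = x - 1`, agrees with `(1 + y) ^ l C(y)`, where
`f` is bounded above and `C` is bounded below, then `f` minus the expansion of the singular part
of `C` is a Laurent polynomial whose expansion in `y` is the regular part of `C`. -/
theorem expansion_of_mulOneAdd {f C : ℤ → Q} {N : ℤ} {k l : ℕ} (hf : ∀ m > N, f m = 0)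
    (hC : ∀ p < -(k : ℤ), C p = 0)
    (h : kernelSum kernelInf (fun m => f (m - l)) = mulOneAdd^[l] C) :
    (∀ m < -(l : ℤ), f m - polarPart C m = 0) ∧
      ∀ p : ℕ, C p = ∑ᶠ m : ℤ, (Ring.choose m p : ℤ) • (f m - polarPart C m) := by
  set f' : ℤ → Q := f - polarPart C with hf'
  have hP : ∀ m > (-1 : ℤ), polarPart C m = 0 := fun m hm => by
    rw [polarPart, if_neg (by omega)]
  have hf'0 : ∀ m > max N (-1), f' m = 0 := fun m hm => by
    rw [hf', Pi.sub_apply, hf m (by omega), hP m (by omega), sub_zero]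
  have shift_bdd : ∀ {g : ℤ → Q} {N : ℤ}, (∀ m > N, g m = 0) → ∀ (l : ℕ) p,
      (Function.support fun m => kernelInf p m • g (m - l)).Finite := by
    intro g N hg l p
    exact support_kernelInf_finite (g := fun m => g (m - l)) (N := N + l)
      (fun m hm => hg _ (by omega)) p
  set Cp : ℤ → Q := fun p => if 0 ≤ p then C p else 0 with hCp
  have hCsub : C - kernelSum kernelInf (polarPart C) = Cp := by
    ext p
    rw [Pi.sub_apply, kernelSum_polarPart hC, hCp]
    rcases lt_or_ge p 0 with hp | hp
    · simp [hp, not_le.2 hp]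
    · simp [hp, not_lt.2 hp]
  have hmain : kernelSum kernelInf (fun m => f' (m - l)) = mulOneAdd^[l] Cp := by
    rw [← hCsub, mulOneAdd_iterate_sub, ← h,
      ← kernelSum_shift_iterate kernelInf_succ (shift_bdd hP)]
    exact kernelSum_sub (shift_bdd hf l) (shift_bdd hP l)
  have hCp0 : ∀ p < 0, Cp p = 0 := fun p hp => by rw [hCp]; simp [not_le.2 hp]
  -- The right side has no negative powers of `y`, and neither does `(1 + y)^m` for `m ≥ 0`. Hence
  -- negative powers of `x` in `x^l f'` vanish one by one from the top: `y^(-n-1)` only sees `m ≥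
  -- -n-1`.
  have hvan : ∀ n : ℕ, f' (-n - 1 - l) = 0 := by
    intro n
    induction n using Nat.strong_induction_on with
    | _ n ih =>
      have h1 := congrFun hmain (-n - 1)
      rw [mulOneAdd_iterate_eq_zero_of_neg l hCp0 _ (by omega), kernelSum,
        finsum_eq_single _ (-(n : ℤ) - 1), kernelInf_self, one_smul] at h1
      · exact h1
      · intro m hm
        rcases lt_or_ge m 0 with h0 | h0
        · rcases lt_or_ge m (-n - 1) with h2 | h2
          · rw [kernelInf, if_neg (by omega), zero_smul]
          · have := ih (-m - 1).toNat (by omega)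
            rw [show (-(((-m - 1).toNat : ℕ) : ℤ) - 1) = m by omega] at this
            rw [this, smul_zero]
        · rw [kernelInf_eq_zero_of_neg (by omega) h0, zero_smul]
  have hlow : ∀ m < -(l : ℤ), f' m = 0 := by
    intro m hm
    have := hvan (-m - 1 - l).toNat
    rwa [show (-(((-m - 1 - l).toNat : ℕ) : ℤ) - 1 - l) = m by omega] at this
  refine ⟨hlow, fun p => ?_⟩
  have hfin : ∀ (j : ℕ) p, (Function.support fun m => kernelZero p m • f' (m - j)).Finite := by
    intro j p
    refine (Set.finite_Icc (-(l : ℤ) + j) (max N (-1) + j)).subset fun m hm => ?_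
    by_contra hc
    rw [Set.mem_Icc, not_and_or, not_le, not_le] at hc
    refine hm ?_
    rcases hc with hc | hc
    · simp [hlow (m - j) (by omega)]
    · simp [hf'0 (m - j) (by omega)]
  -- Now `x^l f'` is a polynomial in `x`, so its two expansions coincide and `(1 + y)^l` can be
  -- cancelled among series bounded below.
  have hsig : mulOneAdd^[l] (kernelSum kernelZero f') = mulOneAdd^[l] Cp := by
    rw [← hmain, ← kernelSum_shift_iterate kernelZero_succ hfin]
    ext p
    simp only [kernelSum]
    refine finsum_congr fun m => ?_
    rcases lt_or_ge m 0 with hm | hm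
    · rw [hlow _ (by omega), smul_zero, smul_zero]
    · rw [kernelInf_eq_kernelZero hm]
  have hz := eq_zero_of_mulOneAdd_iterate l (C := kernelSum kernelZero f' - Cp) (by
      intro p hp
      rw [Pi.sub_apply, hCp0 p hp, sub_zero, kernelSum]
      simp [kernelZero, not_le.2 hp]) (by
      rw [mulOneAdd_iterate_sub, hsig, sub_self])
  have := congrFun hz p
  rw [Pi.sub_apply, Pi.zero_apply, sub_eq_zero] at this
  have h3 : Cp p = C p := by simp [hCp]
  rw [← h3, ← this]
  simp [kernelSum, kernelZero, hf']

/-- Values on a finite set of integers are determined by the binomial moments. -/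
theorem eq_zero_of_choose_moments {g : ℤ → Q} (hg : (Function.support g).Finite)
    (h : ∀ s : ℕ, ∑ᶠ m : ℤ, (Ring.choose m s : ℤ) • g m = 0) : g = 0 := by
  classical
  have hfin : ∀ (j : ℕ) p, (Function.support fun m => kernelZero p m • g (m - j)).Finite := by
    intro j p
    have : (Function.support fun m : ℤ => g (m - j)).Finite :=
      hg.preimage (f := fun m : ℤ => m - j) (sub_left_injective.injOn)
    exact this.subset fun m hm hm' => hm (by simp [hm'])
  have h0 : kernelSum kernelZero g = 0 := by
    ext p
    rcases lt_or_ge p 0 with hp | hp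
    · simp [kernelSum, kernelZero, not_le.2 hp]
    · lift p to ℕ using hp
      simpa [kernelSum, kernelZero] using h p
  by_contra hne
  obtain ⟨m₀, hm₀⟩ := Function.ne_iff.1 hne
  obtain ⟨b, hb⟩ := hg.bddBelow
  obtain ⟨t, ht, hmax⟩ := Set.exists_max_image _ id hg ⟨m₀, hm₀⟩
  have hbt := hb ht
  -- Multiplication by `x^|b|`, with `b` a lower bound of the support, gives a polynomial in `1 +
  -- y`. Its coefficient at the top degree `t + |b|` is `g t`.
  have h1 := congrFun (kernelSum_shift_iterate kernelZero_succ hfin b.natAbs) (t + b.natAbs)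
  have hmul : mulOneAdd^[b.natAbs] (0 : ℤ → Q) = 0 := by
    ext p
    simp [mulOneAdd_iterate]
  rw [h0, hmul, kernelSum, finsum_eq_single _ (t + b.natAbs)] at h1
  · rw [kernelZero, if_pos (by omega)] at h1
    obtain ⟨j, hj⟩ : ∃ j : ℕ, t + b.natAbs = j := ⟨(t + b.natAbs).toNat, by omega⟩
    rw [hj, Int.toNat_natCast, Ring.choose_natCast, Nat.choose_self, Nat.cast_one, one_smul,
      ← hj, add_sub_cancel_right] at h1
    exact ht h1
  · intro m hm
    by_cases hgm : g (m - b.natAbs) = 0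
    · rw [hgm, smul_zero]
    · have h2 := hb hgm
      have h3 := hmax _ hgm
      simp only [id] at h3
      obtain ⟨j, rfl⟩ : ∃ j : ℕ, m = j := ⟨m.toNat, by omega⟩
      rw [kernelZero, if_pos (by omega), Ring.choose_natCast, Nat.choose_eq_zero_of_lt (by omega),
        Nat.cast_zero, zero_smul]

end Expansions

/-! ### Reduction modulo `ħ^r`. -/

section Quotient

variable {ι M : Type*} [AddCommGroup M] [Module ℂ⟦X⟧ M]

theorem mkQ_eq_zero_iff {r : ℕ} {m : M} : (hFil M r).mkQ m = 0 ↔ m ∈ hFil M r := by simp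

theorem HNull.support_mkQ_finite {f : ι → M} (h : HNull f) (r : ℕ) :
    (Function.support fun i => (hFil M r).mkQ (f i)).Finite := by
  obtain ⟨F, hF⟩ := h r
  refine F.finite_toSet.subset fun i hi => ?_
  by_contra hi'
  exact hi (mkQ_eq_zero_iff.2 (hF i hi'))

theorem HasHSum.finsum_mkQ {f : ι → M} {s : M} (h : HasHSum f s) (r : ℕ) :
    ∑ᶠ i, (hFil M r).mkQ (f i) = (hFil M r).mkQ s := by
  obtain ⟨F, hF⟩ := h.null r
  rw [finsum_eq_sum_of_support_subset (s := F), ← map_sum, ← sub_eq_zero, ← map_sub,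
    mkQ_eq_zero_iff]
  · exact h.sum_sub_mem hF
  · intro i hi
    by_contra hi'
    exact hi (mkQ_eq_zero_iff.2 (hF i hi'))

/-- Positive exponents suffice since the filtration decreases, and weak associativity is available
only modulo `ħ^n` with `n ≥ 1`. -/
theorem hNull_of_support_mkQ_finite {f : ι → M}
    (h : ∀ r, (Function.support fun i => (hFil M (r + 1)).mkQ (f i)).Finite) : HNull f := by
  intro r
  refine ⟨(h r).toFinset, fun i hi => hFil_antitone (Nat.le_succ r) ?_⟩
  rw [Set.Finite.mem_toFinset, Function.mem_support, not_not] at hi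
  exact mkQ_eq_zero_iff.1 hi

theorem hasHSum_of_finsum_mkQ {f : ι → M} {s : M} (hf : HNull f)
    (h : ∀ r, ∑ᶠ i, (hFil M (r + 1)).mkQ (f i) = (hFil M (r + 1)).mkQ s) : HasHSum f s := by
  refine hasHSum_of_forall_exists fun r => ?_
  obtain ⟨F, hF⟩ := hf (r + 1)
  refine ⟨F, fun i hi => hFil_antitone (Nat.le_succ r) (hF i hi),
    hFil_antitone (Nat.le_succ r) ?_⟩
  rw [← mkQ_eq_zero_iff, map_sub, map_sum, sub_eq_zero, ← h r]
  refine (finsum_eq_sum_of_support_subset _ fun i hi => ?_).symm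
  by_contra hi'
  exact hi (mkQ_eq_zero_iff.2 (hF i hi'))

theorem polarPart_map {Q Q' : Type*} [AddCommGroup Q] [AddCommGroup Q'] (φ : Q →+ Q')
    (C : ℤ → Q) (m : ℤ) : φ (polarPart C m) = polarPart (fun p => φ (C p)) m := by
  unfold polarPart
  split_ifs <;> simp

theorem polarPart_of_nonneg {Q : Type*} [AddCommGroup Q] (C : ℤ → Q) {m : ℤ} (hm : 0 ≤ m) :
    polarPart C m = 0 := by
  rw [polarPart, if_neg (by omega)]

end Quotient

section Field

variable {M : Type*} [AddCommGroup M] [Module ℂ⟦X⟧ M]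

theorem IsHLaurent.exists_forall_lt {ψ : ℤ → M} (h : IsHLaurent ψ) (r : ℕ) :
    ∃ k : ℕ, ∀ n : ℤ, n ≤ -(k : ℤ) → ψ n ∈ hFil M r := by
  obtain ⟨k, hk⟩ := h r
  refine ⟨k, fun n hn => ?_⟩
  have := hk (-n).toNat (by omega)
  rwa [show -(((-n).toNat : ℕ) : ℤ) = n by omega] at this

end Field

/-! ### Normally ordered products from weak associativity. -/

section Modules

variable {V W : Type*} [AddCommGroup V] [Module ℂ⟦X⟧ V] [AddCommGroup W] [Module ℂ⟦X⟧ W]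
  {𝒱 : NonlocalVA V}

/-- `v ↦ (Y_W(v, x))_q w` as a linear map. -/
def VAModule.modeMap (𝒲 : VAModule 𝒱 W) (q : ℤ) (w : W) : V →ₗ[ℂ⟦X⟧] W where
  toFun v := 𝒲.Y v q w
  map_add' u v := by simp
  map_smul' c v := by simp

@[simp]
theorem VAModule.modeMap_apply (𝒲 : VAModule 𝒱 W) (q : ℤ) (w : W) (v : V) :
    𝒲.modeMap q w v = 𝒲.Y v q w := rfl

/-- The coefficients in degree `d` of `Y_W(Y(u, x₀)v, x₂)w`, indexed by the power of `x₀`. -/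
def VAModule.iterCoeff (𝒲 : VAModule 𝒱 W) (u v : V) (w : W) (d : ℤ) : ℤ → W :=
  fun p => 𝒲.Y (𝒱.Y u p v) (d - p) w

/-- The coefficients in degree `d` of `Y_W(u, x₁)Y_W(v, x₂)w`, minus the expansion of the part of
`Y_W(Y(u, x₁ - x₂)v, x₂)w` which is singular along `x₁ = x₂`. -/
def VAModule.normalCoeff (𝒲 : VAModule 𝒱 W) (u v : V) (w : W) (d : ℤ) : ℤ → W :=
  fun m => 𝒲.Y u m (𝒲.Y v (d - m) w) - polarPart (𝒲.iterCoeff u v w d) m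

/-- This is `expansion_of_mulOneAdd` over the quotient by `ħ^(r+1)`. The product is bounded above in
`m` by the truncation of `Y_W(v, x₂)w`, and the iterate is bounded below in `p` by that of `Y(u,
x₀)v`. -/
theorem VAModule.normalCoeff_spec (𝒲 : VAModule 𝒱 W) (u v : V) (w : W) (d : ℤ) (r : ℕ) :
    (Function.support fun m => (hFil W (r + 1)).mkQ (𝒲.normalCoeff u v w d m)).Finite ∧
      ∀ p : ℕ, (hFil W (r + 1)).mkQ (𝒲.iterCoeff u v w d p) =
        ∑ᶠ m : ℤ, (Ring.choose m p : ℤ) • (hFil W (r + 1)).mkQ (𝒲.normalCoeff u v w d m) := by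
  set π := (hFil W (r + 1)).mkQ with hπ
  obtain ⟨l, hl⟩ := 𝒲.weakAssoc u v w (r + 1) (Nat.succ_pos r)
  obtain ⟨k₁, hk₁⟩ := (𝒲.laurent v w).exists_forall_lt (r + 1)
  obtain ⟨k₂, hk₂⟩ := (𝒱.laurent u v).exists_forall_lt (r + 1)
  set f : ℤ → W := fun m => 𝒲.Y u m (𝒲.Y v (d - m) w) with hf
  set C := 𝒲.iterCoeff u v w d with hC
  have hf0 : ∀ m > d + k₁, π (f m) = 0 := fun m hm =>
    mkQ_eq_zero_iff.2 (map_mem_hFil _ (hk₁ _ (by omega)))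
  have hC0 : ∀ p < -(k₂ : ℤ), π (C p) = 0 := fun p hp =>
    mkQ_eq_zero_iff.2 (map_mem_hFil (𝒲.modeMap _ w) (hk₂ p hp.le))
  -- By homogeneity only `y = x₀/x₂` matters. The factor of degree `l` raises the total degree to `d
  -- + l`, hence the power `q = d + l - p` of `x₂`.
  have hassoc : kernelSum kernelInf (fun m => π (f (m - l))) =
      mulOneAdd^[l] fun p => π (C p) := by
    ext p
    obtain ⟨s, hs, hs'⟩ := hl p (d + l - p)
    have h1 : HasHSum (fun m : ℤ => kernelInf p m • f (m - l)) s := by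
      refine HasHSum.of_injective (e := fun i : ℕ => p + (i : ℤ)) (fun i j hij => by simpa using hij)
        ?_ ?_
      · convert hs using 2 with i
        simp only [kernelInf, hf]
        rw [if_pos (by omega), show (p + (i : ℤ) - p).toNat = i by omega,
          show d - (p + (i : ℤ) - l) = d + l - p - i by ring]
      · intro m hm
        rw [kernelInf, if_neg, zero_smul]
        intro h
        exact hm ⟨(m - p).toNat, by simp only; omega⟩
    have h2 := h1.finsum_mkQ (r + 1)
    rw [kernelSum, mulOneAdd_iterate]
    rw [← mkQ_eq_zero_iff, map_sub, sub_eq_zero, ← h2, map_sum] at hs'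
    simp only [map_zsmul, map_nsmul] at hs'
    rw [hs']
    refine Finset.sum_congr rfl fun j _ => ?_
    simp only [hC, VAModule.iterCoeff, hπ]
    rw [show d + l - p - l + j = d - (p - j) by ring]
  have hpol : ∀ m, polarPart (fun p => π (C p)) m = π (polarPart C m) := fun m =>
    (polarPart_map π.toAddMonoidHom C m).symm
  obtain ⟨h1, h2⟩ := expansion_of_mulOneAdd hf0 hC0 hassoc
  simp only [hpol, ← map_sub] at h1 h2
  refine ⟨(Set.finite_Icc (-(l : ℤ)) (max (d + k₁) (-1))).subset fun m hm => ?_, h2⟩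
  by_contra hc
  rw [Set.mem_Icc, not_and_or, not_le, not_le] at hc
  refine hm ?_
  rcases hc with hc | hc
  · exact h1 m hc
  · simp only [VAModule.normalCoeff]
    rw [polarPart_of_nonneg _ (by omega), sub_zero]
    exact hf0 m (by omega)

theorem VAModule.normalCoeff_hNull (𝒲 : VAModule 𝒱 W) (u v : V) (w : W) (d : ℤ) :
    HNull (𝒲.normalCoeff u v w d) :=
  hNull_of_support_mkQ_finite fun r => (𝒲.normalCoeff_spec u v w d r).1

theorem HNull.zsmul {ι : Type*} {f : ι → W} (h : HNull f) (c : ι → ℤ) :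
    HNull fun i => c i • f i := fun r => by
  obtain ⟨F, hF⟩ := h r
  exact ⟨F, fun i hi => zsmul_mem (hF i hi) (c i)⟩

/-- The regular part of `Y_W(Y(u, x₀)v, x₂)w` is obtained from the normally ordered product by
substituting `x₁ = x₂ + x₀`. -/
theorem VAModule.hasHSum_normalCoeff (𝒲 : VAModule 𝒱 W) (u v : V) (w : W) (d : ℤ) (p : ℕ) :
    HasHSum (fun m : ℤ => (Ring.choose m p : ℤ) • 𝒲.normalCoeff u v w d m)
      (𝒲.Y (𝒱.Y u p v) (d - p) w) := by
  refine hasHSum_of_finsum_mkQ ((𝒲.normalCoeff_hNull u v w d).zsmul _) fun r => ?_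
  simp only [map_zsmul]
  exact ((𝒲.normalCoeff_spec u v w d r).2 p).symm

theorem VAModule.Y_vac_apply (𝒲 : VAModule 𝒱 W) (q : ℤ) (w : W) :
    𝒲.Y 𝒱.vac q w = if q = 0 then w else 0 := by
  rw [𝒲.vac_left, fone]
  split_ifs <;> simp

/-- `Y_W(a_{-s-1} 1, x) = ∂ₓ^s Y_W(a, x) / s!`. -/
theorem VAModule.Y_descendant (𝒲 : VAModule 𝒱 W) (a : V) (s : ℕ) (q : ℤ) :
    𝒲.Y (𝒱.Y a s 𝒱.vac) q = (Ring.choose (q + s) s : ℤ) • 𝒲.Y a (q + s) := by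
  ext w
  have h := 𝒲.hasHSum_normalCoeff a 𝒱.vac w (q + s) s
  rw [add_sub_cancel_right] at h
  -- `Y(a, x₀)1` is regular in `x₀`, so nothing is subtracted; `Y_W(1, x) = 1` then leaves only the
  -- term `m = q + s`.
  have hpol : ∀ m, polarPart (𝒲.iterCoeff a 𝒱.vac w (q + s)) m = 0 := by
    intro m
    unfold polarPart
    split_ifs
    · refine Finset.sum_eq_zero fun i _ => ?_
      rw [VAModule.iterCoeff, 𝒱.creation_regular a _ (by omega)]
      simp
    · rfl
  have h' := hasHSum_single (M := W)
    (f := fun m : ℤ => (Ring.choose m s : ℤ) • 𝒲.normalCoeff a 𝒱.vac w (q + s) m) (q + s) (by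
      intro m hm
      rw [VAModule.normalCoeff, hpol, 𝒲.Y_vac_apply, if_neg (by omega)]
      simp)
  rw [h.unique 𝒲.topFree h', VAModule.normalCoeff, hpol, 𝒲.Y_vac_apply, if_pos (by omega)]
  simp

end Modules

/-- With `m = k + (M - i)` this matches the coefficients of a contraction summed over `m` with those
summed over annihilation modes `i`. -/
theorem choose_mul_choose_symm {M i k : ℕ} (hi : i ≤ M) :
    (k + (M - i)).choose k * M.choose (k + (M - i)) = M.choose i * i.choose k := by
  rcases le_or_gt k i with hk | hk
  · rw [mul_comm, Nat.choose_mul (n := M), Nat.choose_mul (n := M),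
      show k + (M - i) - k = (M - k) - (i - k) by omega, Nat.choose_symm (by omega)] <;> omega
  · rw [Nat.choose_eq_zero_of_lt (n := M) (by omega), Nat.choose_eq_zero_of_lt hk, mul_zero,
      mul_zero]

/-- Negating the upper index of the binomial coefficient cancels the sign `(-1)^n`. The power
`x₁^(-i-1)` belongs to the annihilation mode `a_i`. -/
theorem diffCoeff_neg (γ : ℤ → ℂ⟦X⟧) (i n : ℕ) :
    diffCoeff γ (-i - 1) n = (i.choose n) • γ (n - i - 1) := by
  rw [diffCoeff, if_pos (by omega), show -(i : ℤ) - 1 + n = n - i - 1 by ring, Int.toNat_natCast,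
    show (n : ℤ) - i - 1 = -(i + 1 - n) by ring, Ring.choose_neg,
    show (i : ℤ) + 1 - n + n - 1 = i by ring, Ring.choose_natCast, ← natCast_zsmul]
  congr 1
  rw [Units.smul_def, Int.coe_negOnePow_natCast, smul_eq_mul, ← mul_assoc, ← mul_pow]
  simp

theorem diffCoeff_of_neg_right (γ : ℤ → ℂ⟦X⟧) (m : ℤ) {n : ℤ} (hn : n < 0) :
    diffCoeff γ m n = 0 := by
  rw [diffCoeff, if_neg (by omega)]

/-! ### Transfer of the Heisenberg relations to modules. -/

section

variable {V W : Type*} [AddCommGroup V] [Module ℂ⟦X⟧ V] [AddCommGroup W] [Module ℂ⟦X⟧ W]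

/-- The relations `[F^±(x₁), F^±(x₂)] = 0` and `[F⁻(x₁), F⁺(x₂)] = γ(x₁ - x₂)`, in terms of the
coefficients of `F`. -/
structure HeisenbergRel (γ : ℤ → ℂ⟦X⟧) (F : FSeries V) : Prop where
  reg : ∀ m n : ℤ, 0 ≤ m → 0 ≤ n → F m * F n = F n * F m
  sing : ∀ m n : ℤ, m < 0 → n < 0 → F m * F n = F n * F m
  mixed : ∀ m n : ℤ, m < 0 → 0 ≤ n →
    F m * F n = F n * F m + diffCoeff γ m n • (1 : Module.End ℂ⟦X⟧ V)

theorem HeisenbergRel.of_parts {γ : ℤ → ℂ⟦X⟧} {F : FSeries V}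
    (h_reg : ∀ m n : ℤ, regPart F m * regPart F n - regPart F n * regPart F m = 0)
    (h_sing : ∀ m n : ℤ, singPart F m * singPart F n - singPart F n * singPart F m = 0)
    (h_mixed : ∀ m n : ℤ, singPart F m * regPart F n - regPart F n * singPart F m
        = diffCoeff γ m n • (1 : Module.End ℂ⟦X⟧ V)) : HeisenbergRel γ F where
  reg m n hm hn := by simpa [regPart, hm, hn, sub_eq_zero] using h_reg m n
  sing m n hm hn := by simpa [singPart, hm, hn, sub_eq_zero] using h_sing m n
  mixed m n hm hn := by
    rw [← h_mixed]
    simp [regPart, singPart, hm, hn]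

variable {𝒱 : NonlocalVA V} {γ : ℤ → ℂ⟦X⟧} {a : V}

theorem HeisenbergRel.mixed_apply (h : HeisenbergRel γ (𝒱.Y a)) (i n : ℕ) (v : V) :
    𝒱.Y a (-i - 1) (𝒱.Y a n v) =
      𝒱.Y a n (𝒱.Y a (-i - 1) v) + ((i.choose n) • γ (n - i - 1)) • v := by
  have := LinearMap.congr_fun (h.mixed (-i - 1) n (by omega) (by omega)) v
  rw [diffCoeff_neg] at this
  exact this

/-- Annihilation modes kill `1`, so only the contraction survives; it is a multiple of `1`, whose
field lives in degree zero. -/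
theorem iterCoeff_descendant (h : HeisenbergRel γ (𝒱.Y a)) (𝒲 : VAModule 𝒱 W) (w : W) (d : ℤ)
    (s i : ℕ) : 𝒲.iterCoeff a (𝒱.Y a s 𝒱.vac) w d (-i - 1) =
      if d = -i - 1 then ((i.choose s) • γ (s - i - 1)) • w else 0 := by
  rw [VAModule.iterCoeff, h.mixed_apply, 𝒱.creation_regular a _ (by omega), map_zero, zero_add,
    map_smul, Pi.smul_apply, LinearMap.smul_apply, 𝒲.Y_vac_apply]
  split_ifs with h1 h2 h2
  · rfl
  · omega
  · omega
  · simp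

/-- The field of `a_{-s-1}1` is `∂^s Y_W(a, x₂)/s!`, so its contraction with `a(x₁)` is `∂_{x₂}^s
γ(x₁ - x₂)/s!`. -/
theorem polarPart_descendant (hγ : ∀ n : ℤ, 0 ≤ n → γ n = 0) (h : HeisenbergRel γ (𝒱.Y a))
    (𝒲 : VAModule 𝒱 W) (w : W) (d : ℤ) (s : ℕ) (m : ℤ) :
    polarPart (𝒲.iterCoeff a (𝒱.Y a s 𝒱.vac) w d) m =
      (Ring.choose (d - m + s) s : ℤ) •
        (if m < 0 then diffCoeff γ m (d + s - m) • w else 0) := by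
  unfold polarPart
  split_ifs with hm
  swap
  · rw [smul_zero]
  obtain ⟨M, rfl⟩ : ∃ M : ℕ, m = -M - 1 := ⟨(-m - 1).toNat, by omega⟩
  rw [show (-(-(M : ℤ) - 1)).toNat = M + 1 by omega,
    show (-(-(M : ℤ) - 1) - 1).toNat = M by omega]
  simp only [iterCoeff_descendant h]
  -- For `d ≥ 0` the only value of `γ` involved has index `d + s ≥ 0`, and it vanishes because `γ`
  -- is singular.
  by_cases hd : 0 ≤ d
  · obtain ⟨n, hn⟩ : ∃ n : ℕ, d + s - (-M - 1) = n := ⟨(d + s - (-M - 1)).toNat, by omega⟩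
    rw [hn, diffCoeff_neg, hγ _ (by omega), smul_zero, zero_smul, smul_zero]
    exact Finset.sum_eq_zero fun i _ => by rw [if_neg (by omega), smul_zero]
  · obtain ⟨i, rfl⟩ : ∃ i : ℕ, d = -i - 1 := ⟨(-d - 1).toNat, by omega⟩
    by_cases hi : i ≤ M
    · rw [Finset.sum_eq_single_of_mem i (by simp; omega)]
      · rw [if_pos rfl, show -(i : ℤ) - 1 + s - (-M - 1) = ((s + (M - i) : ℕ) : ℤ) by
            push_cast [Nat.cast_sub hi]; ring,
          show -(i : ℤ) - 1 - (-M - 1) + s = ((s + (M - i) : ℕ) : ℤ) by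
            push_cast [Nat.cast_sub hi]; ring, diffCoeff_neg, Ring.choose_natCast,
          natCast_zsmul, smul_assoc, smul_assoc, smul_smul, smul_smul,
          choose_mul_choose_symm hi,
          show ((s + (M - i) : ℕ) : ℤ) - M - 1 = s - i - 1 by
            push_cast [Nat.cast_sub hi]; ring]
      · intro j _ hj
        rw [if_neg (by omega), smul_zero]
    · rw [Finset.sum_eq_zero fun j hj => by
        rw [if_neg (by simp only [Finset.mem_range] at hj; omega), smul_zero]]
      by_cases hn : (-(i : ℤ) - 1 + s - (-M - 1)) < 0
      · rw [diffCoeff_of_neg_right _ _ hn, zero_smul, smul_zero]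
      · obtain ⟨n, hn'⟩ : ∃ n : ℕ, -(i : ℤ) - 1 - (-M - 1) + s = n :=
          ⟨(-(i : ℤ) - 1 - (-M - 1) + s).toNat, by omega⟩
        rw [hn', Ring.choose_natCast, Nat.choose_eq_zero_of_lt (by omega), Nat.cast_zero,
          zero_smul]

theorem normalCoeff_descendant (hγ : ∀ n : ℤ, 0 ≤ n → γ n = 0) (h : HeisenbergRel γ (𝒱.Y a))
    (𝒲 : VAModule 𝒱 W) (w : W) (d : ℤ) (s : ℕ) (m : ℤ) :
    𝒲.normalCoeff a (𝒱.Y a s 𝒱.vac) w d m = (Ring.choose (d - m + s) s : ℤ) •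
      (𝒲.Y a m (𝒲.Y a (d + s - m) w) -
        if m < 0 then diffCoeff γ m (d + s - m) • w else 0) := by
  rw [VAModule.normalCoeff, polarPart_descendant hγ h, 𝒲.Y_descendant, smul_sub,
    show d - m + s = d + s - m by ring]
  simp

/-- Modulo each `ħ^r` the family has finite support, where binomial moments determine it;
separatedness concludes. -/
theorem eq_zero_of_hasHSum_choose {M : Type*} [AddCommGroup M] [Module ℂ⟦X⟧ M] (hM : TopFree M)
    {g : ℤ → M} (hg : HNull g)
    (h : ∀ s : ℕ, HasHSum (fun m : ℤ => (Ring.choose m s : ℤ) • g m) 0) (m : ℤ) : g m = 0 := by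
  refine hM.eq_zero fun r => mkQ_eq_zero_iff.1 ?_
  refine congrFun (eq_zero_of_choose_moments (hg.support_mkQ_finite r) fun s => ?_) m
  simpa using (h s).finsum_mkQ r

/-- The commutation relations of the coefficients of `Y(a, x)` hold on every module. -/
theorem HeisenbergRel.module (hγ : ∀ n : ℤ, 0 ≤ n → γ n = 0) (h : HeisenbergRel γ (𝒱.Y a))
    (𝒲 : VAModule 𝒱 W) : HeisenbergRel γ (𝒲.Y a) := by
  have key : ∀ (m n : ℤ) (w : W),
      (𝒲.Y a m (𝒲.Y a n w) - if m < 0 then diffCoeff γ m n • w else 0) -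
        (𝒲.Y a n (𝒲.Y a m w) - if n < 0 then diffCoeff γ n m • w else 0) = 0 := by
    intro m n w
    set D := m + n with hD
    set g₀ : ℤ → W := fun m => 𝒲.Y a m (𝒲.Y a (D - m) w) -
      if m < 0 then diffCoeff γ m (D - m) • w else 0 with hg₀
    have hN : ∀ m, 𝒲.normalCoeff a (𝒱.Y a 0 𝒱.vac) w D m = g₀ m := fun m => by
      have := normalCoeff_descendant hγ h 𝒲 w D 0 m
      simpa [hg₀] using this
    have hnull : HNull g₀ := by
      have := 𝒲.normalCoeff_hNull a (𝒱.Y a 0 𝒱.vac) w D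
      rwa [funext hN] at this
    have hnull' : HNull fun m => g₀ (D - m) :=
      hnull.comp_injective (e := fun m => D - m) (Equiv.subLeft D).injective
    have hmom : ∀ s : ℕ,
        HasHSum (fun m : ℤ => (Ring.choose m s : ℤ) • (g₀ m - g₀ (D - m))) 0 := by
      intro s
      have h1 := 𝒲.hasHSum_normalCoeff a (𝒱.Y a 0 𝒱.vac) w D s
      have h2 := (𝒲.hasHSum_normalCoeff a (𝒱.Y a s 𝒱.vac) w (D - s) 0).comp_equiv
        (Equiv.subLeft D)
      -- Commuting creation modes in `V` equate two moments: the `s`-th one of `g₀`, and the zeroth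
      -- one for `a_{-s-1}1`, which after `m ↦ D - m` is the `s`-th one of the reflected family.
      -- Thus `g₀` is symmetric, which is the commutation relation on `W`.
      have h3 : 𝒱.Y a s (𝒱.Y a 0 𝒱.vac) = 𝒱.Y a 0 (𝒱.Y a s 𝒱.vac) :=
        LinearMap.congr_fun (h.reg s 0 (by omega) le_rfl) 𝒱.vac
      rw [Nat.cast_zero, sub_zero] at h2
      rw [h3] at h1
      have h4 := h1.sub h2
      rw [sub_self] at h4
      convert h4 using 2 with m
      rw [hN, normalCoeff_descendant hγ h, smul_sub, Ring.choose_zero_right, one_smul]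
      simp only [Equiv.subLeft_apply, hg₀]
      rw [show D - s - (D - m) + s = m by ring, sub_add_cancel]
    have := eq_zero_of_hasHSum_choose 𝒲.topFree
      (g := fun m => g₀ m - g₀ (D - m)) (hnull.sub hnull') hmom m
    simpa [hg₀, show D - m = n by omega, show D - n = m by omega] using this
  refine ⟨fun m n hm hn => ?_, fun m n hm hn => ?_, fun m n hm hn => ?_⟩ <;> ext w <;>
    have := key m n w
  · rw [if_neg (by omega), if_neg (by omega), sub_zero, sub_zero] at this
    exact sub_eq_zero.1 this
  · rw [diffCoeff_of_neg_right _ _ hn, diffCoeff_of_neg_right _ _ hm] at this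
    simpa [sub_eq_zero] using this
  · rw [if_pos hm, if_neg (by omega), sub_zero, sub_right_comm, sub_eq_zero,
      sub_eq_iff_eq_add, add_comm] at this
    simpa using this

end

/-! ### The commutator formula and creation modes. -/

section

variable {V W : Type*} [AddCommGroup V] [Module ℂ⟦X⟧ V] [AddCommGroup W] [Module ℂ⟦X⟧ W]
  {𝒱 : NonlocalVA V}

theorem HasHSum.finset_sum {ι κ M : Type*} [AddCommGroup M] [Module ℂ⟦X⟧ M] {f : κ → ι → M}
    {s : κ → M} (F : Finset κ) (h : ∀ k ∈ F, HasHSum (f k) (s k)) :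
    HasHSum (fun i => ∑ k ∈ F, f k i) (∑ k ∈ F, s k) := by
  classical
  induction F using Finset.induction_on with
  | empty => simpa using hasHSum_zero
  | insert k F hk ih =>
    simp only [Finset.sum_insert hk]
    exact (h k (Finset.mem_insert_self k F)).add
      (ih fun j hj => h j (Finset.mem_insert_of_mem hj))

/-- The defect in the commutator formula
`[Y_W⁻(a, x₁), Y_W(v, x₂)] = Y_W(Y⁻(a, x₁ - x₂)v, x₂)`, as a linear map in `v`. -/
def VAModule.commDefect (𝒲 : VAModule 𝒱 W) (a : V) (m n : ℤ) (w : W) : V →ₗ[ℂ⟦X⟧] W :=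
  𝒲.Y a m ∘ₗ 𝒲.modeMap n w - 𝒲.modeMap n (𝒲.Y a m w) -
    ∑ i ∈ Finset.range (-m).toNat,
      ((-m - 1).toNat.choose i) • (𝒲.modeMap (m + n + i + 1) w ∘ₗ 𝒱.Y a (-i - 1))

theorem VAModule.commDefect_apply (𝒲 : VAModule 𝒱 W) (a : V) {m : ℤ} (hm : m < 0) (n : ℤ) (w : W)
    (v : V) : 𝒲.commDefect a m n w v = 𝒲.Y a m (𝒲.Y v n w) - 𝒲.Y v n (𝒲.Y a m w) -
      polarPart (𝒲.iterCoeff a v w (m + n)) m := by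
  rw [polarPart, if_pos hm]
  simp only [commDefect, LinearMap.sub_apply, LinearMap.comp_apply, modeMap_apply,
    LinearMap.sum_apply, LinearMap.smul_apply, iterCoeff]
  congr 1
  refine Finset.sum_congr rfl fun i _ => ?_
  rw [show m + n - (-(i : ℤ) - 1) = m + n + i + 1 by ring]

/-- The vectors `v` for which `[Y_W⁻(a, x₁), Y_W(v, x₂)] = Y_W(Y⁻(a, x₁ - x₂)v, x₂)`. -/
def VAModule.commSubmodule (𝒲 : VAModule 𝒱 W) (a : V) : Submodule ℂ⟦X⟧ V where
  carrier := {v | ∀ m n : ℤ, m < 0 → ∀ w, 𝒲.commDefect a m n w v = 0}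
  add_mem' hu hv m n hm w := by rw [map_add, hu m n hm w, hv m n hm w, add_zero]
  zero_mem' m n _ w := map_zero _
  smul_mem' c v hv m n hm w := by rw [map_smul, hv m n hm w, smul_zero]

theorem VAModule.commutator_apply (𝒲 : VAModule 𝒱 W) {a v : V} (hv : v ∈ 𝒲.commSubmodule a)
    (M : ℕ) (n : ℤ) (w : W) :
    𝒲.Y a (-M - 1) (𝒲.Y v n w) = 𝒲.Y v n (𝒲.Y a (-M - 1) w) +
      ∑ i ∈ Finset.range (M + 1), (M.choose i) • 𝒲.Y (𝒱.Y a (-i - 1) v) (n - M + i) w := by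
  have := hv (-M - 1) n (by omega) w
  rw [𝒲.commDefect_apply a (by omega), sub_sub, sub_eq_zero] at this
  rw [this, polarPart, if_pos (by omega), show (-(-(M : ℤ) - 1)).toNat = M + 1 by omega,
    show (-(-(M : ℤ) - 1) - 1).toNat = M by omega]
  congr 1
  refine Finset.sum_congr rfl fun i _ => ?_
  rw [iterCoeff, show -(M : ℤ) - 1 + n - (-(i : ℤ) - 1) = n - M + i by ring]

theorem VAModule.mem_commSubmodule_of_forall (𝒲 : VAModule 𝒱 W) {a v : V}
    (h : ∀ (M : ℕ) (n : ℤ) (w : W), 𝒲.Y a (-M - 1) (𝒲.Y v n w) = 𝒲.Y v n (𝒲.Y a (-M - 1) w) +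
      ∑ i ∈ Finset.range (M + 1), (M.choose i) • 𝒲.Y (𝒱.Y a (-i - 1) v) (n - M + i) w) :
    v ∈ 𝒲.commSubmodule a := by
  intro m n hm w
  obtain ⟨M, rfl⟩ : ∃ M : ℕ, m = -M - 1 := ⟨(-m - 1).toNat, by omega⟩
  rw [𝒲.commDefect_apply a hm, h, polarPart, if_pos hm,
    show (-(-(M : ℤ) - 1)).toNat = M + 1 by omega,
    show (-(-(M : ℤ) - 1) - 1).toNat = M by omega, add_sub_cancel_left, sub_eq_zero]
  refine Finset.sum_congr rfl fun i _ => ?_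
  rw [iterCoeff, show -(M : ℤ) - 1 + n - (-(i : ℤ) - 1) = n - M + i by ring]

/-- The defect is `ℂ⟦X⟧`-linear in `v`, hence `ħ`-adically continuous, and its kernel is closed. -/
theorem VAModule.mem_commSubmodule_of_hasHSum (𝒲 : VAModule 𝒱 W) {ι : Type*} {a s : V} {f : ι → V}
    (hf : ∀ i, f i ∈ 𝒲.commSubmodule a) (hs : HasHSum f s) : s ∈ 𝒲.commSubmodule a := by
  intro m n hm w
  refine (hs.map (𝒲.commDefect a m n w)).unique 𝒲.topFree ?_
  simpa only [fun i => hf i m n hm w] using hasHSum_zero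

theorem VAModule.vac_mem_commSubmodule (𝒲 : VAModule 𝒱 W) (a : V) :
    𝒱.vac ∈ 𝒲.commSubmodule a := by
  refine 𝒲.mem_commSubmodule_of_forall fun M n w => ?_
  rw [Finset.sum_eq_zero fun i _ => ?_]
  · simp only [𝒲.Y_vac_apply]
    split_ifs <;> simp
  · rw [𝒱.creation_regular a _ (by omega)]
    simp

/-- For `m < 0` the subtracted polar part is exactly the commutator, so the subtraction exchanges
the two factors; the abstract normal product becomes the usual one. -/
theorem VAModule.normalCoeff_eq (𝒲 : VAModule 𝒱 W) {a v : V} (hv : v ∈ 𝒲.commSubmodule a) (w : W)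
    (d m : ℤ) : 𝒲.normalCoeff a v w d m =
      if 0 ≤ m then 𝒲.Y a m (𝒲.Y v (d - m) w) else 𝒲.Y v (d - m) (𝒲.Y a m w) := by
  split_ifs with hm
  · rw [normalCoeff, polarPart_of_nonneg _ hm, sub_zero]
  · have := hv m (d - m) (by omega) w
    rw [𝒲.commDefect_apply a (by omega), sub_right_comm, sub_eq_zero, add_sub_cancel] at this
    exact this

/-- `Y_W(a_{-k-1}v, x)` as a normally ordered product. -/
theorem VAModule.hasHSum_normal (𝒲 : VAModule 𝒱 W) {a v : V} (hv : v ∈ 𝒲.commSubmodule a)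
    (k : ℕ) (n : ℤ) (w : W) :
    HasHSum (fun m : ℤ => (Ring.choose m k : ℤ) •
      if 0 ≤ m then 𝒲.Y a m (𝒲.Y v (n + k - m) w) else 𝒲.Y v (n + k - m) (𝒲.Y a m w))
      (𝒲.Y (𝒱.Y a k v) n w) := by
  have := 𝒲.hasHSum_normalCoeff a v w (n + k) k
  rw [add_sub_cancel_right] at this
  simpa only [𝒲.normalCoeff_eq hv] using this

variable {γ : ℤ → ℂ⟦X⟧} {a : V}

/-- Only `k ≤ m ≤ M` contribute, and these correspond to `i = M + k - m`. The sum collects the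
contractions of `a_M` with the factor `a(x₁)` of a normally ordered product. -/
theorem hasHSum_contraction {M' : Type*} [AddCommGroup M'] [Module ℂ⟦X⟧ M'] (γ : ℤ → ℂ⟦X⟧)
    (x : ℤ → M') (M k : ℕ) (n : ℤ) :
    HasHSum (fun m : ℤ => (Ring.choose m k : ℤ) •
      if 0 ≤ m then diffCoeff γ (-M - 1) m • x (n + k - m) else 0)
      (∑ i ∈ Finset.range (M + 1),
        (M.choose i) • ((i.choose k) • γ (k - i - 1)) • x (n - M + i)) := by
  classical
  have hinj : Set.InjOn (fun i : ℕ => (k : ℤ) + (M - i)) (Finset.range (M + 1)) :=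
    fun i _ j _ hij => by simpa using hij
  have := hasHSum_sum (F := (Finset.range (M + 1)).image fun i : ℕ => (k : ℤ) + (M - i))
    (f := fun m : ℤ => (Ring.choose m k : ℤ) •
      if 0 ≤ m then diffCoeff γ (-M - 1) m • x (n + k - m) else 0) (by
      intro m hm
      split_ifs with h0
      swap
      · rw [smul_zero]
      lift m to ℕ using h0
      rw [diffCoeff_neg, Ring.choose_natCast]
      rcases lt_or_ge m k with h1 | h1
      · rw [Nat.choose_eq_zero_of_lt h1, Nat.cast_zero, zero_smul]
      · rw [Nat.choose_eq_zero_of_lt (n := M), zero_smul, zero_smul, smul_zero]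
        by_contra h2
        exact hm (Finset.mem_image.2 ⟨M + k - m, Finset.mem_range.2 (by omega), by
          push_cast [Nat.cast_sub (show m ≤ M + k by omega)]; ring⟩))
  rw [Finset.sum_image hinj] at this
  convert this using 1
  refine Finset.sum_congr rfl fun i hi => ?_
  have hi : i ≤ M := by simpa [Nat.lt_succ_iff] using hi
  rw [if_pos (by omega), show (k : ℤ) + (M - i) = ((k + (M - i) : ℕ) : ℤ) by
    push_cast [Nat.cast_sub hi]; ring, diffCoeff_neg, Ring.choose_natCast, natCast_zsmul,
    smul_assoc, smul_assoc, smul_smul, smul_smul, choose_mul_choose_symm hi,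
    show ((k + (M - i) : ℕ) : ℤ) - M - 1 = k - i - 1 by push_cast [Nat.cast_sub hi]; ring,
    show n + k - ((k + (M - i) : ℕ) : ℤ) = n - M + i by push_cast [Nat.cast_sub hi]; ring]

/-- The commutator with `a_M` acts as a derivation on the normal product representing
`Y_W(a_{-k-1}v)`. On `Y_W(v)` it produces `Y_W(a_i v)`, on `Y_W(a)` the scalar contraction; the
relation in `V` between `a_i` and `a_{-k-1}` reassembles them into `Y_W(a_i a_{-k-1} v)`. -/
theorem VAModule.mode_mem_commSubmodule (𝒲 : VAModule 𝒱 W) (h : HeisenbergRel γ (𝒱.Y a))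
    (hW : HeisenbergRel γ (𝒲.Y a)) {v : V} (hv : v ∈ 𝒲.commSubmodule a)
    (hv' : ∀ i : ℕ, 𝒱.Y a (-i - 1) v ∈ 𝒲.commSubmodule a) (k : ℕ) :
    𝒱.Y a k v ∈ 𝒲.commSubmodule a := by
  refine 𝒲.mem_commSubmodule_of_forall fun M n w => ?_
  rw [← sub_eq_iff_eq_add']
  have h1 := ((𝒲.hasHSum_normal hv k n w).map (𝒲.Y a (-M - 1))).sub
    (𝒲.hasHSum_normal hv k n (𝒲.Y a (-M - 1) w))
  refine h1.unique 𝒲.topFree ?_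
  have h2 : ∀ i ∈ Finset.range (M + 1), HasHSum _ _ := fun i _ =>
    (𝒲.hasHSum_normal (hv' i) k (n - M + i) w).map ((M.choose i) • LinearMap.id)
  have h3 := (HasHSum.finset_sum _ h2).add (hasHSum_contraction γ (fun q => 𝒲.Y v q w) M k n)
  convert h3 using 1
  · ext m
    have hc := 𝒲.commutator_apply hv M (n + k - m)
    rw [map_zsmul, ← smul_sub]
    simp only [LinearMap.smul_apply, LinearMap.id_apply, smul_comm (_ : ℕ) (Ring.choose m k)]
    rw [← Finset.smul_sum, ← smul_add]
    congr 1
    -- For `m ≥ 0` moving `a_M` past a creation mode yields a contraction; for `m < 0` both are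
    -- annihilation modes and commute.
    split_ifs with hm
    · have hcomm : ∀ x, 𝒲.Y a (-M - 1) (𝒲.Y a m x) =
          𝒲.Y a m (𝒲.Y a (-M - 1) x) + diffCoeff γ (-M - 1) m • x := fun x =>
        LinearMap.congr_fun (hW.mixed (-M - 1) m (by omega) hm) x
      rw [hcomm, hc, map_add, map_sum, add_assoc, add_sub_cancel_left]
      congr 1
      refine Finset.sum_congr rfl fun i _ => ?_
      rw [map_nsmul, show n - M + i + k - m = n + k - m - M + i by ring]
    · have hcomm : ∀ x, 𝒲.Y a (-M - 1) (𝒲.Y a m x) = 𝒲.Y a m (𝒲.Y a (-M - 1) x) := fun x =>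
        LinearMap.congr_fun (hW.sing (-M - 1) m (by omega) (by omega)) x
      rw [hc, hcomm, add_sub_cancel_left, add_zero]
      refine Finset.sum_congr rfl fun i _ => ?_
      rw [show n - M + i + k - m = n + k - m - M + i by ring]
  · rw [← Finset.sum_add_distrib]
    refine Finset.sum_congr rfl fun i _ => ?_
    rw [h.mixed_apply, map_add, map_smul]
    simp

/-- Successive application of the annihilation operators `a_i`, `i ∈ l`. -/
def NonlocalVA.annihilate (𝒱 : NonlocalVA V) (a : V) : List ℕ → V →ₗ[ℂ⟦X⟧] V
  | [] => LinearMap.id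
  | i :: l => 𝒱.annihilate a l ∘ₗ 𝒱.Y a (-i - 1)

/-- The vectors all of whose images under annihilation operators satisfy the commutator formula. -/
def VAModule.commCore (𝒲 : VAModule 𝒱 W) (a : V) : Set V :=
  {v | ∀ l : List ℕ, 𝒱.annihilate a l v ∈ 𝒲.commSubmodule a}

theorem VAModule.commCore_subset (𝒲 : VAModule 𝒱 W) {v : V} (hv : v ∈ 𝒲.commCore a) :
    v ∈ 𝒲.commSubmodule a := hv []

theorem VAModule.annihilate_mem_commCore (𝒲 : VAModule 𝒱 W) {v : V} (hv : v ∈ 𝒲.commCore a)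
    (i : ℕ) : 𝒱.Y a (-i - 1) v ∈ 𝒲.commCore a := fun l => hv (i :: l)

theorem VAModule.vac_mem_commCore (𝒲 : VAModule 𝒱 W) (a : V) : 𝒱.vac ∈ 𝒲.commCore a := by
  intro l
  cases l with
  | nil => exact 𝒲.vac_mem_commSubmodule a
  | cons i l =>
    rw [NonlocalVA.annihilate, LinearMap.comp_apply, 𝒱.creation_regular a _ (by omega), map_zero]
    exact zero_mem _

/-- `VAModule.mode_mem_commSubmodule` also needs the vectors `a_i v`, so an inductive argument
requires a set stable under annihilation. Along a word, each annihilation mode passes the creation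
mode up to a multiple of the vector. -/
theorem VAModule.mode_mem_commCore (𝒲 : VAModule 𝒱 W) (h : HeisenbergRel γ (𝒱.Y a))
    (hW : HeisenbergRel γ (𝒲.Y a)) {v : V} (hv : v ∈ 𝒲.commCore a) (k : ℕ) :
    𝒱.Y a k v ∈ 𝒲.commCore a := by
  intro l
  induction l generalizing v with
  | nil =>
    exact 𝒲.mode_mem_commSubmodule h hW (𝒲.commCore_subset hv)
      (fun i => 𝒲.commCore_subset (𝒲.annihilate_mem_commCore hv i)) k
  | cons i l ih =>
    rw [NonlocalVA.annihilate, LinearMap.comp_apply, h.mixed_apply, map_add, map_smul]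
    exact add_mem (ih (𝒲.annihilate_mem_commCore hv i)) (Submodule.smul_mem _ _ (hv l))

theorem VAModule.mem_commCore_of_hasHSum (𝒲 : VAModule 𝒱 W) {ι : Type*} {s : V} {f : ι → V}
    (hf : ∀ i, f i ∈ 𝒲.commCore a) (hs : HasHSum f s) : s ∈ 𝒲.commCore a := fun l =>
  𝒲.mem_commSubmodule_of_hasHSum (fun i => hf i l) (hs.map (𝒱.annihilate a l))

theorem VAModule.smul_mem_commCore (𝒲 : VAModule 𝒱 W) {v : V} (hv : v ∈ 𝒲.commCore a)
    (c : ℂ⟦X⟧) : c • v ∈ 𝒲.commCore a := fun l => by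
  rw [map_smul]
  exact Submodule.smul_mem _ _ (hv l)

end

/-! ### The operators `e^{z∂}` and `zL(z∂)` on series. -/

section Shift

variable {M : Type*} [AddCommGroup M] [Module ℂ⟦X⟧ M]

theorem dx_iterate (A : FSeries M) (k : ℕ) (n : ℤ) :
    (dx^[k] A) n = ((k.factorial : ℤ) * Ring.choose (n + k) k) • A (n + k) := by
  induction k generalizing A with
  | zero => simp
  | succ k ih =>
    have h := Ring.choose_smul_choose (n + k + 1 : ℤ) (n := k + 1) (k := 1) (by omega)
    rw [Nat.choose_one_right, Ring.choose_one_right, Nat.cast_one, add_sub_cancel_right,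
      Nat.add_sub_cancel, nsmul_eq_mul] at h
    rw [Function.iterate_succ_apply, ih, dx, smul_smul]
    push_cast at h ⊢
    rw [← add_assoc n, Nat.factorial_succ]
    congr 1
    push_cast
    linear_combination (-(k.factorial : ℤ)) * h

/-- The coefficient `z^(k+1) / (k+1)` of `∫₀^z`. -/
def primCoeff (z : ℂ⟦X⟧) (k : ℕ) : ℂ⟦X⟧ := PowerSeries.C (1 / ((k : ℂ) + 1)) * z ^ (k + 1)

theorem X_dvd_of_constantCoeff {z : ℂ⟦X⟧} (hz : PowerSeries.constantCoeff z = 0) :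
    (PowerSeries.X : ℂ⟦X⟧) ∣ z := PowerSeries.X_dvd_iff.2 hz

theorem X_pow_dvd_mul_pow {z : ℂ⟦X⟧} (hz : PowerSeries.constantCoeff z = 0) (c : ℂ⟦X⟧) (k : ℕ) :
    (PowerSeries.X : ℂ⟦X⟧) ^ k ∣ c * z ^ k :=
  Dvd.dvd.mul_left (pow_dvd_pow_of_dvd (X_dvd_of_constantCoeff hz) k) c

theorem X_pow_dvd_primCoeff {z : ℂ⟦X⟧} (hz : PowerSeries.constantCoeff z = 0) (k : ℕ) :
    (PowerSeries.X : ℂ⟦X⟧) ^ (k + 1) ∣ primCoeff z k := X_pow_dvd_mul_pow hz _ _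

theorem C_inv_factorial_mul (k : ℕ) :
    (PowerSeries.C (1 / ((k + 1).factorial : ℂ)) : ℂ⟦X⟧) * (k.factorial : ℂ⟦X⟧) =
      PowerSeries.C (1 / ((k : ℂ) + 1)) := by
  rw [← map_natCast (PowerSeries.C (R := ℂ)), ← map_mul]
  congr 1
  have h1 : ((k : ℂ) + 1) ≠ 0 := Nat.cast_add_one_ne_zero k
  have h2 : (k.factorial : ℂ) ≠ 0 := Nat.cast_ne_zero.2 k.factorial_ne_zero
  rw [Nat.factorial_succ]
  push_cast
  field_simp

/-- The factorials cancel to `z^(k+1)/(k+1)`, the weight with which `a_{-k-1}` occurs in `∫₀^z Y⁺(a,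
t) dt`. This match lets an integral in `V` become `zL(z∂)` on `W`. -/
theorem zL_term (z : ℂ⟦X⟧) (A : FSeries M) (n : ℤ) (k : ℕ) :
    (PowerSeries.C (1 / ((k + 1).factorial : ℂ)) * z ^ (k + 1) : ℂ⟦X⟧) • (dx^[k] A) n =
      primCoeff z k • (Ring.choose (n + k) k : ℤ) • A (n + k) := by
  rw [dx_iterate, mul_smul (k.factorial : ℤ), natCast_zsmul, ← Nat.cast_smul_eq_nsmul ℂ⟦X⟧,
    smul_smul, mul_right_comm, C_inv_factorial_mul, primCoeff]

theorem zLConv (hM : TopFree M) {z : ℂ⟦X⟧} (hz : PowerSeries.constantCoeff z = 0)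
    (A : FSeries M) : ZLConv z A := fun _ =>
  opSummable_of_hNull hM fun m => hNull_of_dvd (fun k =>
    (pow_dvd_pow _ k.le_succ).trans (X_pow_dvd_mul_pow hz _ (k + 1))) fun k => (dx^[k] A) _ m

theorem shiftConv (hM : TopFree M) {z : ℂ⟦X⟧} (hz : PowerSeries.constantCoeff z = 0)
    (A : FSeries M) : ShiftConv z A := fun _ =>
  opSummable_of_hNull hM fun m => hNull_of_dvd (fun k => X_pow_dvd_mul_pow hz _ k)
    fun k => (dx^[k] A) _ m

theorem hasOpSum_zL (hM : TopFree M) {z : ℂ⟦X⟧} (hz : PowerSeries.constantCoeff z = 0)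
    (A : FSeries M) (n : ℤ) :
    HasOpSum (fun k : ℕ => primCoeff z k • (Ring.choose (n + k) k : ℤ) • A (n + k)) (zL z A n) := by
  have := (zLConv hM hz A n).hasOpSum
  simp only [zL_term] at this
  rw [zL]
  simp only [zL_term]
  exact this

theorem zL_mem_hFil (hM : TopFree M) {z : ℂ⟦X⟧} (hz : PowerSeries.constantCoeff z = 0)
    (A : FSeries M) (n : ℤ) (m : M) : zL z A n m ∈ hFil M 1 :=
  (hasOpSum_zL hM hz A n).mem_hFil fun k =>
    smul_mem_hFil ((pow_dvd_pow _ (by omega)).trans (X_pow_dvd_primCoeff hz k)) _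

end Shift

/-! ### The field of `∫₀^z Y⁺(a, t)v dt`. -/

section

variable {V W : Type*} [AddCommGroup V] [Module ℂ⟦X⟧ V] [AddCommGroup W] [Module ℂ⟦X⟧ W]
  {𝒱 : NonlocalVA V}

/-- The sign of `-a` cancels that of `1/n` for `n = -(k+1)`, so the exponent of `E⁻(-a, z)` is `∫₀^z
Y⁺(a, t) dt`. -/
theorem minusTerm_neg (𝒱 : NonlocalVA V) (a : V) (z : ℂ⟦X⟧) (k : ℕ) :
    minusTerm (𝒱.Y (-a)) z k = primCoeff z k • 𝒱.Y a k := by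
  rw [minusTerm, mode, map_neg, Pi.neg_apply, smul_neg, ← neg_smul, primCoeff, ← neg_mul,
    ← map_neg, one_div, inv_neg, neg_neg, one_div, neg_neg, add_sub_cancel_right]

theorem hasOpSum_minusTerm (𝒱 : NonlocalVA V) (a : V) {z : ℂ⟦X⟧}
    (hz : PowerSeries.constantCoeff z = 0) :
    HasOpSum (fun k => primCoeff z k • 𝒱.Y a k) (opSum (minusTerm (𝒱.Y (-a)) z)) := by
  have : OpSummable (minusTerm (𝒱.Y (-a)) z) := by
    rw [funext (minusTerm_neg 𝒱 a z)]
    exact opSummable_of_hNull 𝒱.topFree fun m => hNull_of_dvd (fun k =>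
      (pow_dvd_pow _ k.le_succ).trans (X_pow_dvd_primCoeff hz k)) fun k => 𝒱.Y a k m
  simpa only [funext (minusTerm_neg 𝒱 a z)] using this.hasOpSum

theorem HNull.ite {ι M : Type*} [AddCommGroup M] [Module ℂ⟦X⟧ M] {f : ι → M} (h : HNull f)
    (p : ι → Prop) [DecidablePred p] : HNull fun i => if p i then f i else 0 := fun r => by
  obtain ⟨F, hF⟩ := h r
  refine ⟨F, fun i hi => ?_⟩
  beta_reduce
  split_ifs
  · exact hF i hi
  · exact zero_mem _

theorem HNull.prod_smul {ι M : Type*} [AddCommGroup M] [Module ℂ⟦X⟧ M] {c : ℕ → ℂ⟦X⟧}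
    (hc : ∀ k, (PowerSeries.X : ℂ⟦X⟧) ^ k ∣ c k) {g : ℕ × ι → M}
    (hg : ∀ k, HNull fun j => g (k, j)) : HNull fun p => c p.1 • g p :=
  HNull.prod (fun k => (hg k).map (LinearMap.lsmul ℂ⟦X⟧ M (c k))) fun r =>
    ⟨Finset.range r, fun k hk j =>
      hFil_antitone (by simpa using hk) (smul_mem_hFil (hc k) (g (k, j)))⟩

/-- `Y_W(∫₀^z Y⁺(a, t)v dt, x)` as a normally ordered product. -/
theorem VAModule.Y_primitive (𝒲 : VAModule 𝒱 W) {a v : V} (hv : v ∈ 𝒲.commSubmodule a)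
    {z : ℂ⟦X⟧} (hz : PowerSeries.constantCoeff z = 0) (n : ℤ) (w : W) :
    ∃ s t, HasHSum (fun j : ℤ => zL z (regPart (𝒲.Y a)) j (𝒲.Y v (n - j) w)) s ∧
      HasHSum (fun j : ℤ => 𝒲.Y v (n - j) (zL z (singPart (𝒲.Y a)) j w)) t ∧
      𝒲.Y (opSum (minusTerm (𝒱.Y (-a)) z) v) n w = s + t := by
  have hc : ∀ k, (PowerSeries.X : ℂ⟦X⟧) ^ k ∣ primCoeff z k := fun k =>
    (pow_dvd_pow _ k.le_succ).trans (X_pow_dvd_primCoeff hz k)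
  -- Substituting `m = j + k` makes the factor `Y_W(v)` independent of `k`.
  have hnorm := fun k : ℕ => (𝒲.hasHSum_normal hv k n w).comp_equiv (Equiv.addRight (k : ℤ))
  simp only [Equiv.coe_addRight, show ∀ (k : ℕ) (j : ℤ), n + k - (j + k) = n - j from
    fun k j => by ring] at hnorm
  set g₁ : ℕ × ℤ → W := fun p => (Ring.choose (p.2 + p.1) p.1 : ℤ) •
    regPart (𝒲.Y a) (p.2 + p.1) (𝒲.Y v (n - p.2) w) with hg₁
  set g₂ : ℕ × ℤ → W := fun p => (Ring.choose (p.2 + p.1) p.1 : ℤ) •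
    𝒲.Y v (n - p.2) (singPart (𝒲.Y a) (p.2 + p.1) w) with hg₂
  have hn₁ : ∀ k, HNull fun j => g₁ (k, j) := by
    intro k
    convert (hnorm k).null.ite fun j : ℤ => 0 ≤ j + k using 2 with j
    simp only [hg₁, regPart]
    split_ifs <;> simp
  have hn₂ : ∀ k, HNull fun j => g₂ (k, j) := by
    intro k
    convert (hnorm k).null.ite fun j : ℤ => j + k < 0 using 2 with j
    simp only [hg₂, singPart]
    split_ifs <;> first | omega | simp
  -- The powers of `z` make the rows uniformly small, so the sums over `k` and `j` may be
  -- interchanged.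
  have hN₁ := HNull.prod_smul hc hn₁
  have hN₂ := HNull.prod_smul hc hn₂
  choose s₁ hs₁ using fun k => (hn₁ k).exists_hasHSum 𝒲.topFree
  choose s₂ hs₂ using fun k => (hn₂ k).exists_hasHSum 𝒲.topFree
  have hsum : ∀ k : ℕ, 𝒲.Y (𝒱.Y a k v) n w = s₁ k + s₂ k := by
    intro k
    refine (hnorm k).unique 𝒲.topFree ?_
    convert (hs₁ k).add (hs₂ k) using 2 with j
    simp only [hg₁, hg₂, regPart, singPart]
    split_ifs <;> first | omega | simp
  obtain ⟨s, hs⟩ := (hNull_of_dvd hc s₁).exists_hasHSum 𝒲.topFree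
  obtain ⟨t, ht⟩ := (hNull_of_dvd hc s₂).exists_hasHSum 𝒲.topFree
  refine ⟨s, t, ?_, ?_, ?_⟩
  · refine HasHSum.comm 𝒲.topFree hN₁ (fun k => (hs₁ k).smul (primCoeff z k)) (fun j => ?_) hs
    have := hasOpSum_zL 𝒲.topFree hz (regPart (𝒲.Y a)) j (𝒲.Y v (n - j) w)
    simp only [LinearMap.smul_apply] at this
    exact this
  · refine HasHSum.comm 𝒲.topFree hN₂ (fun k => (hs₂ k).smul (primCoeff z k)) (fun j => ?_) ht
    have := (hasOpSum_zL 𝒲.topFree hz (singPart (𝒲.Y a)) j w).map (𝒲.Y v (n - j))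
    simp only [LinearMap.smul_apply, map_smul, map_zsmul] at this
    exact this
  · have h := (hasOpSum_minusTerm 𝒱 a hz v).map (𝒲.modeMap n w)
    refine h.unique 𝒲.topFree ?_
    simpa [hsum] using hs.add ht

theorem VAModule.primitive_mem_commCore (𝒲 : VAModule 𝒱 W) {γ : ℤ → ℂ⟦X⟧} {a v : V}
    (h : HeisenbergRel γ (𝒱.Y a)) (hW : HeisenbergRel γ (𝒲.Y a)) (hv : v ∈ 𝒲.commCore a)
    {z : ℂ⟦X⟧} (hz : PowerSeries.constantCoeff z = 0) :
    opSum (minusTerm (𝒱.Y (-a)) z) v ∈ 𝒲.commCore a :=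
  𝒲.mem_commCore_of_hasHSum
    (fun k => 𝒲.smul_mem_commCore (𝒲.mode_mem_commCore h hW hv k) (primCoeff z k))
    (hasOpSum_minusTerm 𝒱 a hz v)

end

/-! ### Exponentials and shifts in `S⟦X⟧` for a commutative algebra `S` of operators. -/

section Model

variable {M : Type*} [AddCommGroup M] [Module ℂ⟦X⟧ M] {S : Type*} [CommRing S] [Algebra ℂ⟦X⟧ S]
  (φ : S →ₐ[ℂ⟦X⟧] Module.End ℂ⟦X⟧ M)

/-- The elements which act on `M` with image in `ħ^r M`. -/
def opFil (r : ℕ) : Ideal S where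
  carrier := {s | ∀ m, φ s m ∈ hFil M r}
  add_mem' hs ht m := by
    rw [map_add, LinearMap.add_apply]
    exact add_mem (hs m) (ht m)
  zero_mem' m := by
    rw [map_zero]
    exact zero_mem _
  smul_mem' c s hs m := by
    rw [smul_eq_mul, map_mul, Module.End.mul_apply]
    exact map_mem_hFil _ (hs m)

/-- A commutative algebra of operators which is closed under uniformly convergent series. -/
structure IsClosedModel : Prop where
  injective : Function.Injective φ
  closed : ∀ u : ℕ → S, (∀ r, ∃ K, ∀ k ≥ K, u k ∈ opFil φ r) →
    ∃ s, HasOpSum (fun k => φ (u k)) (φ s)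

variable {φ}

theorem opFil_antitone {r t : ℕ} (h : r ≤ t) : opFil φ t ≤ opFil φ r := fun _ hs m =>
  hFil_antitone h (hs m)

theorem mem_opFil_zero (s : S) : s ∈ opFil φ 0 := fun _ => mem_hFil_zero _

theorem mul_mem_opFil {r t : ℕ} {s s' : S} (hs : s ∈ opFil φ r) (hs' : s' ∈ opFil φ t) :
    s * s' ∈ opFil φ (r + t) := by
  intro m
  obtain ⟨y, hy⟩ := mem_hFil.1 (hs' m)
  rw [map_mul, Module.End.mul_apply, ← hy, map_smul, add_comm]
  exact smul_mem_hFil_add (dvd_refl _) (hs y)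

theorem smul_mem_opFil {r t : ℕ} {c : ℂ⟦X⟧} (hc : (PowerSeries.X : ℂ⟦X⟧) ^ r ∣ c) {s : S}
    (hs : s ∈ opFil φ t) : c • s ∈ opFil φ (r + t) := by
  intro m
  rw [map_smul, LinearMap.smul_apply]
  exact smul_mem_hFil_add hc (hs m)

variable (φ) in
/-- The ideals defining the `(ħ, y)`-adic topology on `S[[y]]`. -/
def serFil (N : ℕ) : Ideal S⟦X⟧ where
  carrier := {g | ∀ n, PowerSeries.coeff n g ∈ opFil φ (N - n)}
  add_mem' hg hh n := by
    rw [map_add]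
    exact add_mem (hg n) (hh n)
  zero_mem' n := by
    rw [map_zero]
    exact zero_mem _
  smul_mem' c g hg n := by
    rw [smul_eq_mul, PowerSeries.coeff_mul]
    refine Ideal.sum_mem _ fun p hp => Ideal.mul_mem_left _ _ ?_
    have := Finset.HasAntidiagonal.mem_antidiagonal.1 hp
    exact opFil_antitone (by omega) (hg p.2)

theorem serFil_antitone {N N' : ℕ} (h : N ≤ N') : serFil φ N' ≤ serFil φ N := fun _ hg n =>
  opFil_antitone (by omega) (hg n)

theorem mem_serFil_zero (g : S⟦X⟧) : g ∈ serFil φ 0 := fun n => by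
  rw [Nat.zero_sub]
  exact mem_opFil_zero _

theorem mul_mem_serFil {N N' : ℕ} {g h : S⟦X⟧} (hg : g ∈ serFil φ N) (hh : h ∈ serFil φ N') :
    g * h ∈ serFil φ (N + N') := by
  intro n
  rw [PowerSeries.coeff_mul]
  refine Ideal.sum_mem _ fun p hp => ?_
  have := Finset.HasAntidiagonal.mem_antidiagonal.1 hp
  exact opFil_antitone (by omega) (mul_mem_opFil (hg p.1) (hh p.2))

theorem pow_mem_serFil {f : S⟦X⟧} (hf : f ∈ serFil φ 1) (k : ℕ) : f ^ k ∈ serFil φ k := by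
  induction k with
  | zero => exact mem_serFil_zero _
  | succ k ih =>
    rw [pow_succ]
    exact mul_mem_serFil ih hf

theorem smul_mem_serFil {N r : ℕ} {c : ℂ⟦X⟧} (hc : (PowerSeries.X : ℂ⟦X⟧) ^ r ∣ c) {g : S⟦X⟧}
    (hg : g ∈ serFil φ N) : c • g ∈ serFil φ (r + N) := by
  intro n
  rw [PowerSeries.coeff_smul]
  exact opFil_antitone (by omega) (smul_mem_opFil hc (hg n))

theorem smul_mem_serFil_of_dvd {r : ℕ} {c : ℂ⟦X⟧} (hc : (PowerSeries.X : ℂ⟦X⟧) ^ r ∣ c)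
    (g : S⟦X⟧) : c • g ∈ serFil φ r := by
  have := smul_mem_serFil hc (mem_serFil_zero (φ := φ) g)
  rwa [add_zero] at this

theorem smul_mem_serFil' {N : ℕ} (c : ℂ⟦X⟧) {g : S⟦X⟧}
    (hg : g ∈ serFil φ N) : c • g ∈ serFil φ N := by
  simpa using smul_mem_serFil (r := 0) (c := c) (by simp) hg

theorem IsClosedModel.eq_zero (hφ : IsClosedModel φ) (hM : TopFree M) {g : S⟦X⟧}
    (hg : ∀ N, g ∈ serFil φ N) : g = 0 := by
  ext n
  apply hφ.injective
  ext m
  rw [map_zero, map_zero, LinearMap.zero_apply]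
  exact hM.eq_zero fun r => by simpa using hg (r + n) n m

theorem IsClosedModel.eq_of_mk_eq (hφ : IsClosedModel φ) (hM : TopFree M) {g h : S⟦X⟧}
    (hgh : ∀ N, Ideal.Quotient.mk (serFil φ N) g = Ideal.Quotient.mk (serFil φ N) h) : g = h :=
  sub_eq_zero.1 (hφ.eq_zero hM fun N => Ideal.Quotient.eq.1 (hgh N))

variable (φ) in
/-- Convergence of a series in the `(ħ, y)`-adic topology. -/
def HasSerSum (u : ℕ → S⟦X⟧) (s : S⟦X⟧) : Prop :=
  ∀ N, ∃ K, ∀ k ≥ K, s - ∑ i ∈ Finset.range k, u i ∈ serFil φ N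

theorem HasSerSum.eventually_mem {u : ℕ → S⟦X⟧} {s : S⟦X⟧} (h : HasSerSum φ u s) (N : ℕ) :
    ∃ K, ∀ k ≥ K, u k ∈ serFil φ N := by
  obtain ⟨K, hK⟩ := h N
  refine ⟨K, fun k hk => ?_⟩
  have := sub_mem (hK k hk) (hK (k + 1) (by omega))
  rw [Finset.sum_range_succ] at this
  simpa using this

theorem HasSerSum.add {u v : ℕ → S⟦X⟧} {s t : S⟦X⟧} (hu : HasSerSum φ u s)
    (hv : HasSerSum φ v t) : HasSerSum φ (fun k => u k + v k) (s + t) := by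
  intro N
  obtain ⟨K, hK⟩ := hu N
  obtain ⟨L, hL⟩ := hv N
  refine ⟨max K L, fun k hk => ?_⟩
  rw [Finset.sum_add_distrib, add_sub_add_comm]
  exact add_mem (hK k (le_trans (le_max_left _ _) hk)) (hL k (le_trans (le_max_right _ _) hk))

theorem HasSerSum.mem_serFil {u : ℕ → S⟦X⟧} {s : S⟦X⟧} (h : HasSerSum φ u s) {N : ℕ}
    (hu : ∀ k, u k ∈ serFil φ N) : s ∈ serFil φ N := by
  obtain ⟨K, hK⟩ := h N
  simpa using add_mem (hK K le_rfl) (Ideal.sum_mem _ fun i (_ : i ∈ Finset.range K) => hu i)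

theorem IsClosedModel.exists_hasSerSum (hφ : IsClosedModel φ) {u : ℕ → S⟦X⟧}
    (hu : ∀ N, ∃ K, ∀ k ≥ K, u k ∈ serFil φ N) : ∃ s, HasSerSum φ u s := by
  choose s hs using fun n => hφ.closed (fun k => PowerSeries.coeff n (u k)) fun r => by
    obtain ⟨K, hK⟩ := hu (r + n)
    exact ⟨K, fun k hk => by simpa using hK k hk n⟩
  refine ⟨PowerSeries.mk s, fun N => ?_⟩
  obtain ⟨K, hK⟩ := hu N
  refine ⟨K, fun k hk n m => ?_⟩
  have h1 := (hs n m).sum_sub_mem (r := N - n) (F := Finset.range k) fun i hi =>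
    hK i (by simp at hi; omega) n m
  have h2 := neg_mem h1
  simpa using h2

theorem HasSerSum.hasOpSum_coeff {u : ℕ → S⟦X⟧} {s : S⟦X⟧} (h : HasSerSum φ u s) (n : ℕ) :
    HasOpSum (fun k => φ (PowerSeries.coeff n (u k))) (φ (PowerSeries.coeff n s)) := by
  intro m
  refine hasHSum_of_forall_exists fun r => ?_
  obtain ⟨K, hK⟩ := h (r + n)
  obtain ⟨L, hL⟩ := h.eventually_mem (r + n)
  refine ⟨Finset.range (max K L), fun i hi => ?_, ?_⟩
  · simpa using hL i (by simp at hi; omega) n m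
  · have := neg_mem (hK (max K L) (le_max_left _ _) n m)
    simpa using this

/-! ### Exponentials -/

/-- The terms of the exponential series. -/
def expTerm (f : S⟦X⟧) (k : ℕ) : S⟦X⟧ :=
  (PowerSeries.C (1 / (k.factorial : ℂ)) : ℂ⟦X⟧) • f ^ k

theorem IsClosedModel.exists_exp (hφ : IsClosedModel φ) {f : S⟦X⟧} (hf : f ∈ serFil φ 1) :
    ∃ e, HasSerSum φ (expTerm f) e :=
  hφ.exists_hasSerSum fun N => ⟨N, fun k hk =>
    serFil_antitone hk (smul_mem_serFil' _ (pow_mem_serFil hf k))⟩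

variable (D : Derivation ℂ⟦X⟧ S⟦X⟧ S⟦X⟧)

/-- The terms of `e^{z D} g`. -/
def shiftTerm (z : ℂ⟦X⟧) (g : S⟦X⟧) (k : ℕ) : S⟦X⟧ :=
  (PowerSeries.C (1 / (k.factorial : ℂ)) * z ^ k : ℂ⟦X⟧) • (D^[k] g)

/-- The terms of `z L(z D) g`, where `L(t) = (e^t - 1) / t`. -/
def zLTerm (z : ℂ⟦X⟧) (g : S⟦X⟧) (k : ℕ) : S⟦X⟧ :=
  (PowerSeries.C (1 / ((k + 1).factorial : ℂ)) * z ^ (k + 1) : ℂ⟦X⟧) • (D^[k] g)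

theorem IsClosedModel.exists_shift (hφ : IsClosedModel φ) {z : ℂ⟦X⟧}
    (hz : PowerSeries.constantCoeff z = 0) (g : S⟦X⟧) : ∃ h, HasSerSum φ (shiftTerm D z g) h :=
  hφ.exists_hasSerSum fun N => ⟨N, fun k hk =>
    serFil_antitone hk (smul_mem_serFil_of_dvd (X_pow_dvd_mul_pow hz _ k) _)⟩

theorem zLTerm_mem {z : ℂ⟦X⟧} (hz : PowerSeries.constantCoeff z = 0) (g : S⟦X⟧) (k : ℕ) :
    zLTerm D z g k ∈ serFil φ (k + 1) :=
  smul_mem_serFil_of_dvd (X_pow_dvd_mul_pow hz _ (k + 1)) _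

theorem IsClosedModel.exists_zL (hφ : IsClosedModel φ) {z : ℂ⟦X⟧}
    (hz : PowerSeries.constantCoeff z = 0) (g : S⟦X⟧) : ∃ h, HasSerSum φ (zLTerm D z g) h :=
  hφ.exists_hasSerSum fun N => ⟨N, fun k hk =>
    serFil_antitone (by omega) (zLTerm_mem D hz g k)⟩

theorem HasSerSum.zL_mem {z : ℂ⟦X⟧} (hz : PowerSeries.constantCoeff z = 0) {g h : S⟦X⟧}
    (hh : HasSerSum φ (zLTerm D z g) h) : h ∈ serFil φ 1 :=
  hh.mem_serFil fun k => serFil_antitone (by omega) (zLTerm_mem D hz g k)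

theorem C_inv_factorial_smul {B : Type*} [AddCommGroup B] [Module ℚ B] [Module ℂ⟦X⟧ B] (k : ℕ)
    (x : B) : (k.factorial : ℚ)⁻¹ • x = (PowerSeries.C (1 / (k.factorial : ℂ)) : ℂ⟦X⟧) • x := by
  have h : (k.factorial : ℂ) ≠ 0 := Nat.cast_ne_zero.2 k.factorial_ne_zero
  rw [inv_smul_eq_iff₀ (Nat.cast_ne_zero.2 k.factorial_ne_zero), Nat.cast_smul_eq_nsmul,
    ← Nat.cast_smul_eq_nsmul ℂ⟦X⟧, smul_smul, ← map_natCast (PowerSeries.C (R := ℂ)), ← map_mul,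
    mul_one_div_cancel h, map_one, one_smul]

/-- The rational structure on a `ℂ[[ħ]]`-module. -/
abbrev ratModule (B : Type*) [AddCommGroup B] [Module ℂ⟦X⟧ B] : Module ℚ B :=
  Module.compHom B (algebraMap ℚ ℂ⟦X⟧)

theorem mk_pow_eq_zero {f : S⟦X⟧} (hf : f ∈ serFil φ 1) {N k : ℕ} (hk : N ≤ k) :
    (Ideal.Quotient.mk (serFil φ N) f) ^ k = 0 := by
  rw [← map_pow, Ideal.Quotient.eq_zero_iff_mem]
  exact serFil_antitone hk (pow_mem_serFil hf k)

theorem mk_smul (I : Ideal S⟦X⟧) (c : ℂ⟦X⟧) (g : S⟦X⟧) :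
    Ideal.Quotient.mk I (c • g) = c • Ideal.Quotient.mk I g := rfl

/-- Modulo `serFil φ N` the element `f` is nilpotent, so the exponential series becomes the finite
`IsNilpotent.exp`. -/
theorem HasSerSum.mk_exp {f e : S⟦X⟧} (hf : f ∈ serFil φ 1) (he : HasSerSum φ (expTerm f) e)
    (N : ℕ) : letI := ratModule (S⟦X⟧ ⧸ serFil φ N)
      Ideal.Quotient.mk (serFil φ N) e = IsNilpotent.exp (Ideal.Quotient.mk (serFil φ N) f) := by
  let _ := ratModule (S⟦X⟧ ⧸ serFil φ N)
  obtain ⟨K, hK⟩ := he N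
  rw [IsNilpotent.exp_eq_sum (mk_pow_eq_zero hf (le_max_right K N)),
    Ideal.Quotient.eq.2 (hK (max K N) (le_max_left _ _)), map_sum]
  refine Finset.sum_congr rfl fun i _ => ?_
  rw [C_inv_factorial_smul, expTerm, mk_smul, map_pow]

/-- The identity holds for nilpotent commuting elements in every truncation, and the truncations
separate points. -/
theorem IsClosedModel.exp_add (hφ : IsClosedModel φ) (hM : TopFree M) {f g e₁ e₂ e : S⟦X⟧}
    (hf : f ∈ serFil φ 1) (hg : g ∈ serFil φ 1) (h₁ : HasSerSum φ (expTerm f) e₁)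
    (h₂ : HasSerSum φ (expTerm g) e₂) (h : HasSerSum φ (expTerm (f + g)) e) : e = e₁ * e₂ := by
  refine hφ.eq_of_mk_eq hM fun N => ?_
  let _ := ratModule (S⟦X⟧ ⧸ serFil φ N)
  rw [h.mk_exp (add_mem hf hg), map_mul, h₁.mk_exp hf, h₂.mk_exp hg, map_add]
  exact IsNilpotent.exp_add_of_commute (Commute.all _ _) ⟨N, mk_pow_eq_zero hf le_rfl⟩
    ⟨N, mk_pow_eq_zero hg le_rfl⟩

theorem smul_derivation_iterate (z : ℂ⟦X⟧) (g : S⟦X⟧) (k : ℕ) :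
    (z • D)^[k] g = z ^ k • (D^[k] g) := by
  induction k with
  | zero => simp
  | succ k ih =>
    rw [Function.iterate_succ_apply', ih, Function.iterate_succ_apply', Derivation.smul_apply,
      Derivation.map_smul, smul_smul, pow_succ']

/-- The action of `z D` on a truncation. -/
def truncDer {N : ℕ} (z : ℂ⟦X⟧) (hD : ∀ g ∈ serFil φ N, z • D g ∈ serFil φ N) :
    Module.End ℂ⟦X⟧ (S⟦X⟧ ⧸ serFil φ N) :=
  let e := Submodule.Quotient.restrictScalarsEquiv ℂ⟦X⟧ (serFil φ N)
  e.toLinearMap ∘ₗ Submodule.mapQ _ _ ((z • D : Derivation ℂ⟦X⟧ S⟦X⟧ S⟦X⟧) : S⟦X⟧ →ₗ[ℂ⟦X⟧] S⟦X⟧)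
    (fun g hg => hD g hg) ∘ₗ e.symm.toLinearMap

theorem truncDer_mk {N : ℕ} {z : ℂ⟦X⟧} (hD : ∀ g ∈ serFil φ N, z • D g ∈ serFil φ N)
    (g : S⟦X⟧) : truncDer D z hD (Ideal.Quotient.mk _ g) = Ideal.Quotient.mk _ (z • D g) := rfl

theorem truncDer_pow_mk {N : ℕ} {z : ℂ⟦X⟧} (hD : ∀ g ∈ serFil φ N, z • D g ∈ serFil φ N)
    (g : S⟦X⟧) (k : ℕ) : (truncDer D z hD ^ k) (Ideal.Quotient.mk _ g) =
      Ideal.Quotient.mk _ (z ^ k • (D^[k] g)) := by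
  rw [← smul_derivation_iterate]
  induction k with
  | zero => simp
  | succ k ih =>
    rw [pow_succ', Module.End.mul_apply, ih, truncDer_mk, Function.iterate_succ_apply',
      Derivation.smul_apply]

theorem truncDer_pow_eq_zero {N : ℕ} {z : ℂ⟦X⟧} (hz : PowerSeries.constantCoeff z = 0)
    (hD : ∀ g ∈ serFil φ N, z • D g ∈ serFil φ N) {k : ℕ} (hk : N ≤ k) :
    truncDer D z hD ^ k = 0 := by
  refine LinearMap.ext fun x => ?_
  obtain ⟨g, rfl⟩ := Ideal.Quotient.mk_surjective x
  rw [truncDer_pow_mk, LinearMap.zero_apply, Ideal.Quotient.eq_zero_iff_mem]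
  have hzk : (PowerSeries.X : ℂ⟦X⟧) ^ k ∣ z ^ k := by simpa using X_pow_dvd_mul_pow hz 1 k
  exact serFil_antitone hk (smul_mem_serFil_of_dvd hzk _)

theorem exp_truncDer_mk {N : ℕ} {z : ℂ⟦X⟧} (hz : PowerSeries.constantCoeff z = 0)
    (hD : ∀ g ∈ serFil φ N, z • D g ∈ serFil φ N) (g : S⟦X⟧) {k : ℕ} (hk : N ≤ k) :
    letI := ratModule (S⟦X⟧ ⧸ serFil φ N)
    IsNilpotent.exp (truncDer D z hD) (Ideal.Quotient.mk _ g) =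
      Ideal.Quotient.mk _ (∑ i ∈ Finset.range k, shiftTerm D z g i) := by
  let _ := ratModule (S⟦X⟧ ⧸ serFil φ N)
  rw [IsNilpotent.exp_eq_sum (truncDer_pow_eq_zero D hz hD hk), LinearMap.sum_apply, map_sum]
  refine Finset.sum_congr rfl fun i _ => ?_
  rw [LinearMap.smul_apply, truncDer_pow_mk, C_inv_factorial_smul, shiftTerm, ← mk_smul, smul_smul]

/-- `e^{zD}(e^f) e^{-f} = e^{z L(zD) D f}`. -/
theorem IsClosedModel.shift_exp_mul_exp_neg (hφ : IsClosedModel φ) (hM : TopFree M) {z : ℂ⟦X⟧}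
    (hz : PowerSeries.constantCoeff z = 0)
    (hD : ∀ N, ∀ g ∈ serFil φ N, z • D g ∈ serFil φ N) {f e e' h b c : S⟦X⟧}
    (hf : f ∈ serFil φ 1) (he : HasSerSum φ (expTerm f) e) (he' : HasSerSum φ (expTerm (-f)) e')
    (hh : HasSerSum φ (shiftTerm D z e) h) (hb : HasSerSum φ (zLTerm D z (D f)) b)
    (hc : HasSerSum φ (expTerm b) c) : h * e' = c := by
  refine hφ.eq_of_mk_eq hM fun N => ?_
  let _ := ratModule (S⟦X⟧ ⧸ serFil φ N)
  set π := Ideal.Quotient.mk (serFil φ N) with hπ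
  set δ := truncDer D z (hD N) with hδ
  have hδnil : IsNilpotent δ := ⟨N, truncDer_pow_eq_zero D hz (hD N) le_rfl⟩
  have hbmem := hb.zL_mem D hz
  -- `zD` is a nilpotent derivation of the truncation, so its exponential is multiplicative and
  -- hence a ring endomorphism `χ`.
  have hmul : ∀ x y, IsNilpotent.exp δ (x * y) = IsNilpotent.exp δ x * IsNilpotent.exp δ y := by
    refine Module.End.exp_mul_of_derivation ℂ⟦X⟧ _ δ (fun x y => ?_) hδnil
    obtain ⟨g, rfl⟩ := Ideal.Quotient.mk_surjective x
    obtain ⟨g', rfl⟩ := Ideal.Quotient.mk_surjective y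
    rw [← map_mul, hδ, truncDer_mk, truncDer_mk, truncDer_mk, ← map_mul, ← map_mul, ← map_add,
      Derivation.leibniz, smul_add, smul_eq_mul, smul_eq_mul, mul_smul_comm, smul_mul_assoc,
      mul_comm g' (D g)]
  have hone : IsNilpotent.exp δ 1 = 1 := by
    have h1 := exp_truncDer_mk D hz (hD N) 1 (k := N + 1) (by omega)
    rw [map_one] at h1
    rw [hδ, h1, Finset.sum_range_succ', map_add, map_sum, Finset.sum_eq_zero fun i _ => ?_]
    · simp [shiftTerm]
    · have : ∀ j, D^[j] (0 : S⟦X⟧) = 0 := fun j => Function.iterate_fixed (map_zero D) j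
      rw [shiftTerm, Function.iterate_succ_apply, Derivation.map_one_eq_zero, this, smul_zero,
        map_zero]
  let χ : (S⟦X⟧ ⧸ serFil φ N) →+* (S⟦X⟧ ⧸ serFil φ N) :=
    { toFun := fun x => IsNilpotent.exp δ x, map_one' := hone, map_mul' := hmul,
      map_zero' := map_zero (IsNilpotent.exp δ), map_add' := map_add (IsNilpotent.exp δ) }
  have hχ : ∀ x, χ x = IsNilpotent.exp δ x := fun _ => rfl
  have hh' : π h = χ (π e) := by
    obtain ⟨K, hK⟩ := hh N
    rw [hχ, exp_truncDer_mk D hz (hD N) e (le_max_right K N)]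
    exact Ideal.Quotient.eq.2 (hK _ (le_max_left _ _))
  -- Splitting off the term `k = 0` of `e^{zD}f` leaves exactly `zL(zD)Df`.
  have hf' : χ (π f) = π f + π b := by
    obtain ⟨K, hK⟩ := hb N
    rw [hχ, exp_truncDer_mk D hz (hD N) f (k := max K N + 1) (by omega), Finset.sum_range_succ',
      add_comm, map_add]
    congr 1
    · simp [shiftTerm, hπ]
    · rw [hπ, Ideal.Quotient.eq.2 (hK (max K N) (le_max_left _ _))]
      rfl
  have hfn : IsNilpotent (π f) := ⟨N, mk_pow_eq_zero hf le_rfl⟩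
  have hbn : IsNilpotent (π b) := ⟨N, mk_pow_eq_zero hbmem le_rfl⟩
  -- `χ(e^f)e^{-f} = e^{χ(f)}e^{-f} = e^{f+b}e^{-f} = e^b`.
  rw [map_mul, hh', hπ, he.mk_exp hf, he'.mk_exp (neg_mem hf), hc.mk_exp hbmem,
    IsNilpotent.map_exp hfn, hf', IsNilpotent.exp_add_of_commute (Commute.all _ _) hfn hbn, map_neg,
    mul_right_comm, IsNilpotent.exp_mul_exp_neg_self hfn, one_mul]

end Model

/-! ### From power series in `y = x^{±1}` to operator series. -/

section Embedding

variable {M : Type*} [AddCommGroup M] [Module ℂ⟦X⟧ M] {S : Type*} [CommRing S] [Algebra ℂ⟦X⟧ S]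
  (φ : S →ₐ[ℂ⟦X⟧] Module.End ℂ⟦X⟧ M)

/-- The series of operators obtained from a power series by substituting `y = x ^ ε`, `ε = ±1`. -/
def emb (ε : ℤˣ) (g : S⟦X⟧) : FSeries M := fun n =>
  if 0 ≤ ε * n then φ (PowerSeries.coeff (ε * n : ℤ).toNat g) else 0

theorem unit_mul_unit_mul (ε : ℤˣ) (n : ℤ) : (ε : ℤ) * (ε * n) = n := by
  rw [← mul_assoc, ← Units.val_mul, Int.units_mul_self, Units.val_one, one_mul]

theorem emb_natCast (ε : ℤˣ) (g : S⟦X⟧) (n : ℕ) :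
    emb φ ε g (ε * n) = φ (PowerSeries.coeff n g) := by
  simp [emb, unit_mul_unit_mul]

theorem emb_of_neg (ε : ℤˣ) (g : S⟦X⟧) {n : ℤ} (hn : ε * n < 0) : emb φ ε g n = 0 := by
  rw [emb, if_neg (by omega)]

theorem exists_eq_unit_mul (ε : ℤˣ) (n : ℤ) : (∃ j : ℕ, n = ε * j) ∨ ε * n < 0 := by
  rcases lt_or_ge ((ε : ℤ) * n) 0 with h | h
  · exact Or.inr h
  · refine Or.inl ⟨(ε * n : ℤ).toNat, ?_⟩
    rw [Int.toNat_of_nonneg h, unit_mul_unit_mul]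

theorem emb_ext {ε : ℤˣ} {g : S⟦X⟧} {A : FSeries M} (h : ∀ j : ℕ, A (ε * j) =
    φ (PowerSeries.coeff j g)) (h0 : ∀ n : ℤ, ε * n < 0 → A n = 0) : A = emb φ ε g := by
  ext1 n
  rcases exists_eq_unit_mul ε n with ⟨j, rfl⟩ | hn
  · rw [h, emb_natCast]
  · rw [h0 n hn, emb_of_neg φ ε g hn]

variable {φ}

theorem hasOpSum_sum {ι : Type*} {f : ι → Module.End ℂ⟦X⟧ M} (F : Finset ι)
    (h : ∀ i ∉ F, f i = 0) : HasOpSum f (∑ i ∈ F, f i) := fun m => by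
  rw [LinearMap.sum_apply]
  exact hasHSum_sum fun i hi => by rw [h i hi, LinearMap.zero_apply]

theorem hasOpSum_emb_mul (ε : ℤˣ) (g h : S⟦X⟧) (n : ℤ) :
    HasOpSum (fun i => emb φ ε g i * emb φ ε h (n - i)) (emb φ ε (g * h) n) := by
  have hinj : Function.Injective fun j : ℕ => (ε : ℤ) * j := fun i j hij => by
    simpa using hij
  rcases exists_eq_unit_mul ε n with ⟨N, rfl⟩ | hn
  · have := hasOpSum_sum (f := fun i => emb φ ε g i * emb φ ε h (ε * N - i))
      ((Finset.range (N + 1)).map ⟨_, hinj⟩) (by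
        intro i hi
        rcases exists_eq_unit_mul ε i with ⟨j, rfl⟩ | hj
        · rw [emb_of_neg φ ε h, mul_zero]
          rw [mul_sub, unit_mul_unit_mul, unit_mul_unit_mul]
          by_contra hc
          exact hi (Finset.mem_map.2 ⟨j, Finset.mem_range.2 (by omega), rfl⟩)
        · rw [emb_of_neg φ ε g hj, zero_mul])
    convert this using 1
    rw [Finset.sum_map, emb_natCast, PowerSeries.coeff_mul, map_sum,
      Finset.Nat.sum_antidiagonal_eq_sum_range_succ_mk]
    refine Finset.sum_congr rfl fun j hj => ?_
    have hj : j ≤ N := by simpa [Nat.lt_succ_iff] using hj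
    simp only [Function.Embedding.coeFn_mk]
    rw [emb_natCast, ← mul_sub, ← Nat.cast_sub hj, emb_natCast, map_mul]
  · rw [emb_of_neg φ ε _ hn]
    have := hasOpSum_sum (f := fun i => emb φ ε g i * emb φ ε h (n - i)) ∅ (by
      intro i _
      rcases lt_or_ge ((ε : ℤ) * i) 0 with hi | hi
      · rw [emb_of_neg φ ε g hi, zero_mul]
      · rw [emb_of_neg φ ε h (by rw [mul_sub]; omega), mul_zero])
    simpa using this

theorem mulConv_emb (ε : ℤˣ) (g h : S⟦X⟧) : MulConv (emb φ ε g) (emb φ ε h) := fun n =>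
  (hasOpSum_emb_mul ε g h n).opSummable

theorem emb_mul (hM : TopFree M) (ε : ℤˣ) (g h : S⟦X⟧) :
    emb φ ε g ⊛ emb φ ε h = emb φ ε (g * h) :=
  funext fun n => (hasOpSum_emb_mul ε g h n).opSum_eq hM

variable (φ) in
theorem emb_one (ε : ℤˣ) : fone = emb φ ε (1 : S⟦X⟧) := by
  refine emb_ext φ (fun j => ?_) fun n hn => ?_
  · rw [PowerSeries.coeff_one, fone]
    rcases Nat.eq_zero_or_pos j with rfl | hj
    · simp
    · rw [if_neg (by simp; omega), if_neg (by omega), map_zero]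
  · rw [fone, if_neg]
    rintro rfl
    simp at hn

theorem fpow_emb (hM : TopFree M) (ε : ℤˣ) (g : S⟦X⟧) (k : ℕ) :
    fpow (emb φ ε g) k = emb φ ε (g ^ k) := by
  induction k with
  | zero => rw [fpow, pow_zero, emb_one φ ε]
  | succ k ih => rw [fpow, ih, emb_mul hM, pow_succ']

theorem map_mul_natCast (s : S) (n : ℕ) : φ (s * n) = n • φ s := by
  rw [mul_comm, ← nsmul_eq_mul, map_nsmul]

theorem emb_smul (ε : ℤˣ) (c : ℂ⟦X⟧) (g : S⟦X⟧) (n : ℤ) :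
    emb φ ε (c • g) n = c • emb φ ε g n := by
  unfold emb
  split_ifs
  · rw [PowerSeries.coeff_smul, map_smul]
  · rw [smul_zero]

theorem HasSerSum.hasOpSum_emb {u : ℕ → S⟦X⟧} {s : S⟦X⟧} (h : HasSerSum φ u s) (ε : ℤˣ) (n : ℤ) :
    HasOpSum (fun k => emb φ ε (u k) n) (emb φ ε s n) := by
  unfold emb
  split_ifs
  · exact h.hasOpSum_coeff _
  · exact fun m => by simpa using hasHSum_zero

theorem hasOpSum_fexp_emb (hM : TopFree M) {f e : S⟦X⟧} (he : HasSerSum φ (expTerm f) e)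
    (ε : ℤˣ) (n : ℤ) : HasOpSum (fun k : ℕ => (PowerSeries.C (1 / (k.factorial : ℂ)) : ℂ⟦X⟧) •
      fpow (emb φ ε f) k n) (emb φ ε e n) := by
  have := he.hasOpSum_emb ε n
  simpa only [expTerm, emb_smul, ← fpow_emb hM] using this

theorem expConv_emb (hM : TopFree M) {f e : S⟦X⟧} (he : HasSerSum φ (expTerm f) e)
    (ε : ℤˣ) : ExpConv (emb φ ε f) :=
  ⟨fun k => by rw [fpow_emb hM]; exact mulConv_emb ε _ _,
    fun n => (hasOpSum_fexp_emb hM he ε n).opSummable⟩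

theorem fexp_emb (hM : TopFree M) {f e : S⟦X⟧} (he : HasSerSum φ (expTerm f) e)
    (ε : ℤˣ) : fexp (emb φ ε f) = emb φ ε e :=
  funext fun n => (hasOpSum_fexp_emb hM he ε n).opSum_eq hM

/-! ### The derivations `d/dy` and `d/dx = -y² d/dy` for `y = x⁻¹` -/

variable (S) in
/-- The derivation `d/dx` in terms of `y = x ^ ε`. -/
def embDer (ε : ℤˣ) : Derivation ℂ⟦X⟧ S⟦X⟧ S⟦X⟧ :=
  if ε = 1 then (PowerSeries.derivative S).restrictScalars ℂ⟦X⟧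
  else (-PowerSeries.X ^ 2 : S⟦X⟧) • (PowerSeries.derivative S).restrictScalars ℂ⟦X⟧

theorem coeff_embDer_one (g : S⟦X⟧) (n : ℕ) :
    PowerSeries.coeff n (embDer S 1 g) = PowerSeries.coeff (n + 1) g * (n + 1) := by
  simp [embDer, PowerSeries.coeff_derivative]

theorem coeff_zero_embDer_neg_one (g : S⟦X⟧) :
    PowerSeries.coeff 0 (embDer S (-1) g) = 0 := by
  simp [embDer]

theorem coeff_succ_embDer_neg_one (g : S⟦X⟧) (n : ℕ) :
    PowerSeries.coeff (n + 1) (embDer S (-1) g) = -(PowerSeries.coeff n g * n) := by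
  have h : (-1 : ℤˣ) ≠ 1 := by decide
  rw [embDer, if_neg h]
  simp only [Derivation.smul_apply, smul_eq_mul, neg_mul, map_neg]
  congr 1
  rw [pow_two, mul_assoc, PowerSeries.coeff_succ_X_mul]
  cases n with
  | zero => simp
  | succ n =>
    rw [PowerSeries.coeff_succ_X_mul]
    simp [PowerSeries.coeff_derivative]

/-- Differentiation in `x` costs at most one step of the filtration (when `y = x`), and the factor
`z`, divisible by `ħ`, restores it. -/
theorem smul_embDer_mem {z : ℂ⟦X⟧} (hz : PowerSeries.constantCoeff z = 0) (ε : ℤˣ) (N : ℕ)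
    (g : S⟦X⟧) (hg : g ∈ serFil φ N) : z • embDer S ε g ∈ serFil φ N := by
  intro n
  have hX : (PowerSeries.X : ℂ⟦X⟧) ^ 1 ∣ z := by simpa using X_dvd_of_constantCoeff hz
  rw [PowerSeries.coeff_smul]
  rcases Int.units_eq_one_or ε with rfl | rfl
  · rw [coeff_embDer_one]
    exact opFil_antitone (by omega) (smul_mem_opFil hX (Ideal.mul_mem_right _ _ (hg (n + 1))))
  · cases n with
    | zero =>
      rw [coeff_zero_embDer_neg_one, smul_zero]
      exact zero_mem _
    | succ n =>
      rw [coeff_succ_embDer_neg_one]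
      exact opFil_antitone (by omega)
        (smul_mem_opFil hX (neg_mem (Ideal.mul_mem_right _ _ (hg n))))

theorem dx_emb (ε : ℤˣ) (g : S⟦X⟧) : dx (emb φ ε g) = emb φ ε (embDer S ε g) := by
  refine emb_ext φ (fun j => ?_) fun n hn => ?_
  · rcases Int.units_eq_one_or ε with rfl | rfl
    · have := emb_natCast φ 1 g (j + 1)
      simp only [Units.val_one, one_mul, Nat.cast_add, Nat.cast_one] at this
      rw [coeff_embDer_one, dx, Units.val_one, one_mul, this, ← Nat.cast_succ, natCast_zsmul,
        ← Nat.cast_succ, map_mul_natCast]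
    · cases j with
      | zero =>
        rw [coeff_zero_embDer_neg_one, map_zero, dx, emb_of_neg φ _ g (by simp), smul_zero]
      | succ j =>
        have := emb_natCast φ (-1) g j
        rw [dx, show ((-1 : ℤˣ) : ℤ) * ((j + 1 : ℕ) : ℤ) + 1 = ((-1 : ℤˣ) : ℤ) * j by simp,
          this, coeff_succ_embDer_neg_one, map_neg, map_mul_natCast, Units.val_neg, Units.val_one,
          neg_one_mul, neg_smul, natCast_zsmul]
  · rw [dx]
    rcases Int.units_eq_one_or ε with rfl | rfl
    · rw [Units.val_one, one_mul] at hn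
      -- At `n = -1` the constant term would appear, but with factor `n + 1 = 0`.
      rcases eq_or_ne (n + 1) 0 with h | h
      · rw [h, zero_smul]
      · rw [emb_of_neg φ _ g (by rw [Units.val_one]; omega), smul_zero]
    · rw [emb_of_neg φ _ g (by simp at hn ⊢; omega), smul_zero]

theorem dx_iterate_emb (ε : ℤˣ) (g : S⟦X⟧) (k : ℕ) :
    dx^[k] (emb φ ε g) = emb φ ε ((embDer S ε)^[k] g) := by
  induction k with
  | zero => rfl
  | succ k ih => rw [Function.iterate_succ_apply', ih, dx_emb, Function.iterate_succ_apply']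

theorem shift_emb (hM : TopFree M) {z : ℂ⟦X⟧} {ε : ℤˣ} {g h : S⟦X⟧}
    (hh : HasSerSum φ (shiftTerm (embDer S ε) z g) h) :
    shift z (emb φ ε g) = emb φ ε h := by
  refine funext fun n => HasOpSum.opSum_eq hM ?_
  have := hh.hasOpSum_emb ε n
  simpa only [shiftTerm, emb_smul, ← dx_iterate_emb] using this

theorem zL_emb (hM : TopFree M) {z : ℂ⟦X⟧} {ε : ℤˣ} {g h : S⟦X⟧}
    (hh : HasSerSum φ (zLTerm (embDer S ε) z g) h) :
    zL z (emb φ ε g) = emb φ ε h := by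
  refine funext fun n => HasOpSum.opSum_eq hM ?_
  have := hh.hasOpSum_emb ε n
  simpa only [zLTerm, emb_smul, ← dx_iterate_emb] using this

end Embedding

/-! ### Existence of models by double commutants. -/

section Models

universe u

variable {M : Type u} [AddCommGroup M] [Module ℂ⟦X⟧ M]

/-- The double commutant of a set of operators. -/
abbrev bicommutant (A : Set (Module.End ℂ⟦X⟧ M)) : Subalgebra ℂ⟦X⟧ (Module.End ℂ⟦X⟧ M) :=
  Subalgebra.centralizer ℂ⟦X⟧ (Set.centralizer A)

/-- Commuting operators lie in a commutative algebra closed under uniformly convergent series. -/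
theorem exists_closedModel (hM : TopFree M) {A : Set (Module.End ℂ⟦X⟧ M)}
    (hA : ∀ a ∈ A, ∀ b ∈ A, a * b = b * a) :
    ∃ (S : Type u) (_ : CommRing S) (_ : Algebra ℂ⟦X⟧ S) (φ : S →ₐ[ℂ⟦X⟧] Module.End ℂ⟦X⟧ M), IsClosedModel φ ∧
        (∀ a ∈ A, ∃ s, φ s = a) ∧
        ∀ s, ∀ T : Module.End ℂ⟦X⟧ M, (∀ a ∈ A, a * T = T * a) → φ s * T = T * φ s := by
  have hcomm : ∀ s t : bicommutant A, s * t = t * s := fun s t => Subtype.ext <|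
    Set.centralizer_centralizer_comm_of_comm hA s.1 s.2 t.1 t.2
  have hcen : ∀ s : bicommutant A, ∀ T : Module.End ℂ⟦X⟧ M, (∀ a ∈ A, a * T = T * a) →
      s.1 * T = T * s.1 := fun s T hT => (s.2 T hT).symm
  let inst : CommRing (bicommutant A) :=
    { (inferInstance : Ring (bicommutant A)) with mul_comm := hcomm }
  refine ⟨bicommutant A, inst, inferInstance, (bicommutant A).val, ⟨Subtype.val_injective, fun u hu => ?_⟩,
    fun a ha => ⟨⟨a, Set.subset_centralizer_centralizer ha⟩, rfl⟩, hcen⟩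
  obtain ⟨T, hT⟩ := opSummable_of_hNull hM (f := fun k => (u k).1) (fun m r => by
    obtain ⟨K, hK⟩ := hu r
    exact ⟨Finset.range K, fun k hk => hK k (by simpa using hk) m⟩)
  refine ⟨⟨T, fun c hc => LinearMap.ext fun m => ?_⟩, hT⟩
  -- Linear maps are `ħ`-adically continuous, so the limit still commutes with everything its terms
  -- commute with.
  refine ((hT m).map c).unique hM ?_
  have h : (fun k => c ((u k).1 m)) = fun k => (u k).1 (c m) :=
    funext fun k => LinearMap.congr_fun ((u k).2 c hc) m
  rw [h]
  exact hT (c m)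

end Models

/-! ### Convergence and associativity of products of operator series. -/

section Products

variable {M : Type*} [AddCommGroup M] [Module ℂ⟦X⟧ M]

/-- Series in non-positive powers of `x` with pointwise decaying coefficients. -/
structure IsAnnihilating (Q : FSeries M) : Prop where
  eq_zero : ∀ n, 0 < n → Q n = 0
  laurent : ∀ w, IsHLaurent fun n => Q n w

theorem hNull_of_finite {ι : Type*} {f : ι → M} (h : ∀ r, ∃ s : Set ι, s.Finite ∧
    ∀ i ∉ s, f i ∈ hFil M r) : HNull f := fun r => by
  obtain ⟨s, hs, h⟩ := h r
  exact ⟨hs.toFinset, fun i hi => h i (by simpa using hi)⟩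

theorem HNull.congr {ι : Type*} {f g : ι → M} (hf : HNull f) (h : ∀ i, f i = g i) : HNull g :=
  funext h ▸ hf

theorem hasHSum_of_forall_eq_zero {ι : Type*} {f : ι → M} (h : ∀ i, f i = 0) : HasHSum f 0 := by
  rw [show f = fun _ => 0 from funext h]
  exact hasHSum_zero

theorem IsHLaurent.of_exists {ψ : ℤ → M}
    (h : ∀ r, ∃ k : ℕ, ∀ n : ℤ, n ≤ -(k : ℤ) → ψ n ∈ hFil M r) : IsHLaurent ψ := fun r => by
  obtain ⟨k, hk⟩ := h r
  exact ⟨k, fun n hn => hk _ (by omega)⟩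

/-- Modulo `ħ^r`, only `0 ≤ i ≤ n + k` survive: the support of `P` bounds `i` below and the
truncation of `F w` bounds it above. -/
theorem hNull_mul_left {P F : FSeries M} (hP : ∀ n < 0, P n = 0)
    (hF : ∀ w, IsHLaurent fun n => F n w) (n : ℤ) (w : M) :
    HNull fun i => P i (F (n - i) w) := by
  refine hNull_of_finite fun r => ?_
  obtain ⟨k, hk⟩ := (hF w).exists_forall_lt r
  refine ⟨Set.Icc 0 (n + k), Set.finite_Icc _ _, fun i hi => ?_⟩
  rw [Set.mem_Icc, not_and_or, not_le, not_le] at hi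
  rcases hi with hi | hi
  · rw [hP i hi, LinearMap.zero_apply]
    exact zero_mem _
  · exact map_mem_hFil _ (hk _ (by omega))

/-- Both bounds on `i` come from `Q`, so `F` may be arbitrary. -/
theorem hNull_mul_right (F : FSeries M) {Q : FSeries M} (hQ : IsAnnihilating Q) (n : ℤ) (w : M) :
    HNull fun i => F i (Q (n - i) w) := by
  refine hNull_of_finite fun r => ?_
  obtain ⟨k, hk⟩ := (hQ.laurent w).exists_forall_lt r
  refine ⟨Set.Icc n (n + k), Set.finite_Icc _ _, fun i hi => ?_⟩
  rw [Set.mem_Icc, not_and_or, not_le, not_le] at hi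
  rcases hi with hi | hi
  · rw [hQ.eq_zero _ (by omega), LinearMap.zero_apply, map_zero]
    exact zero_mem _
  · exact map_mem_hFil _ (hk _ (by omega))

theorem mulConv_of_hNull (hM : TopFree M) {A B : FSeries M}
    (h : ∀ n w, HNull fun i => A i (B (n - i) w)) : MulConv A B := fun n =>
  opSummable_of_hNull hM fun w => h n w

theorem MulConv.hasHSum {A B : FSeries M} (h : MulConv A B) (n : ℤ) (w : M) :
    HasHSum (fun i => A i (B (n - i) w)) ((A ⊛ B) n w) := (h n).hasOpSum w

theorem fmul_apply_eq (hM : TopFree M) {A B : FSeries M} (h : MulConv A B) {n : ℤ} {w s : M}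
    (hs : HasHSum (fun i => A i (B (n - i) w)) s) : (A ⊛ B) n w = s :=
  (h.hasHSum n w).unique hM hs

/-- Associativity of absolutely convergent triple products. -/
theorem fmul_assoc (hM : TopFree M) {A B C : FSeries M} (hAB : MulConv A B) (hBC : MulConv B C)
    (h : ∀ n w, HNull fun p : ℤ × ℤ => A p.1 (B p.2 (C (n - p.1 - p.2) w))) :
    MulConv (A ⊛ B) C ∧ MulConv A (B ⊛ C) ∧ (A ⊛ B) ⊛ C = A ⊛ (B ⊛ C) := by
  have key : ∀ n w, ∃ s, HasHSum (fun i => A i ((B ⊛ C) (n - i) w)) s ∧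
      HasHSum (fun i => (A ⊛ B) i (C (n - i) w)) s := by
    intro n w
    obtain ⟨s, hs⟩ := (h n w).exists_hasHSum hM
    refine ⟨s, hs.fiberwise fun i => ?_, ?_⟩
    · exact (hBC.hasHSum (n - i) w).map (A i)
    · let e : ℤ × ℤ ≃ ℤ × ℤ :=
        { toFun := fun p => (p.2, p.1 - p.2)
          invFun := fun p => (p.1 + p.2, p.1)
          left_inv := fun p => by simp
          right_inv := fun p => by simp }
      refine (hs.comp_equiv e).fiberwise fun m => ?_
      have := hAB.hasHSum m (C (n - m) w)
      simpa only [e, Equiv.coe_fn_mk, sub_sub, add_sub_cancel] using this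
  choose s hs₁ hs₂ using key
  have h₁ : MulConv (A ⊛ B) C := mulConv_of_hNull hM fun n w => (hs₂ n w).null
  have h₂ : MulConv A (B ⊛ C) := mulConv_of_hNull hM fun n w => (hs₁ n w).null
  refine ⟨h₁, h₂, funext fun n => LinearMap.ext fun w => ?_⟩
  rw [fmul_apply_eq hM h₁ (hs₂ n w), fmul_apply_eq hM h₂ (hs₁ n w)]

theorem MulConv.comm {A B : FSeries M} (h : MulConv A B) (hAB : ∀ i j, A i * B j = B j * A i) :
    MulConv B A := fun n => by
  refine ⟨(A ⊛ B) n, fun w => ?_⟩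
  convert (h.hasHSum n w).comp_equiv (Equiv.subLeft n) using 2 with i
  simp only [Equiv.subLeft_apply, sub_sub_cancel]
  exact LinearMap.congr_fun (hAB _ _).symm w

theorem fmul_comm (hM : TopFree M) {A B : FSeries M} (h : MulConv A B)
    (hAB : ∀ i j, A i * B j = B j * A i) : A ⊛ B = B ⊛ A := by
  ext n w
  refine (fmul_apply_eq hM (h.comm hAB) ?_).symm
  convert (h.hasHSum n w).comp_equiv (Equiv.subLeft n) using 2 with i
  simp only [Equiv.subLeft_apply, sub_sub_cancel]
  exact LinearMap.congr_fun (hAB _ _).symm w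

theorem fmul_assoc_left (hM : TopFree M) {P P' F : FSeries M} (hP : ∀ n < 0, P n = 0)
    (hP' : ∀ n < 0, P' n = 0) (hPP' : MulConv P P') (hF : ∀ w, IsHLaurent fun n => F n w) :
    MulConv P (P' ⊛ F) ∧ (P ⊛ P') ⊛ F = P ⊛ (P' ⊛ F) := by
  refine (fmul_assoc hM hPP' (mulConv_of_hNull hM (hNull_mul_left hP' hF)) fun n w =>
    hNull_of_finite fun r => ?_).2
  obtain ⟨k, hk⟩ := (hF w).exists_forall_lt r
  refine ⟨Set.Icc 0 (n + k) ×ˢ Set.Icc 0 (n + k), (Set.finite_Icc _ _).prod (Set.finite_Icc _ _),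
    fun ⟨i, j⟩ hij => ?_⟩
  by_cases hi : i < 0
  · simp [hP i hi]
  by_cases hj : j < 0
  · simp [hP' j hj]
  refine map_mem_hFil _ (map_mem_hFil _ (hk _ ?_))
  simp only [Set.mem_prod, Set.mem_Icc] at hij ⊢
  omega

theorem fmul_assoc_right (hM : TopFree M) (F : FSeries M) {Q Q' : FSeries M}
    (hQ : IsAnnihilating Q) (hQ' : IsAnnihilating Q') :
    MulConv (F ⊛ Q) Q' ∧ (F ⊛ Q) ⊛ Q' = F ⊛ (Q ⊛ Q') := by
  have := fmul_assoc hM (mulConv_of_hNull hM (hNull_mul_right F hQ))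
    (mulConv_of_hNull hM (hNull_mul_right Q hQ')) (fun n w => by
      -- The first coordinate is the index in `Q'`. Modulo `ħ^r` only finitely many of its values
      -- matter, uniformly in the index of `Q`.
      have h : HNull fun p : ℤ × ℤ => F (n - p.1 - p.2) (Q p.2 (Q' p.1 w)) := by
        refine HNull.prod (fun c => ?_) fun r => ?_
        · exact HNull.congr ((hNull_mul_right F hQ (n - c) (Q' c w)).comp_injective
            (e := Equiv.subLeft (n - c)) (Equiv.injective _)) fun j => by simp
        · obtain ⟨k, hk⟩ := (hQ'.laurent w).exists_forall_lt r
          refine ⟨Finset.Icc (-(k : ℤ)) 0, fun c hc j => map_mem_hFil _ (map_mem_hFil _ ?_)⟩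
          by_cases h0 : 0 < c
          · rw [hQ'.eq_zero c h0, LinearMap.zero_apply]
            exact zero_mem _
          · exact hk c (by simp only [Finset.mem_Icc] at hc; omega)
      let e : ℤ × ℤ ≃ ℤ × ℤ :=
        { toFun := fun p => (n - p.1 - p.2, p.2)
          invFun := fun p => (n - p.1 - p.2, p.2)
          left_inv := fun p => Prod.ext (by simp only; ring) rfl
          right_inv := fun p => Prod.ext (by simp only; ring) rfl }
      refine HNull.congr (h.comp_injective (e := e) e.injective) fun p => ?_
      simp only [e, Equiv.coe_fn_mk]
      rw [show n - (n - p.1 - p.2) - p.2 = p.1 by ring])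
  exact ⟨this.1, this.2.2⟩

theorem fmul_sum_right (hM : TopFree M) {κ : Type*} (F : Finset κ) (c : κ → ℕ) (A : FSeries M)
    {B : κ → FSeries M} (h : ∀ k ∈ F, MulConv A (B k)) :
    A ⊛ (∑ k ∈ F, c k • B k) = ∑ k ∈ F, c k • (A ⊛ B k) := by
  ext n w
  have h2 : HasOpSum (fun i => A i * (∑ k ∈ F, c k • B k) (n - i))
      ((∑ k ∈ F, c k • (A ⊛ B k)) n) := fun w => by
    have h1 := HasHSum.finset_sum F fun k hk => ((h k hk).hasHSum n w).map (c k • LinearMap.id)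
    simpa [Finset.sum_apply, LinearMap.sum_apply] using h1
  rw [fmul, h2.opSum_eq hM]

theorem fmul_sum_left (hM : TopFree M) {κ : Type*} (F : Finset κ) (c : κ → ℕ) (A : FSeries M)
    {B : κ → FSeries M} (h : ∀ k ∈ F, MulConv (B k) A) :
    (∑ k ∈ F, c k • B k) ⊛ A = ∑ k ∈ F, c k • (B k ⊛ A) := by
  ext n w
  have h2 : HasOpSum (fun i => (∑ k ∈ F, c k • B k) i * A (n - i))
      ((∑ k ∈ F, c k • (B k ⊛ A)) n) := fun w => by
    have h1 := HasHSum.finset_sum F fun k hk => ((h k hk).hasHSum n w).map (c k • LinearMap.id)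
    simpa [Finset.sum_apply, LinearMap.sum_apply] using h1
  rw [fmul, h2.opSum_eq hM]

/-! ### Annihilating series -/

theorem isAnnihilating_fone : IsAnnihilating (fone : FSeries M) where
  eq_zero n hn := by rw [fone, if_neg (by omega)]
  laurent w := IsHLaurent.of_exists fun r => ⟨1, fun n hn => by
    rw [fone, if_neg (by omega), LinearMap.zero_apply]
    exact zero_mem _⟩

theorem IsAnnihilating.fmul (hM : TopFree M) {Q Q' : FSeries M} (hQ : IsAnnihilating Q)
    (hQ' : IsAnnihilating Q') : IsAnnihilating (Q ⊛ Q') := by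
  have hconv := mulConv_of_hNull hM (hNull_mul_right Q hQ')
  refine ⟨fun n hn => LinearMap.ext fun w => fmul_apply_eq hM hconv ?_, fun w =>
    IsHLaurent.of_exists fun r => ?_⟩
  · refine hasHSum_of_forall_eq_zero fun i => ?_
    rcases lt_or_ge 0 i with hi | hi
    · rw [hQ.eq_zero i hi, LinearMap.zero_apply]
    · rw [hQ'.eq_zero _ (by omega), LinearMap.zero_apply, map_zero]
  · obtain ⟨k, hk⟩ := (hQ'.laurent w).exists_forall_lt r
    -- Modulo `ħ^r` only the finitely many vectors `Q' (-c) w` with `c < k` remain, so a common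
    -- truncation bound `L` for `Q` exists.
    choose l hl using fun c : ℕ => (hQ.laurent (Q' (-c) w)).exists_forall_lt r
    obtain ⟨L, hL⟩ := ((Finset.range k).image l).bddAbove
    refine ⟨k + L, fun n hn => ?_⟩
    refine (hconv n).hasOpSum.mem_hFil fun i => ?_
    rw [Module.End.mul_apply]
    rcases lt_or_ge 0 (n - i) with h0 | h0
    · rw [hQ'.eq_zero _ h0, LinearMap.zero_apply, map_zero]
      exact zero_mem _
    · obtain ⟨c, hc⟩ : ∃ c : ℕ, n - i = -c := ⟨(i - n).toNat, by omega⟩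
      rcases lt_or_ge c k with hck | hck
      · rw [hc]
        have : l c ≤ L := hL (by
          simp only [Finset.coe_image, Set.mem_image, Finset.mem_coe, Finset.mem_range]
          exact ⟨c, hck, rfl⟩)
        exact hl c i (by omega)
      · exact map_mem_hFil _ (hk _ (by omega))

theorem IsAnnihilating.fpow (hM : TopFree M) {Q : FSeries M} (hQ : IsAnnihilating Q) (k : ℕ) :
    IsAnnihilating (fpow Q k) := by
  induction k with
  | zero => exact isAnnihilating_fone
  | succ k ih => exact hQ.fmul hM ih

theorem fpow_mem_hFil {A : FSeries M} (hA : ExpConv A) (h : ∀ n m, A n m ∈ hFil M 1) (k : ℕ)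
    (n : ℤ) (m : M) : fpow A k n m ∈ hFil M k := by
  induction k generalizing n with
  | zero => exact mem_hFil_zero _
  | succ k ih =>
    refine (hA.1 k n).hasOpSum.mem_hFil fun i => ?_
    rw [Module.End.mul_apply]
    obtain ⟨y, hy⟩ := mem_hFil.1 (ih (n - i))
    rw [← hy, map_smul]
    exact smul_mem_hFil_add (dvd_refl _) (h i y)

theorem IsAnnihilating.fexp (hM : TopFree M) {Q : FSeries M} (hQ : IsAnnihilating Q)
    (hconv : ExpConv Q) (h : ∀ n m, Q n m ∈ hFil M 1) : IsAnnihilating (fexp Q) := by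
  refine ⟨fun n hn => HasOpSum.opSum_eq hM fun m => ?_, fun w => IsHLaurent.of_exists fun r => ?_⟩
  · refine hasHSum_of_forall_eq_zero fun k => ?_
    rw [(hQ.fpow hM k).eq_zero n hn, smul_zero, LinearMap.zero_apply]
  -- Powers with `k ≥ r` are already divisible by `ħ^r`; the remaining ones have a common truncation
  -- bound.
  · choose l hl using fun k => ((hQ.fpow hM k).laurent w).exists_forall_lt r
    obtain ⟨L, hL⟩ := ((Finset.range r).image l).bddAbove
    refine ⟨L, fun n hn => (hconv.2 n).hasOpSum.mem_hFil fun k => ?_⟩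
    rw [LinearMap.smul_apply]
    refine Submodule.smul_mem _ _ ?_
    rcases lt_or_ge k r with hk | hk
    · have : l k ≤ L := hL (by
        simp only [Finset.coe_image, Set.mem_image, Finset.mem_coe, Finset.mem_range]
        exact ⟨k, hk, rfl⟩)
      exact hl k n (by omega)
    · exact hFil_antitone hk (fpow_mem_hFil hconv h k n w)

theorem IsAnnihilating.zL (hM : TopFree M) {Q : FSeries M} (hQ : IsAnnihilating Q) {z : ℂ⟦X⟧}
    (hz : PowerSeries.constantCoeff z = 0) : IsAnnihilating (zL z Q) := by
  refine ⟨fun n hn => LinearMap.ext fun m => ?_, fun w =>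
    IsHLaurent.of_exists fun r => ?_⟩
  · refine (hasOpSum_zL hM hz Q n m).unique hM ?_
    refine hasHSum_of_forall_eq_zero fun k => ?_
    beta_reduce
    rw [hQ.eq_zero _ (by omega), smul_zero, smul_zero, LinearMap.zero_apply]
  · obtain ⟨l, hl⟩ := (hQ.laurent w).exists_forall_lt r
    refine ⟨l + r, fun n hn => (hasOpSum_zL hM hz Q n).mem_hFil fun k => ?_⟩
    rw [LinearMap.smul_apply]
    rcases lt_or_ge k r with hk | hk
    · exact Submodule.smul_mem _ _ (zsmul_mem (hl _ (by omega)) _)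
    · exact smul_mem_hFil ((pow_dvd_pow _ (by omega)).trans (X_pow_dvd_primCoeff hz k)) _

end Products

/-! ### Products of two exponentials as series of divided powers. -/

section Exponential

variable {M : Type*} [AddCommGroup M] [Module ℂ⟦X⟧ M]

theorem pow_apply_mem_hFil {T : Module.End ℂ⟦X⟧ M} (hT : ∀ m, T m ∈ hFil M 1) (k : ℕ) (m : M) :
    (T ^ k) m ∈ hFil M k := by
  induction k generalizing m with
  | zero => exact mem_hFil_zero _
  | succ k ih =>
    rw [pow_succ', Module.End.mul_apply, add_comm]
    obtain ⟨y, hy⟩ := mem_hFil.1 (ih m)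
    rw [← hy, map_smul, add_comm]
    exact smul_mem_hFil_add (dvd_refl _) (hT y)

theorem hNull_of_mem_hFil {f : ℕ → M} (h : ∀ k, f k ∈ hFil M k) : HNull f := fun r =>
  ⟨Finset.range r, fun k hk => hFil_antitone (by simpa using hk) (h k)⟩

theorem opExpConv_of_mem_hFil (hM : TopFree M) {T : Module.End ℂ⟦X⟧ M}
    (hT : ∀ m, T m ∈ hFil M 1) : OpExpConv T :=
  opSummable_of_hNull hM fun m => hNull_of_mem_hFil fun k =>
    Submodule.smul_mem _ _ (pow_apply_mem_hFil hT k m)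

theorem C_inv_factorial_mul_choose {i N : ℕ} (hi : i ≤ N) :
    (PowerSeries.C (1 / (N.factorial : ℂ)) : ℂ⟦X⟧) * (N.choose i : ℂ⟦X⟧) =
      PowerSeries.C (1 / (i.factorial : ℂ)) * PowerSeries.C (1 / ((N - i).factorial : ℂ)) := by
  rw [← map_natCast (PowerSeries.C (R := ℂ)), ← map_mul, ← map_mul]
  congr 1
  have h1 : (N.factorial : ℂ) ≠ 0 := Nat.cast_ne_zero.2 N.factorial_ne_zero
  have h2 : (i.factorial : ℂ) ≠ 0 := Nat.cast_ne_zero.2 i.factorial_ne_zero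
  have h3 : ((N - i).factorial : ℂ) ≠ 0 := Nat.cast_ne_zero.2 (N - i).factorial_ne_zero
  have h4 : ((N.choose i * i.factorial * (N - i).factorial : ℕ) : ℂ) = N.factorial :=
    congrArg _ (Nat.choose_mul_factorial_mul_factorial hi)
  push_cast at h4
  field_simp
  linear_combination h4

/-- The product of `exp P(x)` and `exp Q(x)` as a convergent series of divided powers. -/
theorem hasHSum_fexp_fmul_fexp (hM : TopFree M) {P Q : FSeries M}
    (hP0 : ∀ k, ∀ n < 0, fpow P k n = 0) (hP : ExpConv P) (hQ : ExpConv Q)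
    (hQa : ∀ k, IsAnnihilating (fpow Q k))
    (hP1 : ∀ n m, P n m ∈ hFil M 1) (hQ1 : ∀ n m, Q n m ∈ hFil M 1)
    (hconv : MulConv (fexp P) (fexp Q)) (n : ℤ) (w : M) :
    HasHSum (fun N : ℕ => (PowerSeries.C (1 / (N.factorial : ℂ)) : ℂ⟦X⟧) •
      ∑ i ∈ Finset.range (N + 1), N.choose i • (fpow P i ⊛ fpow Q (N - i)) n w)
      ((fexp P ⊛ fexp Q) n w) := by
  let c : ℕ → ℂ⟦X⟧ := fun k => PowerSeries.C (1 / (k.factorial : ℂ))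
  let g : (ℕ × ℕ) × ℤ → M := fun p =>
    c p.1.1 • fpow P p.1.1 p.2 (c p.1.2 • fpow Q p.1.2 (n - p.2) w)
  have hg : HNull g := by
    refine HNull.prod (fun p => ?_) fun r => ⟨Finset.range r ×ˢ Finset.range r, fun p hp i => ?_⟩
    · have := (hNull_mul_left (hP0 p.1) (hQa p.2).laurent n w).map
        (LinearMap.lsmul ℂ⟦X⟧ M (c p.1 * c p.2))
      refine this.congr fun i => ?_
      simp [g, mul_smul]
    · simp only [Finset.mem_product, Finset.mem_range, not_and_or, not_lt] at hp
      refine Submodule.smul_mem _ _ ?_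
      rcases hp with hp | hp
      · exact hFil_antitone hp (fpow_mem_hFil hP hP1 _ _ _)
      · exact hFil_antitone hp (map_mem_hFil _ (Submodule.smul_mem _ _
          (fpow_mem_hFil hQ hQ1 _ _ _)))
  obtain ⟨s, hs⟩ := hg.exists_hasHSum hM
  -- Summing over both exponents with the power of `x` fixed gives the product of the exponentials;
  -- the opposite order gives products of powers.
  have hcols : ∀ i, HasHSum (fun p => g (p, i)) (fexp P i (fexp Q (n - i) w)) := by
    intro i
    obtain ⟨t, ht⟩ := (hg.comp_injective (e := fun p => (p, i))
      (Prod.mk_left_injective i)).exists_hasHSum hM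
    have h1 : HasHSum (fun k => c k • fpow P k i (fexp Q (n - i) w)) t := by
      refine ht.fiberwise fun k => ?_
      exact (((hQ.2 (n - i)).hasOpSum w).map (fpow P k i)).smul (c k)
    have h2 : fexp P i (fexp Q (n - i) w) = t :=
      ((hP.2 i).hasOpSum (fexp Q (n - i) w)).unique hM h1
    rwa [h2]
  rw [fmul_apply_eq hM hconv (hs.fiberwise_right hcols)]
  let t : ℕ × ℕ → M := fun p => (c p.1 * c p.2) • (fpow P p.1 ⊛ fpow Q p.2) n w
  have hrows : HasHSum t s := by
    refine hs.fiberwise fun p => ?_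
    have := ((mulConv_of_hNull hM (hNull_mul_left (hP0 p.1) (hQa p.2).laurent)).hasHSum n w).smul
      (c p.1 * c p.2)
    simpa only [g, map_smul, smul_smul] using this
  -- The pair `(i, j)` of exponents is regrouped as `(N, i)` with `N = i + j`, extended by zero to
  -- `i > N`.
  let t' : ℕ × ℕ → M := fun p => if p.2 ≤ p.1 then t (p.2, p.1 - p.2) else 0
  have ht' : HasHSum t' s := by
    refine HasHSum.of_injective (e := fun p : ℕ × ℕ => (p.1 + p.2, p.1)) ?_ ?_ ?_
    · rintro ⟨a, b⟩ ⟨a', b'⟩ h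
      simp only [Prod.mk.injEq] at h ⊢
      omega
    · simpa [t'] using hrows
    · rintro ⟨N, i⟩ h
      simp only [t']
      rw [if_neg]
      intro hi
      exact h ⟨(i, N - i), by simp only [Prod.mk.injEq, and_true]; omega⟩
  refine ht'.fiberwise fun N => ?_
  have h1 := hasHSum_sum (f := fun i => t' (N, i)) (F := Finset.range (N + 1)) fun i hi => by
    simp only [t']
    rw [if_neg (by simp only [Finset.mem_range] at hi; omega)]
  convert h1 using 1
  rw [Finset.smul_sum]
  refine Finset.sum_congr rfl fun i hi => ?_
  have hi : i ≤ N := by simpa [Nat.lt_succ_iff] using hi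
  simp only [t', t, if_pos hi]
  rw [← Nat.cast_smul_eq_nsmul ℂ⟦X⟧, smul_smul, C_inv_factorial_mul_choose hi]

end Exponential

/-! ### The normally ordered exponential. -/

section

variable {V W : Type*} [AddCommGroup V] [Module ℂ⟦X⟧ V] [AddCommGroup W] [Module ℂ⟦X⟧ W]
  {𝒱 : NonlocalVA V} {γ : ℤ → ℂ⟦X⟧} {a : V}

theorem opSum_minusTerm_mem_hFil (𝒱 : NonlocalVA V) (a : V) {z : ℂ⟦X⟧}
    (hz : PowerSeries.constantCoeff z = 0) (v : V) :
    opSum (minusTerm (𝒱.Y (-a)) z) v ∈ hFil V 1 :=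
  (hasOpSum_minusTerm 𝒱 a hz).mem_hFil fun k =>
    smul_mem_hFil ((pow_dvd_pow _ (by omega)).trans (X_pow_dvd_primCoeff hz k)) _

theorem isAnnihilating_singPart (𝒲 : VAModule 𝒱 W) (a : V) :
    IsAnnihilating (singPart (𝒲.Y a)) where
  eq_zero n hn := by rw [singPart, if_neg (by omega)]
  laurent w := IsHLaurent.of_exists fun r => by
    obtain ⟨k, hk⟩ := (𝒲.laurent a w).exists_forall_lt r
    refine ⟨k, fun n hn => ?_⟩
    unfold singPart
    split_ifs
    · exact hk n hn
    · exact zero_mem _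

theorem VAModule.Y_primitive_eq (𝒲 : VAModule 𝒱 W) {v : V} (hv : v ∈ 𝒲.commSubmodule a)
    {z : ℂ⟦X⟧} (hz : PowerSeries.constantCoeff z = 0) :
    MulConv (zL z (regPart (𝒲.Y a))) (𝒲.Y v) ∧ MulConv (𝒲.Y v) (zL z (singPart (𝒲.Y a))) ∧
      𝒲.Y (opSum (minusTerm (𝒱.Y (-a)) z) v) =
        zL z (regPart (𝒲.Y a)) ⊛ 𝒲.Y v + 𝒲.Y v ⊛ zL z (singPart (𝒲.Y a)) := by
  choose s t hs ht hst using 𝒲.Y_primitive hv hz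
  have ht' : ∀ n w, HasHSum (fun i => 𝒲.Y v i (zL z (singPart (𝒲.Y a)) (n - i) w)) (t n w) :=
    fun n w => by
      convert (ht n w).comp_equiv (Equiv.subLeft n) using 2 with i
      simp
  have h1 := mulConv_of_hNull 𝒲.topFree fun n w => (hs n w).null
  have h2 := mulConv_of_hNull 𝒲.topFree fun n w => (ht' n w).null
  refine ⟨h1, h2, funext fun n => LinearMap.ext fun w => ?_⟩
  rw [hst, Pi.add_apply, LinearMap.add_apply, fmul_apply_eq 𝒲.topFree h1 (hs n w),
    fmul_apply_eq 𝒲.topFree h2 (ht' n w)]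

/-- `fpow` multiplies on the left, whereas `Q` enters the recursion for `Y_W(T^N 1)` on the right.
-/
theorem fpow_succ_right {M : Type*} [AddCommGroup M] [Module ℂ⟦X⟧ M] (hM : TopFree M)
    {Q : FSeries M} (hQ : IsAnnihilating Q) (k : ℕ) : fpow Q k ⊛ Q = fpow Q (k + 1) := by
  induction k with
  | zero =>
    have h : ∀ i j, (fone : FSeries M) i * Q j = Q j * fone i := fun i j => by
      rw [fone]
      split_ifs <;> simp
    exact fmul_comm hM (mulConv_of_hNull hM (hNull_mul_right fone hQ)) h
  | succ k ih =>
    conv_lhs => rw [fpow]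
    rw [(fmul_assoc_right hM Q (hQ.fpow hM k) hQ).2, ih]
    rfl

/-- `Y_W(T^N 1, x)`, `T = ∫₀^z Y⁺(a, t) dt`, by the binomial theorem for normally ordered
products. -/
theorem VAModule.Y_primitive_pow (𝒲 : VAModule 𝒱 W) (h : HeisenbergRel γ (𝒱.Y a))
    (hW : HeisenbergRel γ (𝒲.Y a)) {z : ℂ⟦X⟧} (hz : PowerSeries.constantCoeff z = 0)
    (hP0 : ∀ k, ∀ n < 0, fpow (zL z (regPart (𝒲.Y a))) k n = 0)
    (hP : ExpConv (zL z (regPart (𝒲.Y a)))) (N : ℕ) :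
    (opSum (minusTerm (𝒱.Y (-a)) z) ^ N) 𝒱.vac ∈ 𝒲.commCore a ∧
      𝒲.Y ((opSum (minusTerm (𝒱.Y (-a)) z) ^ N) 𝒱.vac) = ∑ i ∈ Finset.range (N + 1),
        N.choose i • (fpow (zL z (regPart (𝒲.Y a))) i ⊛ fpow (zL z (singPart (𝒲.Y a))) (N - i)) := by
  have hM := 𝒲.topFree
  set P := zL z (regPart (𝒲.Y a)) with hPdef
  set Q := zL z (singPart (𝒲.Y a)) with hQdef
  have hQa : IsAnnihilating Q := (isAnnihilating_singPart 𝒲 a).zL hM hz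
  -- If `n + k ≥ 0`, the binomial coefficient of `n + k` over `k` vanishes because `n + k < k`;
  -- otherwise the regular part does.
  have hP01 : ∀ n < 0, P n = 0 := fun n hn => by
    rw [hPdef, zL]
    refine HasOpSum.opSum_eq hM fun m => hasHSum_of_forall_eq_zero fun k => ?_
    rw [zL_term]
    rcases lt_or_ge (n + k) 0 with hk | hk
    · rw [regPart, if_neg (by omega), smul_zero, smul_zero, LinearMap.zero_apply]
    · obtain ⟨j, hj⟩ : ∃ j : ℕ, n + k = j := ⟨(n + k).toNat, by omega⟩
      rw [hj, Ring.choose_natCast, Nat.choose_eq_zero_of_lt (by omega), Nat.cast_zero, zero_smul,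
        smul_zero, LinearMap.zero_apply]
  induction N with
  | zero =>
    refine ⟨𝒲.vac_mem_commCore a, ?_⟩
    simp only [pow_zero, Module.End.one_apply, zero_add, Finset.sum_range_one, Nat.choose_self,
      one_smul, Nat.sub_self]
    rw [𝒲.vac_left]
    refine funext fun n => LinearMap.ext fun w => (fmul_apply_eq hM
      (mulConv_of_hNull hM (hNull_mul_right _ isAnnihilating_fone)) ?_).symm
    have := hasHSum_single (f := fun i : ℤ => (fone : FSeries W) i ((fone : FSeries W) (n - i) w)) n
      (fun j hj => by rw [fone, fone, if_neg (show ¬ n - j = 0 by omega), LinearMap.zero_apply,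
        map_zero])
    simpa [fone, fpow] using this
  | succ N ih =>
    obtain ⟨hmem, hY⟩ := ih
    rw [pow_succ', Module.End.mul_apply]
    refine ⟨𝒲.primitive_mem_commCore h hW hmem hz, ?_⟩
    have hassocL : ∀ j i, MulConv P (fpow P j ⊛ fpow Q i) ∧
        fpow P (j + 1) ⊛ fpow Q i = P ⊛ (fpow P j ⊛ fpow Q i) := fun j i =>
      fmul_assoc_left hM hP01 (hP0 j) (hP.1 j) (hQa.fpow hM i).laurent
    have hassocR : ∀ j i, MulConv (fpow P j ⊛ fpow Q i) Q ∧
        (fpow P j ⊛ fpow Q i) ⊛ Q = fpow P j ⊛ fpow Q (i + 1) := fun j i => by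
      have := fmul_assoc_right hM (fpow P j) (hQa.fpow hM i) hQa
      rwa [fpow_succ_right hM hQa] at this
    rw [(𝒲.Y_primitive_eq (𝒲.commCore_subset hmem) hz).2.2, hY,
      fmul_sum_right hM _ _ _ fun i _ => (hassocL _ _).1,
      fmul_sum_left hM _ _ _ fun i _ => (hassocR _ _).1,
      Finset.sum_choose_succ_nsmul (fun i j => fpow P i ⊛ fpow Q j) N, add_comm]
    congr 1
    · refine Finset.sum_congr rfl fun i hi => ?_
      have hi : i ≤ N := by simpa [Nat.lt_succ_iff] using hi
      rw [(hassocR _ _).2, show N - i + 1 = N + 1 - i by omega]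
    · exact Finset.sum_congr rfl fun i _ => by rw [(hassocL _ _).2]

/-- `Y_W(E⁻(-a, z)1, x)` as a normally ordered exponential. -/
theorem VAModule.Y_EMinusAt (𝒲 : VAModule 𝒱 W) (h : HeisenbergRel γ (𝒱.Y a))
    (hW : HeisenbergRel γ (𝒲.Y a)) {z : ℂ⟦X⟧} (hz : PowerSeries.constantCoeff z = 0)
    (hP0 : ∀ k, ∀ n < 0, fpow (zL z (regPart (𝒲.Y a))) k n = 0)
    (hP : ExpConv (zL z (regPart (𝒲.Y a)))) (hQ : ExpConv (zL z (singPart (𝒲.Y a))))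
    (hconv : MulConv (fexp (zL z (regPart (𝒲.Y a)))) (fexp (zL z (singPart (𝒲.Y a))))) :
    𝒲.Y (EMinusAt (𝒱.Y (-a)) z 𝒱.vac) =
      fexp (zL z (regPart (𝒲.Y a))) ⊛ fexp (zL z (singPart (𝒲.Y a))) := by
  have hM := 𝒲.topFree
  ext n w
  have h1 := hasHSum_fexp_fmul_fexp hM hP0 hP hQ
    (((isAnnihilating_singPart 𝒲 a).zL hM hz).fpow hM) (zL_mem_hFil hM hz _) (zL_mem_hFil hM hz _)
    hconv n w
  -- A fixed coefficient of `Y_W(·, x)w` is linear in the vector, so it can be applied term by term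
  -- to `exp T · 1`.
  have h2 := ((opExpConv_of_mem_hFil 𝒱.topFree
    (opSum_minusTerm_mem_hFil 𝒱 a hz)).hasOpSum 𝒱.vac).map (𝒲.modeMap n w)
  refine HasHSum.unique hM h2 ?_
  convert h1 using 2 with N
  rw [LinearMap.smul_apply, map_smul, modeMap_apply,
    (𝒲.Y_primitive_pow h hW hz hP0 hP N).2, Finset.sum_apply, LinearMap.sum_apply]
  rfl

end

/-! ### Factoring exponentials of `zL(z∂)` and the factor `(1 + z/x)^T`. -/

section Factorization

variable {M : Type*} [AddCommGroup M] [Module ℂ⟦X⟧ M] {S : Type*} [CommRing S] [Algebra ℂ⟦X⟧ S]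
  {φ : S →ₐ[ℂ⟦X⟧] Module.End ℂ⟦X⟧ M}

/-- `e^{F(x+z)} e^{-F(x)} = exp(z L(z∂ₓ) F'(x))` for a power series `F` in `x` or in `x⁻¹` with
commuting coefficients. -/
theorem IsClosedModel.shift_fexp_fmul_fexp (hφ : IsClosedModel φ) (hM : TopFree M) {z : ℂ⟦X⟧}
    (hz : PowerSeries.constantCoeff z = 0) (ε : ℤˣ) {f : S⟦X⟧} (hf : f ∈ serFil φ 1)
    {F F' G : FSeries M} (hF : F = emb φ ε f) (hF' : F' = emb φ ε (-f))
    (hG : G = emb φ ε (embDer S ε f)) :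
    ExpConv F ∧ ExpConv F' ∧ MulConv (shift z (fexp F)) (fexp F') ∧
      ∃ b c, b ∈ serFil φ 1 ∧ HasSerSum φ (zLTerm (embDer S ε) z (embDer S ε f)) b ∧
        HasSerSum φ (expTerm b) c ∧ zL z G = emb φ ε b ∧
        shift z (fexp F) ⊛ fexp F' = emb φ ε c := by
  obtain ⟨e, he⟩ := hφ.exists_exp hf
  obtain ⟨e', he'⟩ := hφ.exists_exp (neg_mem hf)
  obtain ⟨h, hh⟩ := hφ.exists_shift (embDer S ε) hz e
  obtain ⟨b, hb⟩ := hφ.exists_zL (embDer S ε) hz (embDer S ε f)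
  obtain ⟨c, hc⟩ := hφ.exists_exp (hb.zL_mem _ hz)
  subst hF hF' hG
  rw [fexp_emb hM he, fexp_emb hM he', shift_emb hM hh]
  refine ⟨expConv_emb hM he ε, expConv_emb hM he' ε, mulConv_emb ε _ _, b, c, hb.zL_mem _ hz, hb,
    hc, zL_emb hM hb, ?_⟩
  rw [emb_mul hM, hφ.shift_exp_mul_exp_neg _ hM hz (smul_embDer_mem hz ε) hf he he' hh hb hc]

/-- The power series `∑ (c / n) α_n t^n`, whose constant coefficient is zero. -/
def primitive (c : ℂ) (α : ℕ → S) : S⟦X⟧ :=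
  PowerSeries.mk fun n => (PowerSeries.C (c / (n : ℂ)) : ℂ⟦X⟧) • α n

theorem coeff_primitive (c : ℂ) (α : ℕ → S) (n : ℕ) : PowerSeries.coeff n (primitive c α) =
    (PowerSeries.C (c / (n : ℂ)) : ℂ⟦X⟧) • α n := by simp [primitive]

theorem primitive_mem (c : ℂ) (α : ℕ → S) : primitive c α ∈ serFil φ 1 := by
  intro n
  rw [coeff_primitive]
  cases n with
  -- Division by zero gives `c / 0 = 0`, so the constant coefficient vanishes whatever `α 0` is.
  | zero =>
    simp
  | succ n => exact opFil_antitone (by omega) (mem_opFil_zero _)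

theorem primitive_neg (c : ℂ) (α : ℕ → S) : -primitive c α = primitive (-c) α := by
  ext n
  rw [map_neg, coeff_primitive, coeff_primitive, neg_div, map_neg, neg_smul]

theorem C_div_smul_mul (c : ℂ) (s : S) {n : ℕ} (hn : n ≠ 0) :
    ((PowerSeries.C (c / (n : ℂ)) : ℂ⟦X⟧) • s) * n = (PowerSeries.C c : ℂ⟦X⟧) • s := by
  have h : (n : ℂ) ≠ 0 := Nat.cast_ne_zero.2 hn
  rw [mul_comm, ← nsmul_eq_mul, ← Nat.cast_smul_eq_nsmul ℂ⟦X⟧, smul_smul,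
    ← map_natCast (PowerSeries.C (R := ℂ)), ← map_mul, mul_div_cancel₀ _ h]

/-- The terms of `z L(z∂ₓ) (s x⁻¹)`. -/
theorem zLTerm_pole (z : ℂ⟦X⟧) (s : S) (k : ℕ) :
    zLTerm (embDer S (-1)) z (PowerSeries.monomial 1 s) k = PowerSeries.monomial (k + 1)
      ((PowerSeries.C ((-1) ^ k / ((k : ℂ) + 1)) * z ^ (k + 1) : ℂ⟦X⟧) • s) := by
  have h : (embDer S (-1))^[k] (PowerSeries.monomial 1 s) =
      PowerSeries.monomial (k + 1) ((PowerSeries.C ((-1) ^ k * k.factorial) : ℂ⟦X⟧) • s) := by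
    induction k with
    | zero => simp
    | succ k ih =>
      rw [Function.iterate_succ_apply', ih]
      ext n
      cases n with
      | zero =>
        rw [coeff_zero_embDer_neg_one, PowerSeries.coeff_monomial, if_neg (by omega)]
      | succ n =>
        rw [coeff_succ_embDer_neg_one, PowerSeries.coeff_monomial, PowerSeries.coeff_monomial]
        by_cases hn : n = k + 1
        · subst hn
          rw [if_pos rfl, if_pos rfl, mul_comm, ← nsmul_eq_mul, ← Nat.cast_smul_eq_nsmul ℂ⟦X⟧,
            smul_smul, ← neg_smul, ← map_natCast (PowerSeries.C (R := ℂ)), ← map_mul, ← map_neg]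
          congr 2
          rw [Nat.factorial_succ]
          push_cast
          ring
        · rw [if_neg hn, if_neg (by omega), zero_mul, neg_zero]
  rw [zLTerm, h, ← LinearMap.map_smul_of_tower, smul_smul]
  congr 2
  rw [mul_right_comm, ← map_mul]
  congr 2
  have h2 : (k.factorial : ℂ) ≠ 0 := Nat.cast_ne_zero.2 k.factorial_ne_zero
  have h1 : ((k : ℂ) + 1) ≠ 0 := Nat.cast_add_one_ne_zero k
  rw [Nat.factorial_succ]
  push_cast
  field_simp

/-- The power series in `x⁻¹` representing `s log(1 + z/x)`. -/
def logSeries (z : ℂ⟦X⟧) (s : S) : S⟦X⟧ :=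
  PowerSeries.mk fun n =>
    (PowerSeries.C ((-1 : ℂ) ^ (n + 1) / (n : ℂ)) * z ^ n : ℂ⟦X⟧) • s

/-- `zL(z∂)x⁻¹` is `log(1 + z/x)`; its `k`-th term only contributes to `x^(-k-1)`. -/
theorem hasSerSum_logSeries (z : ℂ⟦X⟧) (s : S) : HasSerSum φ
    (zLTerm (embDer S (-1)) z (PowerSeries.monomial 1 s)) (logSeries z s) := by
  intro N
  refine ⟨N, fun k hk n => ?_⟩
  simp only [zLTerm_pole, map_sub, map_sum, PowerSeries.coeff_monomial]
  rcases lt_or_ge N n with hn | hn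
  · rw [show N - n = 0 by omega]
    exact mem_opFil_zero _
  · cases n with
    | zero =>
      simp [logSeries]
    | succ n =>
      rw [Finset.sum_eq_single_of_mem n (by simp; omega) fun j _ hj => if_neg (by omega),
        if_pos rfl, logSeries, PowerSeries.coeff_mk, pow_succ, pow_succ]
      simp

theorem logTerm_eq_emb (z : ℂ⟦X⟧) (s : S) : logTerm z (φ s) = emb φ (-1) (logSeries z s) := by
  refine emb_ext φ (fun j => ?_) fun n hn => ?_
  · rw [logSeries, PowerSeries.coeff_mk, map_smul, logTerm]
    rcases Nat.eq_zero_or_pos j with rfl | hj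
    · simp
    · rw [if_pos (by simp; omega)]
      simp
  · rw [logTerm, if_neg]
    simp at hn
    omega

theorem logSeries_mem {z : ℂ⟦X⟧} (s : S) : logSeries z s ∈ serFil φ 1 := by
  intro n
  cases n with
  | zero =>
    simp [logSeries]
  | succ n => exact opFil_antitone (by omega) (mem_opFil_zero _)

variable (φ) in
/-- The series whose `n`-th coefficient is divisible by `ħ^n`. -/
def IsGraded (g : S⟦X⟧) : Prop := ∀ n, PowerSeries.coeff n g ∈ opFil φ n

theorem IsGraded.mul {g h : S⟦X⟧} (hg : IsGraded φ g) (hh : IsGraded φ h) :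
    IsGraded φ (g * h) := fun n => by
  rw [PowerSeries.coeff_mul]
  refine Ideal.sum_mem _ fun p hp => ?_
  have := Finset.HasAntidiagonal.mem_antidiagonal.1 hp
  exact opFil_antitone (by omega) (mul_mem_opFil (hg p.1) (hh p.2))

theorem IsGraded.pow {g : S⟦X⟧} (hg : IsGraded φ g) (k : ℕ) : IsGraded φ (g ^ k) := by
  induction k with
  | zero =>
    intro n
    rw [pow_zero, PowerSeries.coeff_one]
    split_ifs with h
    · rw [h]
      exact mem_opFil_zero _
    · exact zero_mem _
  | succ k ih =>
    rw [pow_succ]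
    exact ih.mul hg

theorem IsGraded.exp {g e : S⟦X⟧} (hg : IsGraded φ g) (he : HasSerSum φ (expTerm g) e) :
    IsGraded φ e := fun n m =>
  (he.hasOpSum_coeff n).mem_hFil fun k => by
    rw [expTerm, PowerSeries.coeff_smul, map_smul, LinearMap.smul_apply]
    exact Submodule.smul_mem _ _ (hg.pow k n m)

theorem isGraded_logSeries {z : ℂ⟦X⟧} (hz : PowerSeries.constantCoeff z = 0) (s : S) :
    IsGraded φ (logSeries z s) := fun n => by
  rw [logSeries, PowerSeries.coeff_mk]
  have := smul_mem_opFil (X_pow_dvd_mul_pow hz (PowerSeries.C ((-1 : ℂ) ^ (n + 1) / n)) n)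
    (mem_opFil_zero (φ := φ) s)
  rwa [add_zero] at this

/-- Convergence of `(1 + z/x)^T` and properties of its coefficients. -/
theorem onePlusPow_spec (hM : TopFree M) {z : ℂ⟦X⟧}
    (hz : PowerSeries.constantCoeff z = 0) (T : Module.End ℂ⟦X⟧ M) :
    ExpConv (logTerm z T) ∧ (∀ n > 0, onePlusPow z T n = 0) ∧
      (∀ (j : ℕ) m, onePlusPow z T (-j) m ∈ hFil M j) ∧
      ∀ U, T * U = U * T → ∀ n, onePlusPow z T n * U = U * onePlusPow z T n := by
  -- The model generated by `T` alone also shows that the coefficients commute with everything that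
  -- `T` commutes with.
  obtain ⟨S, _, _, φ, hφ, hgen, hcomm⟩ := exists_closedModel hM (A := {T}) (by simp)
  obtain ⟨s, hs⟩ := hgen T rfl
  obtain ⟨e, he⟩ := hφ.exists_exp (logSeries_mem (φ := φ) (z := z) s)
  have h1 : onePlusPow z T = emb φ (-1) e := by
    rw [onePlusPow, ← hs, logTerm_eq_emb, fexp_emb hM he]
  refine ⟨?_, fun n hn => ?_, fun j m => ?_, fun U hU n => ?_⟩
  · rw [← hs, logTerm_eq_emb]
    exact expConv_emb hM he _
  · rw [h1, emb_of_neg]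
    simpa using hn
  · have := emb_natCast φ (-1) e j
    rw [Units.val_neg, Units.val_one, neg_one_mul] at this
    rw [h1, this]
    exact (isGraded_logSeries hz s).exp he j m
  · rw [h1, emb]
    split_ifs
    · exact hcomm _ U (by simpa using hU)
    · simp

theorem hNull_onePlusPow (hM : TopFree M) {z : ℂ⟦X⟧}
    (hz : PowerSeries.constantCoeff z = 0) (T : Module.End ℂ⟦X⟧ M) (r : ℕ) :
    ∃ F : Finset ℤ, ∀ i ∉ F, ∀ m, onePlusPow z T i m ∈ hFil M r := by
  obtain ⟨-, h0, h1, -⟩ := onePlusPow_spec hM hz T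
  refine ⟨Finset.Icc (-(r : ℤ)) 0, fun i hi m => ?_⟩
  rw [Finset.mem_Icc, not_and_or, not_le, not_le] at hi
  rcases hi with hi | hi
  · have := h1 (-i).toNat m
    rw [show -(((-i).toNat : ℕ) : ℤ) = i by omega] at this
    exact hFil_antitone (by omega) this
  · rw [h0 i hi, LinearMap.zero_apply]
    exact zero_mem _

/-- Multiplication by `(1 + z/x)^T` commutes with the creation factors if `T` does. -/
theorem onePlusPow_fmul (hM : TopFree M) {z : ℂ⟦X⟧}
    (hz : PowerSeries.constantCoeff z = 0) (T : Module.End ℂ⟦X⟧ M) {P Q : FSeries M}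
    (hP : ∀ n < 0, P n = 0) (hQ : IsAnnihilating Q) :
    MulConv (onePlusPow z T) (P ⊛ Q) ∧ ((∀ n, T * P n = P n * T) →
      P ⊛ (onePlusPow z T ⊛ Q) = onePlusPow z T ⊛ (P ⊛ Q)) := by
  obtain ⟨-, h0, h1, hc⟩ := onePlusPow_spec hM hz T
  have hsmall := hNull_onePlusPow hM hz T
  set L := onePlusPow z T
  -- The coefficient of `x^(-j)` in `L` is divisible by `ħ^j` uniformly in the vector, so `L` can be
  -- multiplied with any series.
  have hL : ∀ B : FSeries M, MulConv L B := fun B => mulConv_of_hNull hM fun n w r => by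
    obtain ⟨F, hF⟩ := hsmall r
    exact ⟨F, fun i hi => hF i hi _⟩
  have hPQ := mulConv_of_hNull hM (hNull_mul_left hP hQ.laurent)
  refine ⟨hL _, fun hT => ?_⟩
  have hcomm : ∀ i j, L i * P j = P j * L i := fun i j => hc (P j) (hT j) i
  have hLP := fmul_assoc hM (hL P) hPQ fun n w => by
    refine HNull.prod (fun i => ?_) fun r => ?_
    · exact (hNull_mul_left hP hQ.laurent (n - i) w).map (L i)
    · obtain ⟨F, hF⟩ := hsmall r
      exact ⟨F, fun i hi _ => hF i hi _⟩
  have hPL := fmul_assoc hM ((hL P).comm hcomm) (hL Q) fun n w => by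
    refine HNull.prod_right (fun j => ?_) fun r => ?_
    · refine ((hNull_mul_left hP hQ.laurent (n - j) w).map (L j)).congr fun i => ?_
      rw [show n - i - j = n - j - i by ring]
      exact LinearMap.congr_fun (hcomm j i) _
    · obtain ⟨F, hF⟩ := hsmall r
      exact ⟨F, fun i hi _ => map_mem_hFil _ (hF i hi _)⟩
  rw [← hPL.2.2, ← fmul_comm hM (hL P) hcomm, hLP.2.2]

end Factorization

/-! ### Regular, singular and logarithmic parts as power series. -/

section Modes

variable {M : Type*} [AddCommGroup M] [Module ℂ⟦X⟧ M] {S : Type*} [CommRing S] [Algebra ℂ⟦X⟧ S]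
  {φ : S →ₐ[ℂ⟦X⟧] Module.End ℂ⟦X⟧ M}

theorem minusLog_eq_emb {F : FSeries M} {α : ℕ → S} (hα : ∀ n : ℕ, φ (α (n + 1)) = F n) :
    minusLog F = emb φ 1 (primitive (-1) α) := by
  refine emb_ext φ (fun j => ?_) fun n hn => ?_
  · rw [coeff_primitive, map_smul, minusLog, Units.val_one, one_mul]
    cases j with
    | zero => simp
    | succ j =>
      rw [if_pos (by omega), hα, mode, show -(-((j + 1 : ℕ) : ℤ)) - 1 = j by push_cast; ring]
      congr 2
      push_cast
      rw [div_neg, neg_div]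
  · rw [minusLog, if_neg]
    simp at hn
    omega

theorem plusLog_eq_emb {F : FSeries M} {β : ℕ → S} (hβ : ∀ n : ℕ, φ (β n) = F (-n - 1)) :
    plusLog F = emb φ (-1) (primitive 1 β) := by
  refine emb_ext φ (fun j => ?_) fun n hn => ?_
  · rw [coeff_primitive, map_smul, plusLog]
    cases j with
    | zero => simp
    | succ j =>
      rw [if_pos (by simp; omega), hβ, mode, Units.val_neg, Units.val_one, neg_one_mul, neg_neg]
      simp
  · rw [plusLog, if_neg]
    simp at hn
    omega

theorem regPart_eq_emb {F : FSeries M} {α : ℕ → S} (hα : ∀ n : ℕ, φ (α (n + 1)) = F n) :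
    regPart F = emb φ 1 (embDer S 1 (primitive 1 α)) := by
  refine emb_ext φ (fun j => ?_) fun n hn => ?_
  · rw [coeff_embDer_one, coeff_primitive, ← Nat.cast_succ, C_div_smul_mul _ _ (Nat.succ_ne_zero j),
      map_one, one_smul, hα, regPart, Units.val_one, one_mul, if_pos (by omega)]
  · rw [regPart, if_neg]
    simp at hn
    omega

/-- For `n ≥ 1`, `β_n x^(-n-1)` is the derivative of `-β_n x^(-n)/n`, hence the constant `-1`; only
the residue `β_0 x⁻¹` has no antiderivative. -/
theorem singPart_eq_emb {F : FSeries M} {β : ℕ → S} (hβ : ∀ n : ℕ, φ (β n) = F (-n - 1)) :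
    singPart F = emb φ (-1)
      (embDer S (-1) (primitive (-1) β) + PowerSeries.monomial 1 (β 0)) := by
  refine emb_ext φ (fun j => ?_) fun n hn => ?_
  · rw [map_add, PowerSeries.coeff_monomial, singPart]
    cases j with
    | zero => simp [coeff_zero_embDer_neg_one]
    | succ j =>
      rw [if_pos (by simp; omega), coeff_succ_embDer_neg_one, coeff_primitive]
      rw [show ((-1 : ℤˣ) : ℤ) * ((j + 1 : ℕ) : ℤ) = -j - 1 by simp; ring, ← hβ]
      cases j with
      | zero => simp
      | succ j =>
        rw [C_div_smul_mul _ _ (Nat.succ_ne_zero j), if_neg (by omega), add_zero]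
        simp
  · rw [singPart, if_neg]
    simp at hn
    omega

theorem singPart_tail_eq_emb {F : FSeries M} {β : ℕ → S} (hβ : ∀ n : ℕ, φ (β n) = F (-n - 1)) :
    (fun n => if n < -1 then F n else 0) =
      emb φ (-1) (embDer S (-1) (primitive (-1) β)) := by
  refine emb_ext φ (fun j => ?_) fun n hn => ?_
  · cases j with
    | zero => simp [coeff_zero_embDer_neg_one]
    | succ j =>
      rw [coeff_succ_embDer_neg_one, coeff_primitive]
      rw [show ((-1 : ℤˣ) : ℤ) * ((j + 1 : ℕ) : ℤ) = -j - 1 by simp; ring, ← hβ]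
      cases j with
      | zero => simp
      | succ j =>
        rw [C_div_smul_mul _ _ (Nat.succ_ne_zero j), if_pos (by omega)]
        simp
  · rw [if_neg]
    simp at hn
    omega

end Modes

/-! ### The creation and annihilation factors. -/

section Factors

variable {M : Type*} [AddCommGroup M] [Module ℂ⟦X⟧ M]

/-- The creation factor `E⁻(-a, x+z) E⁻(a, x) = exp(z L(z∂ₓ) a⁺(x))`. -/
theorem shift_EMinus_fmul_EMinus (hM : TopFree M) {z : ℂ⟦X⟧}
    (hz : PowerSeries.constantCoeff z = 0) {F : FSeries M}
    (hcomm : ∀ m n : ℕ, F m * F n = F n * F m) :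
    ExpConv (minusLog (-F)) ∧ ExpConv (minusLog F) ∧
      MulConv (shift z (EMinus (-F))) (EMinus F) ∧ ExpConv (zL z (regPart F)) ∧
      shift z (EMinus (-F)) ⊛ EMinus F = fexp (zL z (regPart F)) ∧
      (∀ k, ∀ n < 0, fpow (zL z (regPart F)) k n = 0) ∧
      (∀ n < 0, fexp (zL z (regPart F)) n = 0) ∧
      ∀ T : Module.End ℂ⟦X⟧ M, (∀ n : ℕ, F n * T = T * F n) →
        ∀ n, T * fexp (zL z (regPart F)) n = fexp (zL z (regPart F)) n * T := by
  obtain ⟨S, _, _, φ, hφ, hgen, hT⟩ := exists_closedModel hM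
    (A := Set.range fun n : ℕ => F n) (by rintro _ ⟨m, rfl⟩ _ ⟨n, rfl⟩; exact hcomm m n)
  choose s hs using fun n : ℕ => hgen (F n) ⟨n, rfl⟩
  -- The shift puts the mode `a_{-n}` at `α n`. The value `α 0` is spurious, and `primitive` ignores
  -- it.
  set α : ℕ → S := fun n => s (n - 1)
  have hα : ∀ n : ℕ, φ (α (n + 1)) = F n := hs
  have hα' : ∀ n : ℕ, φ ((-α) (n + 1)) = (-F) n := fun n => by
    rw [Pi.neg_apply, map_neg, hα, Pi.neg_apply]
  have hprim : primitive (-1) (-α) = primitive 1 α := by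
    ext n
    simp [coeff_primitive, neg_div]
  obtain ⟨h1, h2, h3, b, c, hbmem, -, hc, hb, hE⟩ := hφ.shift_fexp_fmul_fexp hM hz 1
    (primitive_mem 1 α) (hprim ▸ minusLog_eq_emb hα')
    ((minusLog_eq_emb hα).trans (by rw [primitive_neg])) (regPart_eq_emb hα)
  have hexp : fexp (zL z (regPart F)) = emb φ 1 c := by rw [hb, fexp_emb hM hc]
  refine ⟨h1, h2, h3, by rw [hb]; exact expConv_emb hM hc 1, hE.trans hexp.symm,
    fun k n hn => ?_, fun n hn => ?_, fun T h n => ?_⟩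
  · rw [hb, fpow_emb hM, emb_of_neg _ _ _ (by simpa using hn)]
  · rw [hexp, emb_of_neg _ _ _ (by simpa using hn)]
  · rw [hexp, emb]
    split_ifs
    · exact (hT _ T (by rintro _ ⟨m, rfl⟩; exact h m)).symm
    · simp

/-- The annihilation factor:
`exp(z L(z∂ₓ) a⁻(x)) = (1 + z/x)^{a_0} E⁺(-a, x+z) E⁺(a, x)`. -/
theorem onePlusPow_fmul_shift_EPlus_fmul_EPlus (hM : TopFree M) {z : ℂ⟦X⟧}
    (hz : PowerSeries.constantCoeff z = 0) {F : FSeries M}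
    (hcomm : ∀ m n : ℕ, F (-m - 1) * F (-n - 1) = F (-n - 1) * F (-m - 1))
    (hF : ∀ w, IsHLaurent fun n => F n w) :
    ExpConv (plusLog (-F)) ∧ ExpConv (plusLog F) ∧
      MulConv (shift z (EPlus (-F))) (EPlus F) ∧ ExpConv (zL z (singPart F)) ∧
      IsAnnihilating (shift z (EPlus (-F)) ⊛ EPlus F) ∧
      MulConv (onePlusPow z (mode F 0)) (shift z (EPlus (-F)) ⊛ EPlus F) ∧
      onePlusPow z (mode F 0) ⊛ (shift z (EPlus (-F)) ⊛ EPlus F) =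
        fexp (zL z (singPart F)) := by
  obtain ⟨S, _, _, φ, hφ, hgen, -⟩ := exists_closedModel hM
    (A := Set.range fun n : ℕ => F (-n - 1)) (by rintro _ ⟨m, rfl⟩ _ ⟨n, rfl⟩; exact hcomm m n)
  choose β hβ using fun n : ℕ => hgen (F (-n - 1)) ⟨n, rfl⟩
  have hβ' : ∀ n : ℕ, φ ((-β) n) = (-F) (-n - 1) := fun n => by
    rw [Pi.neg_apply, map_neg, hβ, Pi.neg_apply]
  have hprim : primitive 1 (-β) = primitive (-1) β := by
    ext n
    simp [coeff_primitive, neg_div]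
  obtain ⟨h1, h2, h3, b, c, hbmem, hbsum, hc, hb, hE⟩ := hφ.shift_fexp_fmul_fexp hM hz (-1)
    (primitive_mem (-1) β) (hprim ▸ plusLog_eq_emb hβ')
    ((plusLog_eq_emb hβ).trans (by rw [primitive_neg, neg_neg])) (singPart_tail_eq_emb hβ)
  have hmode : mode F 0 = φ (β 0) := by
    rw [hβ, mode]
    simp
  have hlog := logSeries_mem (φ := φ) (z := z) (β 0)
  obtain ⟨l, hl⟩ := hφ.exists_exp hlog
  obtain ⟨e, he⟩ := hφ.exists_exp (add_mem hlog hbmem)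
  have hpow : onePlusPow z (mode F 0) = emb φ (-1) l := by
    rw [onePlusPow, hmode, logTerm_eq_emb, fexp_emb hM hl]
  -- `zL(z∂)` is additive: the residue gives the logarithm and the rest gives `b`. All coefficients
  -- commute, so the exponential factors.
  have hsing : zL z (singPart F) = emb φ (-1) (logSeries z (β 0) + b) := by
    rw [singPart_eq_emb hβ, add_comm (embDer S (-1) _)]
    refine zL_emb hM ?_
    convert (hasSerSum_logSeries z (β 0)).add hbsum using 2 with k
    rw [zLTerm, iterate_map_add, smul_add]
    rfl
  have htail : IsAnnihilating fun n => if n < -1 then F n else 0 :=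
    { eq_zero := fun n hn => if_neg (by omega)
      laurent := fun w => IsHLaurent.of_exists fun r => by
        obtain ⟨k, hk⟩ := (hF w).exists_forall_lt r
        refine ⟨k, fun n hn => ?_⟩
        split_ifs
        · exact hk n hn
        · exact zero_mem _ }
  refine ⟨h1, h2, h3, by rw [hsing]; exact expConv_emb hM he _, ?_, ?_, ?_⟩
  · have := (htail.zL hM hz).fexp hM (by rw [hb]; exact expConv_emb hM hc _)
      (zL_mem_hFil hM hz _)
    rw [hb, fexp_emb hM hc, ← hE] at this
    exact this
  · rw [hpow, EPlus, EPlus, hE]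
    exact mulConv_emb _ _ _
  · rw [hpow, EPlus, EPlus, hE, emb_mul hM, hsing, fexp_emb hM he,
      hφ.exp_add hM hlog hbmem hl hc he]

end Factors

end HAdic

end

/-! ### Assembly of the proposition. -/

theorem proposition4p13 {V W : Type*} [AddCommGroup V] [Module (PowerSeries ℂ) V]
    [AddCommGroup W] [Module (PowerSeries ℂ) W]
    (𝒱 : NonlocalVA V) (𝒲 : VAModule 𝒱 W) (a : V)
    (γ : ℤ → PowerSeries ℂ) (hγ : IsSingularPoly γ)
    (h_reg : ∀ m n : ℤ, regPart (𝒱.Y a) m * regPart (𝒱.Y a) n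
      - regPart (𝒱.Y a) n * regPart (𝒱.Y a) m = 0)
    (h_sing : ∀ m n : ℤ, singPart (𝒱.Y a) m * singPart (𝒱.Y a) n
      - singPart (𝒱.Y a) n * singPart (𝒱.Y a) m = 0)
    (h_mixed : ∀ m n : ℤ, singPart (𝒱.Y a) m * regPart (𝒱.Y a) n
      - regPart (𝒱.Y a) n * singPart (𝒱.Y a) m
        = diffCoeff γ m n • (1 : Module.End (PowerSeries ℂ) V))
    (z : PowerSeries ℂ) (hz : PowerSeries.constantCoeff z = 0) :
    -- the vector `E⁻(-a, z) 1` is well defined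
    (OpSummable (minusTerm (𝒱.Y (-a)) z) ∧ OpExpConv (opSum (minusTerm (𝒱.Y (-a)) z))) ∧
    -- first formula, all the series in it being convergent
    (ZLConv z (regPart (𝒲.Y a)) ∧ ZLConv z (singPart (𝒲.Y a)) ∧
      ExpConv (zL z (regPart (𝒲.Y a))) ∧ ExpConv (zL z (singPart (𝒲.Y a))) ∧
      MulConv (fexp (zL z (regPart (𝒲.Y a)))) (fexp (zL z (singPart (𝒲.Y a)))) ∧
      𝒲.Y (EMinusAt (𝒱.Y (-a)) z 𝒱.vac)
        = fexp (zL z (regPart (𝒲.Y a))) ⊛ fexp (zL z (singPart (𝒲.Y a)))) ∧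
    -- the factors of the second formula are well defined
    (ExpConv (minusLog (𝒲.Y (-a))) ∧ ExpConv (minusLog (𝒲.Y a)) ∧
      ExpConv (plusLog (𝒲.Y (-a))) ∧ ExpConv (plusLog (𝒲.Y a)) ∧
      ShiftConv z (EMinus (𝒲.Y (-a))) ∧ ShiftConv z (EPlus (𝒲.Y (-a))) ∧
      ExpConv (logTerm z (mode (𝒲.Y a) 0)) ∧
      MulConv (shift z (EMinus (𝒲.Y (-a)))) (EMinus (𝒲.Y a)) ∧
      MulConv (shift z (EPlus (𝒲.Y (-a)))) (EPlus (𝒲.Y a))) ∧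
    -- second formula, with `(1 + z/x)^(a_0)` between the creation and the annihilation factors
    (MulConv (onePlusPow z (mode (𝒲.Y a) 0))
        (shift z (EPlus (𝒲.Y (-a))) ⊛ EPlus (𝒲.Y a)) ∧
      MulConv (shift z (EMinus (𝒲.Y (-a))) ⊛ EMinus (𝒲.Y a))
        (onePlusPow z (mode (𝒲.Y a) 0) ⊛ (shift z (EPlus (𝒲.Y (-a))) ⊛ EPlus (𝒲.Y a))) ∧
      𝒲.Y (EMinusAt (𝒱.Y (-a)) z 𝒱.vac)
        = (shift z (EMinus (𝒲.Y (-a))) ⊛ EMinus (𝒲.Y a)) ⊛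
          (onePlusPow z (mode (𝒲.Y a) 0) ⊛ (shift z (EPlus (𝒲.Y (-a))) ⊛ EPlus (𝒲.Y a)))) ∧
    -- second formula, with `(1 + z/x)^(a_0)` on the left, when `γ` has no `x⁻¹` term
    (MulConv (shift z (EMinus (𝒲.Y (-a))) ⊛ EMinus (𝒲.Y a))
        (shift z (EPlus (𝒲.Y (-a))) ⊛ EPlus (𝒲.Y a)) ∧
      MulConv (onePlusPow z (mode (𝒲.Y a) 0))
        ((shift z (EMinus (𝒲.Y (-a))) ⊛ EMinus (𝒲.Y a)) ⊛
          (shift z (EPlus (𝒲.Y (-a))) ⊛ EPlus (𝒲.Y a))) ∧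
      (γ (-1) = 0 →
        𝒲.Y (EMinusAt (𝒱.Y (-a)) z 𝒱.vac)
          = onePlusPow z (mode (𝒲.Y a) 0) ⊛
            ((shift z (EMinus (𝒲.Y (-a))) ⊛ EMinus (𝒲.Y a)) ⊛
              (shift z (EPlus (𝒲.Y (-a))) ⊛ EPlus (𝒲.Y a))))) := by
  have h := HeisenbergRel.of_parts h_reg h_sing h_mixed
  have hW := h.module hγ.1 𝒲
  have hM := 𝒲.topFree
  have hneg : 𝒲.Y (-a) = -𝒲.Y a := map_neg _ _
  obtain ⟨c1, c2, c3, c4, c5, c6, c7, c8⟩ := shift_EMinus_fmul_EMinus hM hz (F := 𝒲.Y a)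
    fun m n => hW.reg m n (by omega) (by omega)
  obtain ⟨d1, d2, d3, d4, d5, d6, d7⟩ := onePlusPow_fmul_shift_EPlus_fmul_EPlus hM hz (F := 𝒲.Y a)
    (fun m n => hW.sing _ _ (by omega) (by omega)) (𝒲.laurent a)
  have hconv : MulConv (fexp (zL z (regPart (𝒲.Y a)))) (fexp (zL z (singPart (𝒲.Y a)))) :=
    mulConv_of_hNull hM <| hNull_mul_left c7 (((isAnnihilating_singPart 𝒲 a).zL hM hz).fexp hM d4
      (zL_mem_hFil hM hz _)).laurent
  have hY := 𝒲.Y_EMinusAt h hW hz c6 c4 d4 hconv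
  obtain ⟨l1, l2⟩ := onePlusPow_fmul hM hz (mode (𝒲.Y a) 0) c7 d5
  have hsum : OpSummable (minusTerm (𝒱.Y (-a)) z) := by
    rw [funext (minusTerm_neg 𝒱 a z)]
    exact (hasOpSum_minusTerm 𝒱 a hz).opSummable
  -- The creation and annihilation factors are replaced by the two exponentials, which turns the
  -- second formula into the first.
  rw [hneg, c5, d7]
  refine ⟨⟨hsum, opExpConv_of_mem_hFil 𝒱.topFree (opSum_minusTerm_mem_hFil 𝒱 a hz)⟩,
    ⟨zLConv hM hz _, zLConv hM hz _, c4, d4, hconv, hY⟩,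
    ⟨c1, c2, d1, d2, shiftConv hM hz _, shiftConv hM hz _, (onePlusPow_spec hM hz _).1, c3, d3⟩,
    ⟨d6, hconv, hY⟩, mulConv_of_hNull hM (hNull_mul_left c7 d5.laurent), l1, fun hγ1 => ?_⟩
  rw [hY, ← d7]
  refine l2 (c8 _ fun n => ?_)
  -- The commutator of `a_0` with a creation mode is the binomial coefficient of `0` over `n` times
  -- `γ (n - 1)`, so only `γ (-1)` can obstruct.
  have hdiff : diffCoeff γ (-1) n = 0 := by
    have := diffCoeff_neg γ 0 n
    rw [Nat.cast_zero, neg_zero, zero_sub] at this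
    rw [this]
    cases n <;> simp [hγ1]
  have := hW.mixed (-1) n (by omega) (by omega)
  rw [hdiff, zero_smul, add_zero] at this
  exact this.symm
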